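/- Let $(\Omega,\mathcal G,\mathbb P)$ be a complete probability space and $\mathbb T=[0,1]$. Let $X\in L^2(\mathbb P)$ take values in $\mathbb X\subseteq\mathbb R$, let $\beta^{(1)},\dots,\beta^{(n)}$ be standard Brownian bridges on $[0,1]$ (centred Gaussian processes with continuous paths and covariance $\min(s,t)-st$) such that $X,\beta^{(1)},\dots,\beta^{(n)}$ are mutually independent, let $\sigma_i>0$, and put $\xi^{(i)}_t=tX+\sigma_i\beta^{(i)}_t$. Let $(\tilde J_t)_{t\in\mathbb T}$ be a càdlàg process with values in $\{0,1\}^n$, independent of $(\xi^{(1)},\dots,\xi^{(n)})$, let $\mathcal J_t=\{i:\tilde J^{(i)}_t=1\}$ be the set of active sources, and let $(\mathcal F_t)_{t\in\mathbb T}$ be the filtration generated by $(\tilde J^{(i)}_u\xi^{(i)}_u)_{i}$, $\tilde J_u$, $u\le t$, and $X\mathbf 1_{\{t=1\}}$, made complete and right-continuous. With $\tau^{(i)}_t=0\vee\sup\{u\le t:\tilde J^{(i)}_u=1\}$ and $h(x,y,t,\sigma)=\exp\{(xy-tx^2/2)/(\sigma^2(1-t))\}$, define $$\hat\sigma_t=\Big(\sum_{i\in\mathcal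 J_t}\sigma_i^{-2}\Big)^{-1/2},\qquad \hat\xi_t=\hat\sigma_t^2\sum_{i\in\mathcal J_t}\sigma_i^{-2}\xi^{(i)}_t,\qquad \eta_t(x)=\prod_{i\notin\mathcal J_t}h\big(x,\xi^{(i)}(\tau^{(i)}_t),\tau^{(i)}_t,\sigma_i\big)\quad(x\in\mathbb X),$$ with $\hat\sigma_t=\hat\xi_t=0$ if $\mathcal J_t=\emptyset$. Write $\mathbb E[X\,|\,\hat\xi_s,\eta_s]$ for the conditional expectation of $X$ given the effective information at time $s$ (the value $\hat\xi_s$ together with its volatility $\hat\sigma_s$) and the complementary information $\eta_s$, i.e. given $\sigma(\hat\xi_s,\hat\sigma_s,\eta_s)$. Let $C_t$ be the number of jumps of $\tilde J$ up to time $t$, let $\pi_j=\inf\{t:C_t=j\}$ (so $\pi_0=0$, and $\inf\emptyset=\infty$), and let $N_t$ be the number of jump times $s\le t$ with $\mathcal J_s\setminus\mathcal J_{s-}\neq\emptyset$. Define $$M_t=\sum_{j=1}^{C_t+1}M^{(j)}_t+\int_0^t(\hat\xi_s-\hat\xi_{s-})\,\mathrm dN_s,$$ where $M^{(j)}_t=0$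 for $t<\pi_{j-1}$ and, for $t\ge\pi_{j-1}$, $$M^{(j)}_t=(\hat\xi_{t\wedge\pi_j-}-\hat\xi_{\pi_{j-1}})-\int_{\pi_{j-1}}^{t\wedge\pi_j-}\frac{\mathbb E[X\,|\,\hat\xi_s,\eta_s]-\hat\xi_s}{1-s}\,\mathrm ds .$$ Here, for a process $Z$, $Z_{t\wedge\pi_j-}$ is $Z_t$ if $t<\pi_j$ and the left limit of $Z$ at $\pi_j$ if $t\ge\pi_j$. Then $(s,\omega)\mapsto\mathbb E[X\,|\,\hat\xi_s,\eta_s](\omega)$, $s<1$, has a jointly measurable version, and for every such version and every $j\ge1$ the process $M$ is an $(\mathcal F_t)$-martingale on the random interval $[\pi_{j-1},\pi_j)$ whenever at least one source is active there. Precisely, $\pi_{j-1}$ and $\pi_j$ are stopping times, and: 1. Let $A=\{\pi_{j-1}\le1,\ \mathcal J_{\pi_{j-1}}\ne\emptyset\}$. Almost surely on $A$, the integrand of $M^{(j)}$ is Lebesgue integrable over $[\pi_{j-1},\pi_j)\cap[0,1]$. For every $t\in[0,1]$, $A\cap\{\pi_{j-1}\le t\}\in\mathcal F_t$, and on this event the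 increment $M_{t\wedge\pi_j-}-M_{\pi_{j-1}}$ is $\mathcal F_t$-measurable and integrable, and for $t\le u\le 1$ $$\mathbb E[M_{u\wedge\pi_j-}-M_{\pi_{j-1}}\,|\,\mathcal F_t]=M_{t\wedge\pi_j-}-M_{\pi_{j-1}} .$$ 2. Let $A'=\{\pi_{j-1}\le1,\ \mathcal J_r\ne\emptyset\text{ for all }r\le\pi_{j-1}\}$. For every $t\in[0,1]$, $A'\cap\{\pi_{j-1}\le t\}\in\mathcal F_t$, and on this event $M_{t\wedge\pi_j-}$ itself is $\mathcal F_t$-measurable and integrable, and for $t\le u\le1$ $$\mathbb E[M_{u\wedge\pi_j-}\,|\,\mathcal F_t]=M_{t\wedge\pi_j-},$$ which equals $M_t$ if $\pi_{j-1}\le t<\pi_j$. -/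

import Mathlib

open MeasureTheory ProbabilityTheory Filter Topology
open scoped unitInterval

noncomputable section

/-- A standard Brownian bridge on `[0,1]`: a centred Gaussian process with continuous paths and
covariance function `(s, t) ↦ min s t - s * t`. -/
structure IsBrownianBridge {Ω : Type*} [MeasurableSpace Ω] (β : I → Ω → ℝ) (P : Measure Ω) :
    Prop where
  measurable : ∀ t, Measurable (β t)
  gaussian : IsGaussianProcess β P
  mean : ∀ t, ∫ ω, β t ω ∂P = 0
  covariance : ∀ s t, cov[β s, β t; P] = min (s : ℝ) t - (s : ℝ) * t
  continuous : ∀ ω, Continuous fun t => β t ω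

/-- A path on `[0,1]` which is right-continuous with left limits. -/
def IsCadlagPath {E : Type*} [TopologicalSpace E] (f : I → E) : Prop :=
  ∀ t, ContinuousWithinAt f (Set.Ici t) t ∧ ∃ l, Tendsto f (𝓝[<] t) (𝓝 l)

/-- The data of the model: a square-integrable signal `X` with values in `S ⊆ ℝ`, independent
standard Brownian bridges `β i` with volatilities `vol i > 0`, and a càdlàg jump process `J` on
`{0,1}ⁿ` (`J t ω i = true` when source `i` is active at time `t`), independent of the information
processes `t X + vol i * β i t`. -/
structure ModulatedInformation {Ω : Type*} [MeasurableSpace Ω] (P : Measure Ω) (n : ℕ) where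
  S : Set ℝ
  X : Ω → ℝ
  vol : Fin n → ℝ
  β : Fin n → I → Ω → ℝ
  J : I → Ω → Fin n → Bool
  X_mem : ∀ ω, X ω ∈ S
  X_measurable : Measurable X
  X_memLp : MemLp X 2 P
  vol_pos : ∀ i, 0 < vol i
  bridge : ∀ i, IsBrownianBridge (β i) P
  /-- `X` and the Brownian bridges are mutually independent (see also the next field). -/
  bridges_indep : iIndepFun (fun i ω (t : I) => β i t ω) P
  X_indep : IndepFun X (fun ω (i : Fin n) (t : I) => β i t ω) P
  J_measurable : ∀ t, Measurable (J t)
  J_cadlag : ∀ ω, IsCadlagPath fun t => J t ω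
  J_indep : IndepFun (fun ω (t : I) => J t ω)
    (fun ω (t : I) (i : Fin n) => (t : ℝ) * X ω + vol i * β i t ω) P

/-- The Gaussian function `h(x, y, t, v) = exp((x y - t x² / 2) / (v² (1 - t)))`. -/
def gaussH (x y t v : ℝ) : ℝ := Real.exp ((x * y - t * x ^ 2 / 2) / (v ^ 2 * (1 - t)))

/-- The value `Z_{t ∧ τ-}`: it is `Z t` before `τ`, and the left limit of `Z` at `τ` from `τ` on. -/
def stoppedBefore (Z : I → ℝ) (τ : WithTop I) (t : I) : ℝ :=
  open Classical in if (t : WithTop I) < τ then Z t else Function.leftLim Z (τ.untopD 1)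

namespace ModulatedInformation

variable {Ω : Type*} [m : MeasurableSpace Ω] {P : Measure Ω} {n : ℕ}

/-- The information process `ξ⁽ⁱ⁾`. -/
def xi (D : ModulatedInformation P n) (i : Fin n) (t : I) (ω : Ω) : ℝ :=
  (t : ℝ) * D.X ω + D.vol i * D.β i t ω

/-- The set of active sources at time `t`. -/
def active (D : ModulatedInformation P n) (t : I) (ω : Ω) : Finset (Fin n) :=
  Finset.univ.filter fun i => D.J t ω i = true

/-- The modulated information process: its `i`-th coordinate is `ξ⁽ⁱ⁾_t` when source `i` is active
and `0` otherwise. -/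
def modulated (D : ModulatedInformation P n) (t : I) (ω : Ω) (i : Fin n) : ℝ :=
  if D.J t ω i = true then D.xi i t ω else 0

/-- The σ-algebra generated by the modulated information and the switching process up to time `t`,
and by `X` when `t = 1`. -/
@[reducible] def rawSigma (D : ModulatedInformation P n) (t : I) : MeasurableSpace Ω :=
  (⨆ u ≤ t, MeasurableSpace.comap (D.modulated u) inferInstance) ⊔
  (⨆ u ≤ t, MeasurableSpace.comap (D.J u) inferInstance) ⊔
  MeasurableSpace.comap (fun ω => if t = 1 then D.X ω else 0) inferInstance

/-- The σ-algebra generated by the null events. -/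
@[reducible] def nullSigma (P : Measure Ω) : MeasurableSpace Ω :=
  MeasurableSpace.generateFrom {N | MeasurableSet N ∧ P N = 0}

lemma measurable_modulated (D : ModulatedInformation P n) (t : I) :
    Measurable (D.modulated t) := by
  refine measurable_pi_lambda _ fun i => ?_
  refine Measurable.ite ?_ ?_ measurable_const
  · exact ((measurable_pi_apply i).comp (D.J_measurable t)) (measurableSet_singleton true)
  · exact (D.X_measurable.const_mul _).add (((D.bridge i).measurable t).const_mul _)

lemma rawSigma_le (D : ModulatedInformation P n) (t : I) : D.rawSigma t ≤ m := by
  refine sup_le (sup_le ?_ ?_) ?_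
  · exact iSup₂_le fun u _ => (D.measurable_modulated u).comap_le
  · exact iSup₂_le fun u _ => (D.J_measurable u).comap_le
  · by_cases h : t = 1
    · simpa [h] using D.X_measurable.comap_le
    · simp [h]

lemma rawSigma_mono (D : ModulatedInformation P n) : Monotone D.rawSigma := by
  intro s t hst
  refine sup_le_sup (sup_le_sup ?_ ?_) ?_
  · exact biSup_mono fun u hu => le_trans hu hst
  · exact biSup_mono fun u hu => le_trans hu hst
  · by_cases h : s = 1
    · have ht : t = 1 := le_antisymm unitInterval.le_one' (h ▸ hst)
      simp [h, ht]
    · simp [h]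

lemma nullSigma_le : nullSigma P ≤ m :=
  MeasurableSpace.generateFrom_le fun _ h => h.1

/-- The filtration `(F_t)`, made complete and right-continuous. -/
def filtration (D : ModulatedInformation P n) : Filtration I m :=
  Filtration.rightCont
    { seq := fun t => D.rawSigma t ⊔ nullSigma P
      mono' := fun _ _ h => sup_le_sup_right (D.rawSigma_mono h) _
      le' := fun t => sup_le (D.rawSigma_le t) nullSigma_le }

/-- The last time up to `t` at which source `i` was active (`0` if there is none). -/
def lastActive (D : ModulatedInformation P n) (i : Fin n) (t : I) (ω : Ω) : I :=
  sSup {u | u ≤ t ∧ D.J u ω i = true}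

/-- The effective volatility `(∑_{i active} σᵢ⁻²)^{-1/2}`; it is `0` when no source is active,
since `0⁻¹ = 0`. -/
def volHat (D : ModulatedInformation P n) (t : I) (ω : Ω) : ℝ :=
  (√(∑ i ∈ D.active t ω, (D.vol i ^ 2)⁻¹))⁻¹

/-- The effective information process; it is `0` when no source is active. -/
def xiHat (D : ModulatedInformation P n) (t : I) (ω : Ω) : ℝ :=
  D.volHat t ω ^ 2 * ∑ i ∈ D.active t ω, (D.vol i ^ 2)⁻¹ * D.xi i t ω

/-- The complementary information process, with values in the functions on the state space of the
signal. -/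
def eta (D : ModulatedInformation P n) (t : I) (ω : Ω) (x : D.S) : ℝ :=
  ∏ i ∈ (D.active t ω)ᶜ,
    gaussH x (D.xi i (D.lastActive i t ω) ω) (D.lastActive i t ω) (D.vol i)

/-- The σ-algebra generated at time `t` by the effective information (its value and its volatility)
and by the complementary information. -/
@[reducible] def infoSigma (D : ModulatedInformation P n) (t : I) : MeasurableSpace Ω :=
  MeasurableSpace.comap (fun ω => (D.xiHat t ω, D.volHat t ω, D.eta t ω)) inferInstance

/-- `Y` is a jointly measurable version of `t ↦ E[X | ξ̂_t, η_t]`, `t ∈ [0,1)`. -/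
structure IsBestEstimate (D : ModulatedInformation P n) (Y : I → Ω → ℝ) : Prop where
  measurable : Measurable (Function.uncurry Y)
  version : ∀ t : I, t < 1 → Y t =ᵐ[P] P[D.X | D.infoSigma t]

/-- The number of state changes up to and including time `t`; the left limit at `0` is the value
at `0`, so there is no state change at `0`. -/
def changes (D : ModulatedInformation P n) (t : I) (ω : Ω) : ℕ :=
  Set.ncard {s : I | s ≤ t ∧ D.J s ω ≠ Function.leftLim (fun r => D.J r ω) s}

/-- The time of the `j`-th state change, `∞` if there are fewer than `j` of them, and `0` for
`j = 0`. -/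
def changeTime (D : ModulatedInformation P n) (j : ℕ) (ω : Ω) : WithTop I :=
  sInf {u | ∃ t : I, u = (t : WithTop I) ∧ D.changes t ω = j}

/-- The times at which at least one inactive source becomes active. -/
def activations (D : ModulatedInformation P n) (ω : Ω) : Set I :=
  {s | ∃ i, D.J s ω i = true ∧ Function.leftLim (fun r => D.J r ω) s i = false}

/-- The drift `(E[X | ξ̂_s, η_s] - ξ̂_s) / (1 - s)`, for a version `Y` of the conditional
expectation. -/
def drift (D : ModulatedInformation P n) (Y : I → Ω → ℝ) (s : I) (ω : Ω) : ℝ :=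
  (Y s ω - D.xiHat s ω) / (1 - (s : ℝ))

/-- The process `M⁽ʲ⁾`. -/
def piece (D : ModulatedInformation P n) (Y : I → Ω → ℝ) (j : ℕ) (t : I) (ω : Ω) : ℝ :=
  open Classical in
  if (t : WithTop I) < D.changeTime (j - 1) ω then 0
  else
    (stoppedBefore (fun r => D.xiHat r ω) (D.changeTime j ω) t
        - D.xiHat ((D.changeTime (j - 1) ω).untopD 0) ω)
      - ∫ s in {s : I | D.changeTime (j - 1) ω ≤ s ∧ s ≤ t ∧ (s : WithTop I) < D.changeTime j ω},
          D.drift Y s ω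

/-- The process `M`: the sum of the pieces, and the sum over the activation times of the jumps of
the effective information process (its integral against the process that counts activations). -/
def M (D : ModulatedInformation P n) (Y : I → Ω → ℝ) (t : I) (ω : Ω) : ℝ :=
  ∑ j ∈ Finset.Icc 1 (D.changes t ω + 1), D.piece Y j t ω
    + ∑ᶠ s ∈ {s : I | s ≤ t} ∩ D.activations ω,
        (D.xiHat s ω - Function.leftLim (fun r => D.xiHat r ω) s)

/-- The increments of `M` after the `k`-th state change. -/
def increment (D : ModulatedInformation P n) (Y : I → Ω → ℝ) (k : ℕ) (t : I) (ω : Ω) : ℝ :=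
  D.M Y t ω - D.M Y ((D.changeTime k ω).untopD 0) ω

/-- The event that the `k`-th state change takes place and leaves at least one source active. -/
def activeFrom (D : ModulatedInformation P n) (k : ℕ) : Set Ω :=
  {ω | ∃ s : I, D.changeTime k ω = s ∧ (D.active s ω).Nonempty}

/-- The event that the `k`-th state change takes place and at least one source is active at each
time up to it. -/
def activeUpTo (D : ModulatedInformation P n) (k : ℕ) : Set Ω :=
  {ω | ∃ s : I, D.changeTime k ω = s ∧ ∀ r ≤ s, (D.active r ω).Nonempty}

end ModulatedInformation

/-- On the event `A`, the process `Z` is an `F`-martingale on the random interval `[ρ, τ)`: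
`ρ`, `τ` are stopping times, `A` is known at time `ρ`, and, on the event `A ∩ {ρ ≤ t}`, the process
`Z_{t ∧ τ-}` is adapted and integrable with `E[Z_{u ∧ τ-} | F_t] = Z_{t ∧ τ-}` for `t ≤ u` (which
is `Z_t` if moreover `t < τ`). -/
structure IsMartingaleOn {Ω : Type*} {m : MeasurableSpace Ω} (Z : I → Ω → ℝ)
    (ρ τ : Ω → WithTop I) (A : Set Ω) (F : Filtration I m) (P : Measure Ω) : Prop where
  stopping_left : IsStoppingTime F ρ
  stopping_right : IsStoppingTime F τ
  event : ∀ t : I, MeasurableSet[F t] (A ∩ {ω | ρ ω ≤ t})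
  adapted : ∀ t : I, StronglyMeasurable[F t]
    ((A ∩ {ω | ρ ω ≤ t}).indicator fun ω => stoppedBefore (fun r => Z r ω) (τ ω) t)
  integrable : ∀ t : I, Integrable
    ((A ∩ {ω | ρ ω ≤ t}).indicator fun ω => stoppedBefore (fun r => Z r ω) (τ ω) t) P
  condExp_eq : ∀ t u : I, t ≤ u →
    P[(A ∩ {ω | ρ ω ≤ t}).indicator (fun ω => stoppedBefore (fun r => Z r ω) (τ ω) u) | F t]
      =ᵐ[P] (A ∩ {ω | ρ ω ≤ t}).indicator fun ω => stoppedBefore (fun r => Z r ω) (τ ω) t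

end

/-! Between two state changes the set of active sources is fixed, and the effective information is
`t X` plus a weighted sum of bridges, because the weights of the active sources add up to one
(`effective_eq`). This process reaches `X` at time `1`, so from any earlier time it is expected to
move towards `X` at the rate given by the drift. Two points need work: the switching is random, and
the drift contains the conditional expectation given `xiHat`, `volHat`, `eta` only.

Freezing the switching. The process `J` is independent of the signal and the bridges
(`indep_switch_signal`), so the observations may be enlarged by the whole path of `J` (`wholeSigma`)
without disturbing the noise. For a frozen path, an observable event before time `1` is an event of
the information processes, each run up to its last active time (`fullSigma_le_liftSigma`). By
independence, an integral over the diagonal is an iterated integral in which `J` is fixed first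
(`setIntegral_eq_zero_of_lift`). Statements about random times thus reduce to deterministic ones.

Sufficiency. At deterministic times `c` the signal enters the data through `score c`, which is
`precision c * X` plus an independent centred Gaussian variable of variance `precision c`; what
remains of the data is independent of the signal and of that noise. Bayes' formula then gives the
conditional expectation as a posterior mean (`posteriorMean_score`). The likelihood behind it is a
function of `xiHat`, `volHat` and `eta` (`likelihood_eq`). Hence conditioning on these three, on the
observations, or on the observations together with all of `J`, gives the same estimate of `X`
(`estimate_ae_eq_condExp`).

Drift. With `β_s = (1-s)/(1-r) β_r + innovation`, the innovation being centred and independent of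
the signal and of the past of `r`, the effective information after `r` is a line of slope `slope`
plus innovations, and its distance to `X` at time `s` is `(1-s) * slope` minus innovations. Over
events known at `r`, the increment of the effective information and the integral of the drift
therefore have the same integral, that of `occupation * slope` (`setIntegral_level_sub`,
`setIntegral_compensator_sub`). The drift is integrable up to time `1` because `X - xiHat` has mean
size of order `√(1-s)` while a source is active.

Conclusion. The difference, `segment`, is adapted and has constant integrals over events of the
enlarged past; continuity in mean from the right carries this over to the right-continuous
filtration (`condExp_segment`). Pathwise, `M` on the interval is a quantity known at its start plus
`segment` (`M_eq`, `M_switchTime_eq`), which gives both martingale statements. -/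

open MeasureTheory ProbabilityTheory Filter Topology
open scoped unitInterval

noncomputable section

/-! ### Jumps of càdlàg paths with values in a discrete space. -/

section CadlagPaths

variable {E : Type*} [TopologicalSpace E] [DiscreteTopology E] {f : I → E}

/-- The number of discontinuities of a path on `[0, t]`. -/
def pathChanges (f : I → E) (t : I) : ℕ :=
  Set.ncard {s : I | s ≤ t ∧ f s ≠ Function.leftLim f s}

/-- The first time at which a path has had `k` discontinuities. -/
def pathChangeTime (f : I → E) (k : ℕ) : WithTop I :=
  sInf {u | ∃ t : I, u = (t : WithTop I) ∧ pathChanges f t = k}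

lemma IsCadlagPath.eventually_left (hf : IsCadlagPath f) (t : I) :
    ∀ᶠ s in 𝓝[<] t, f s = Function.leftLim f t := by
  have h := tendsto_leftLim_of_tendsto (hf t).2
  rw [nhds_discrete] at h
  exact tendsto_pure.1 h

lemma IsCadlagPath.eventually_right (hf : IsCadlagPath f) (t : I) :
    ∀ᶠ s in 𝓝[≥] t, f s = f t := by
  have h := (hf t).1
  rw [ContinuousWithinAt, nhds_discrete] at h
  exact tendsto_pure.1 h

lemma leftLim_eq_of_eventually_eq {t : I} {c : E} (h : ∀ᶠ s in 𝓝 t, f s = c) :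
    f t = Function.leftLim f t := by
  have hc : ContinuousAt f t := by
    rw [ContinuousAt, h.self_of_nhds, nhds_discrete E]
    exact tendsto_pure.2 h
  exact hc.continuousWithinAt.leftLim_eq.symm

omit [DiscreteTopology E] in
lemma leftLim_zero_eq : f 0 = Function.leftLim f 0 :=
  (leftLim_eq_of_isBot (fun _ => unitInterval.nonneg')).symm

lemma IsCadlagPath.eventually_left_not_jump (hf : IsCadlagPath f) (t : I) :
    ∀ᶠ s in 𝓝[<] t, f s = Function.leftLim f s := by
  have h := eventually_eventually_nhdsWithin.2 (hf.eventually_left t)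
  filter_upwards [h, self_mem_nhdsWithin] with s hs hst
  rw [isOpen_Iio.nhdsWithin_eq hst] at hs
  exact leftLim_eq_of_eventually_eq hs

lemma IsCadlagPath.eventually_right_not_jump (hf : IsCadlagPath f) (t : I) :
    ∀ᶠ s in 𝓝[>] t, f s = Function.leftLim f s := by
  have h := eventually_eventually_nhdsWithin.2
    ((hf.eventually_right t).filter_mono (nhdsWithin_mono t Set.Ioi_subset_Ici_self))
  filter_upwards [h, self_mem_nhdsWithin] with s hs hst
  rw [isOpen_Ioi.nhdsWithin_eq hst] at hs
  exact leftLim_eq_of_eventually_eq hs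

/-- By compactness infinitely many jumps would accumulate somewhere, but a path in a discrete space
is constant on a punctured one-sided neighbourhood of every time. -/
lemma IsCadlagPath.finite_jumps (hf : IsCadlagPath f) :
    {s : I | f s ≠ Function.leftLim f s}.Finite := by
  by_contra hinf
  obtain ⟨t, ht⟩ := Set.Infinite.exists_accPt_principal hinf
  have hev : ∀ᶠ s in 𝓝[≠] t, f s = Function.leftLim f s := by
    rw [← Set.Iio_union_Ioi, nhdsWithin_union]
    exact eventually_sup.2 ⟨hf.eventually_left_not_jump t, hf.eventually_right_not_jump t⟩
  obtain ⟨s, hs, hs'⟩ := ((accPt_iff_frequently_nhdsNE.1 ht).and_eventually hev).exists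
  exact hs hs'

/-- Without jumps the path is continuous on the interval, and a continuous map from a connected set
to a discrete space is constant. -/
lemma IsCadlagPath.eq_of_no_jump (hf : IsCadlagPath f) {a b : I} (hab : a ≤ b)
    (h : ∀ s, a < s → s ≤ b → f s = Function.leftLim f s) : f a = f b := by
  have hc : ContinuousOn f (Set.Icc a b) := by
    intro s hs
    have hright : ContinuousWithinAt f (Set.Ici s) s := (hf s).1
    rcases hs.1.eq_or_lt with rfl | has
    · exact hright.mono Set.Icc_subset_Ici_self
    · have hleft : ContinuousWithinAt f (Set.Iic s) s := by
        rw [← Set.Iio_insert, continuousWithinAt_insert_self, ContinuousWithinAt, h s has hs.2]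
        exact tendsto_leftLim_of_tendsto (hf s).2
      refine (hleft.union hright).mono ?_
      rw [Set.Iic_union_Ici]
      exact Set.subset_univ _
  exact isPreconnected_Icc.constant hc (Set.left_mem_Icc.2 hab) (Set.right_mem_Icc.2 hab)

omit [DiscreteTopology E] in
lemma pathChanges_zero : pathChanges f 0 = 0 := by
  have : {s : I | s ≤ 0 ∧ f s ≠ Function.leftLim f s} = ∅ := by
    ext s
    simp only [Set.mem_ofPred_eq, Set.mem_empty_iff_false, iff_false, not_and, not_not]
    intro hs
    obtain rfl : s = 0 := le_antisymm hs unitInterval.nonneg'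
    exact leftLim_zero_eq
  rw [pathChanges, this, Set.ncard_empty]

lemma IsCadlagPath.pathChanges_add (hf : IsCadlagPath f) {a b : I} (hab : a ≤ b) :
    pathChanges f b = pathChanges f a
      + Set.ncard {s : I | (a < s ∧ s ≤ b) ∧ f s ≠ Function.leftLim f s} := by
  rw [pathChanges, pathChanges, ← Set.ncard_union_eq ?_ (hf.finite_jumps.subset fun s hs => hs.2)
    (hf.finite_jumps.subset fun s hs => hs.2)]
  · congr 1
    ext s
    simp only [Set.mem_ofPred_eq, Set.mem_union]
    constructor
    · rintro ⟨h1, h2⟩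
      rcases le_or_gt s a with h | h
      · exact Or.inl ⟨h, h2⟩
      · exact Or.inr ⟨⟨h, h1⟩, h2⟩
    · rintro (⟨h1, h2⟩ | ⟨h1, h2⟩)
      · exact ⟨h1.trans hab, h2⟩
      · exact ⟨h1.2, h2⟩
  · refine Set.disjoint_left.2 fun s hs hs' => ?_
    exact absurd hs.1 (not_le.2 hs'.1.1)

lemma IsCadlagPath.pathChanges_mono (hf : IsCadlagPath f) : Monotone (pathChanges f) :=
  fun a b hab => by rw [hf.pathChanges_add hab]; exact Nat.le_add_right _ _

lemma IsCadlagPath.no_jump_of_pathChanges_eq (hf : IsCadlagPath f) {a b : I} (hab : a ≤ b)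
    (h : pathChanges f a = pathChanges f b) (s : I) (has : a < s) (hsb : s ≤ b) :
    f s = Function.leftLim f s := by
  rw [hf.pathChanges_add hab] at h
  have h0 : Set.ncard {s : I | (a < s ∧ s ≤ b) ∧ f s ≠ Function.leftLim f s} = 0 := by omega
  rw [Set.ncard_eq_zero (hf.finite_jumps.subset fun s hs => hs.2)] at h0
  by_contra hne
  exact (Set.eq_empty_iff_forall_notMem.1 h0 s) ⟨⟨has, hsb⟩, hne⟩

lemma IsCadlagPath.eq_of_pathChanges_eq (hf : IsCadlagPath f) {a b : I}
    (h : pathChanges f a = pathChanges f b) : f a = f b := by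
  rcases le_total a b with hab | hab
  · exact hf.eq_of_no_jump hab (hf.no_jump_of_pathChanges_eq hab h)
  · exact (hf.eq_of_no_jump hab (hf.no_jump_of_pathChanges_eq hab h.symm)).symm

lemma IsCadlagPath.pathChanges_eq_of_no_jump (hf : IsCadlagPath f) {a b : I} (hab : a ≤ b)
    (h : ∀ s, a < s → s ≤ b → f s = Function.leftLim f s) :
    pathChanges f a = pathChanges f b := by
  rw [hf.pathChanges_add hab]
  have : {s : I | (a < s ∧ s ≤ b) ∧ f s ≠ Function.leftLim f s} = ∅ :=
    Set.eq_empty_iff_forall_notMem.2 fun s hs => hs.2 (h s hs.1.1 hs.1.2)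
  rw [this, Set.ncard_empty, add_zero]

lemma IsCadlagPath.pathChanges_lt_of_ne (hf : IsCadlagPath f) {a b : I} (hab : a ≤ b)
    (h : f a ≠ f b) : pathChanges f a < pathChanges f b :=
  lt_of_le_of_ne (hf.pathChanges_mono hab) fun hE => h (hf.eq_of_pathChanges_eq hE)

lemma IsCadlagPath.eventually_right_pathChanges (hf : IsCadlagPath f) (t : I) :
    ∀ᶠ s in 𝓝[≥] t, pathChanges f s = pathChanges f t := by
  rw [← Set.Ioi_insert, nhdsWithin_insert, eventually_sup]
  refine ⟨eventually_pure.2 rfl, ?_⟩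
  rcases eq_or_lt_of_le (unitInterval.le_one' (t := t)) with rfl | ht
  · have : Set.Ioi (1 : I) = ∅ := Set.eq_empty_iff_forall_notMem.2
      fun s hs => absurd (unitInterval.le_one' (t := s)) (not_le.2 hs)
    simp [this]
  obtain ⟨u, hu, hsub⟩ := (mem_nhdsGT_iff_exists_Ioo_subset' ht).1 (hf.eventually_right_not_jump t)
  filter_upwards [Ioo_mem_nhdsGT hu] with s hs
  exact (hf.pathChanges_eq_of_no_jump hs.1.le
    fun r hr hrs => hsub ⟨hr, hrs.trans_lt hs.2⟩).symm

lemma IsCadlagPath.eventually_left_pathChanges (hf : IsCadlagPath f) {t : I} (ht : 0 < t) :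
    ∀ᶠ s in 𝓝[<] t, pathChanges f t ≤ pathChanges f s + 1 := by
  obtain ⟨u, hu, hsub⟩ := (mem_nhdsLT_iff_exists_Ioo_subset' ht).1 (hf.eventually_left_not_jump t)
  filter_upwards [Ioo_mem_nhdsLT hu] with s hs
  rw [hf.pathChanges_add hs.2.le]
  have hle : Set.ncard {r : I | (s < r ∧ r ≤ t) ∧ f r ≠ Function.leftLim f r} ≤ 1 := by
    refine (Set.ncard_le_ncard (t := {t}) (fun r hr => ?_)).trans (Set.ncard_singleton t).le
    by_contra hne
    exact hr.2 (hsub ⟨hs.1.trans hr.1.1, lt_of_le_of_ne hr.1.2 hne⟩)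
  omega

/-- The time is the infimum of those with count at least `k`. Right-continuity of the count shows
that the infimum is attained; the count grows by at most one at a single time, so it does not
overshoot `k` there. -/
lemma IsCadlagPath.exists_pathChanges_eq (hf : IsCadlagPath f) {k : ℕ} {t : I}
    (h : k ≤ pathChanges f t) :
    ∃ p ≤ t, pathChanges f p = k ∧ ∀ s < p, pathChanges f s < k := by
  set p := sInf {s : I | k ≤ pathChanges f s} with hp
  have hlt : ∀ s < p, pathChanges f s < k := fun s hs => by
    by_contra hk
    exact absurd (sInf_le (show s ∈ {s : I | k ≤ pathChanges f s} from not_lt.1 hk)) (not_le.2 hs)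
  have hge : k ≤ pathChanges f p := by
    by_contra hk
    have hpt : p < t := lt_of_le_of_ne (sInf_le h) fun hE => hk (hE ▸ h)
    obtain ⟨u, hu, hsub⟩ := (mem_nhdsGE_iff_exists_Ico_subset' hpt).1
      (hf.eventually_right_pathChanges p)
    have : u ≤ p := le_sInf fun s hs => by
      by_contra hsu
      have hps : p ≤ s := sInf_le hs
      have : pathChanges f s = pathChanges f p := hsub ⟨hps, not_le.1 hsu⟩
      exact hk (this ▸ hs)
    exact absurd hu (not_lt.2 this)
  refine ⟨p, sInf_le h, le_antisymm ?_ hge, hlt⟩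
  rcases eq_or_lt_of_le (unitInterval.nonneg' (t := p)) with h0 | h0
  · rw [← h0, pathChanges_zero]; exact Nat.zero_le k
  · have : (𝓝[<] p).NeBot := nhdsLT_neBot_of_exists_lt ⟨0, h0⟩
    obtain ⟨s, hs, hsp⟩ := ((hf.eventually_left_pathChanges h0).and self_mem_nhdsWithin).exists
    have := hlt s hsp
    omega

/-- `pathChangeTime` is an infimum over times with count exactly `k`. Since the count skips no
value, it is also the first time with count at least `k`; from here on, change times are handled
through counts alone. -/
lemma IsCadlagPath.pathChangeTime_le_iff (hf : IsCadlagPath f) {k : ℕ} {t : I} :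
    pathChangeTime f k ≤ t ↔ k ≤ pathChanges f t := by
  constructor
  · intro h
    by_contra hk
    by_cases hS : ∃ s, pathChanges f s = k
    · obtain ⟨s, hs⟩ := hS
      obtain ⟨p, -, hpk, hp⟩ := hf.exists_pathChanges_eq hs.ge
      have hle : (p : WithTop I) ≤ pathChangeTime f k := by
        refine le_sInf ?_
        rintro _ ⟨r, rfl, hr⟩
        by_contra hrp
        have := hp r (WithTop.coe_lt_coe.1 (not_le.1 hrp))
        omega
      have hpt : p ≤ t := WithTop.coe_le_coe.1 (hle.trans h)
      have := hf.pathChanges_mono hpt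
      omega
    · have hE : {u | ∃ t : I, u = (t : WithTop I) ∧ pathChanges f t = k} = ∅ :=
        Set.eq_empty_iff_forall_notMem.2 fun u hu => hu.elim fun t ht => hS ⟨t, ht.2⟩
      rw [pathChangeTime, hE, sInf_empty] at h
      exact absurd h (not_le.2 (WithTop.coe_lt_top t))
  · intro h
    obtain ⟨p, hpt, hpk, -⟩ := hf.exists_pathChanges_eq h
    have hmem : (p : WithTop I) ∈ {u : WithTop I | ∃ t : I, u = t ∧ pathChanges f t = k} :=
      ⟨p, rfl, hpk⟩
    exact (sInf_le hmem).trans (WithTop.coe_le_coe.2 hpt)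

lemma IsCadlagPath.lt_pathChangeTime_iff (hf : IsCadlagPath f) {k : ℕ} {t : I} :
    (t : WithTop I) < pathChangeTime f k ↔ pathChanges f t < k := by
  rw [← not_le, hf.pathChangeTime_le_iff, not_le]

lemma IsCadlagPath.pathChanges_changeTime (hf : IsCadlagPath f) {k : ℕ} {p : I}
    (h : pathChangeTime f k = p) : pathChanges f p = k := by
  have h1 : k ≤ pathChanges f p := hf.pathChangeTime_le_iff.1 h.le
  obtain ⟨q, hq, hqk, -⟩ := hf.exists_pathChanges_eq h1
  have : p ≤ q := WithTop.coe_le_coe.1 (h ▸ hf.pathChangeTime_le_iff.2 hqk.ge)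
  rw [le_antisymm this hq, hqk]

lemma IsCadlagPath.pathChangeTime_zero (hf : IsCadlagPath f) : pathChangeTime f 0 = (0 : I) :=
  le_antisymm (hf.pathChangeTime_le_iff.2 (Nat.zero_le _)) (by
    rcases h : pathChangeTime f 0 with _ | p
    · exact le_top
    · exact WithTop.coe_le_coe.2 unitInterval.nonneg')

lemma exists_mem_dense_lt {D : Set I} (hD : Dense D) {a b : I} (hab : a < b) :
    ∃ q ∈ D, a < q ∧ q < b := by
  obtain ⟨q, hq, hqD⟩ := hD.exists_between hab
  exact ⟨q, hq, hqD⟩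

omit [TopologicalSpace E] [DiscreteTopology E] in
lemma exists_mem_dense_right {D : Set I} (hD : Dense D) {s t : I} {p : I → Prop}
    (ht : t ∈ D) (hst : s ≤ t) (hp : ∀ᶠ q in 𝓝[≥] s, p q) :
    ∃ q ∈ D, s ≤ q ∧ q ≤ t ∧ p q := by
  rcases hst.eq_or_lt with rfl | hlt
  · exact ⟨s, ht, le_rfl, le_rfl, hp.self_of_nhdsWithin Set.self_mem_Ici⟩
  · obtain ⟨u, hu, hsub⟩ := (mem_nhdsGE_iff_exists_Ico_subset' hlt).1 hp
    obtain ⟨q, hqD, hsq, hq⟩ := exists_mem_dense_lt hD (lt_min hlt hu)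
    exact ⟨q, hqD, hsq.le, (hq.trans_le (min_le_left _ _)).le,
      hsub ⟨hsq.le, hq.trans_le (min_le_right _ _)⟩⟩

/-- This describes the count by the path on a countable set of times, whence its measurability. The
times `a` and `b` are taken shortly before and shortly after the jump; `t` must belong to the dense
set in case the jump happens at `t` itself. -/
lemma IsCadlagPath.succ_le_pathChanges_iff (hf : IsCadlagPath f) {D : Set I} (hD : Dense D)
    {t : I} (ht : t ∈ D) (k : ℕ) :
    k + 1 ≤ pathChanges f t ↔
      ∃ a ∈ D, ∃ b ∈ D, a ≤ b ∧ b ≤ t ∧ k ≤ pathChanges f a ∧ f a ≠ f b := by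
  constructor
  · intro h
    obtain ⟨p, hpt, hpk, hp⟩ := hf.exists_pathChanges_eq h
    obtain ⟨b, hbD, hpb, hbt, hb⟩ :=
      exists_mem_dense_right hD ht hpt (hf.eventually_right_pathChanges p)
    have h0 : 0 < p := by
      refine lt_of_le_of_ne unitInterval.nonneg' fun h0 => ?_
      rw [← h0, pathChanges_zero] at hpk
      omega
    obtain ⟨u, hu, hsub⟩ := (mem_nhdsLT_iff_exists_Ioo_subset' h0).1
      (((hf.eventually_left_pathChanges h0).and (hf.eventually_left p)).and
        (hf.eventually_left_not_jump p))
    obtain ⟨a, haD, hua, hap⟩ := exists_mem_dense_lt hD hu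
    obtain ⟨⟨ha1, ha2⟩, -⟩ := hsub ⟨hua, hap⟩
    -- If `f a = f b`, the path would not jump at `p`, nor between `a` and `p` by the choice of `a`,
    -- so the count would already have its value at `p` when the time is `a`.
    refine ⟨a, haD, b, hbD, hap.le.trans hpb, hbt, by omega, fun hE => ?_⟩
    have hpp : f p = Function.leftLim f p := by
      rw [← ha2, hE]
      exact (hf.eq_of_pathChanges_eq hb).symm
    have hC : pathChanges f a = pathChanges f p :=
      hf.pathChanges_eq_of_no_jump hap.le fun s has hsp => by
        rcases hsp.eq_or_lt with rfl | hsp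
        · exact hpp
        · exact (hsub ⟨hua.trans has, hsp⟩).2
    have := hp a hap
    omega
  · rintro ⟨a, -, b, -, hab, hbt, hka, hne⟩
    have h1 := hf.pathChanges_lt_of_ne hab hne
    have h2 := hf.pathChanges_mono hbt
    omega

end CadlagPaths

/-! ### Measurability of functionals of the switching path. -/

section PathMeasurability

variable {Ω' : Type*} [MeasurableSpace Ω'] {n : ℕ}

/-- Approximation of a time from the right by a time in a countable grid. -/
def gridAbove (m j : ℕ) : I := Set.projIcc 0 1 zero_le_one (((j : ℝ) + 1) / (m + 1))

lemma tendsto_gridAbove (s : I) :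
    Tendsto (fun m : ℕ => gridAbove m ⌊(s : ℝ) * (m + 1)⌋₊) atTop (𝓝[≥] s) := by
  have hs := s.2
  refine tendsto_nhdsWithin_iff.2 ⟨?_, Eventually.of_forall fun m => ?_⟩
  · have h1 : Tendsto (fun m : ℕ => ((⌊(s : ℝ) * (m + 1)⌋₊ : ℝ) + 1) / ((m : ℝ) + 1)) atTop
        (𝓝 (s : ℝ)) := by
      have h2 : Tendsto (fun m : ℕ => (s : ℝ) + 1 / ((m : ℝ) + 1)) atTop (𝓝 (s : ℝ)) := by
        simpa using tendsto_const_nhds.add (tendsto_one_div_add_atTop_nhds_zero_nat (𝕜 := ℝ))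
      refine tendsto_of_tendsto_of_tendsto_of_le_of_le tendsto_const_nhds h2 (fun m => ?_)
        (fun m => ?_)
      · have hm : (0 : ℝ) < m + 1 := by positivity
        change (s : ℝ) ≤ _
        rw [le_div_iff₀ hm]
        exact (Nat.lt_floor_add_one _).le
      · have hm : (0 : ℝ) < m + 1 := by positivity
        change _ ≤ (s : ℝ) + 1 / ((m : ℝ) + 1)
        rw [div_le_iff₀ hm, add_mul, one_div, inv_mul_cancel₀ hm.ne']
        have := Nat.floor_le (mul_nonneg hs.1 hm.le)
        linarith
    have h3 := (continuous_projIcc (h := zero_le_one (α := ℝ))).continuousAt.tendsto.comp h1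
    rwa [Set.projIcc_val] at h3
  · have hm : (0 : ℝ) < m + 1 := by positivity
    have h1 : (s : ℝ) ≤ ((⌊(s : ℝ) * (m + 1)⌋₊ : ℝ) + 1) / ((m : ℝ) + 1) := by
      rw [le_div_iff₀ hm]
      exact (Nat.lt_floor_add_one _).le
    have h2 := Set.monotone_projIcc (zero_le_one (α := ℝ)) h1
    rwa [Set.projIcc_val] at h2

/-- Replacing the time by the next point of a countable grid gives a jointly measurable function,
and right-continuity lets the mesh tend to zero. -/
lemma measurable_uncurry_of_rightContinuous {E : Type*} [TopologicalSpace E]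
    [TopologicalSpace.PseudoMetrizableSpace E] [MeasurableSpace E] [BorelSpace E]
    {Z : I → Ω' → E} (hm : ∀ t, Measurable (Z t))
    (hc : ∀ ω t, ContinuousWithinAt (fun s => Z s ω) (Set.Ici t) t) :
    Measurable (Function.uncurry Z) := by
  refine measurable_of_tendsto_metrizable (f := fun (m : ℕ) (p : I × Ω') =>
    Z (gridAbove m ⌊(p.1 : ℝ) * (m + 1)⌋₊) p.2) (fun m => ?_) (tendsto_pi_nhds.2 fun p => ?_)
  · have h1 : Measurable (fun q : ℕ × Ω' => Z (gridAbove m q.1) q.2) :=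
      measurable_from_prod_countable_right fun j => hm (gridAbove m j)
    have h2 : Measurable (fun p : I × Ω' => ((⌊(p.1 : ℝ) * (m + 1)⌋₊, p.2) : ℕ × Ω')) := by
      refine Measurable.prodMk (Nat.measurable_floor.comp ?_) measurable_snd
      exact (measurable_subtype_coe.comp measurable_fst).mul_const _
    simpa only [Function.comp_def] using h1.comp h2
  · exact (hc p.2 p.1).tendsto.comp (tendsto_gridAbove p.1)

/-- The last time up to `t` at which the `i`-th coordinate of a path is `true`. -/
def pathLastActive (f : I → Fin n → Bool) (i : Fin n) (t : I) : I :=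
  sSup {u | u ≤ t ∧ f u i = true}

variable {f : I → Fin n → Bool}

lemma pathLastActive_le (i : Fin n) (t : I) : pathLastActive f i t ≤ t :=
  sSup_le fun _ hu => hu.1

lemma le_pathLastActive {i : Fin n} {u t : I} (hut : u ≤ t) (hu : f u i = true) :
    u ≤ pathLastActive f i t := le_sSup (⟨hut, hu⟩ : u ∈ {u | u ≤ t ∧ f u i = true})

lemma pathLastActive_eq_self {i : Fin n} {t : I} (h : f t i = true) :
    pathLastActive f i t = t := le_antisymm (pathLastActive_le i t) (le_pathLastActive le_rfl h)

/-- An active source stays active for a while, so an active time can be moved to the right into the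
dense set. -/
lemma IsCadlagPath.lt_pathLastActive_iff (hf : IsCadlagPath f) {D : Set I} (hD : Dense D)
    {i : Fin n} {c t : I} (ht : t ∈ D) :
    c < pathLastActive f i t ↔ ∃ q ∈ D, q ≤ t ∧ c < q ∧ f q i = true := by
  rw [pathLastActive, lt_sSup_iff]
  constructor
  · rintro ⟨u, ⟨hut, hu⟩, hcu⟩
    obtain ⟨q, hqD, huq, hqt, hq⟩ := exists_mem_dense_right hD ht hut (hf.eventually_right u)
    exact ⟨q, hqD, hqt, hcu.trans_le huq, by rw [hq, hu]⟩
  · rintro ⟨q, -, hqt, hcq, hq⟩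
    exact ⟨q, ⟨hqt, hq⟩, hcq⟩

/-- Just after `t` the path keeps its value: the last active time stands still if the source is
inactive at `t`, and equals the current time if it is active. -/
lemma IsCadlagPath.pathLastActive_rightContinuous (hf : IsCadlagPath f) (i : Fin n) (t : I) :
    ContinuousWithinAt (fun s => pathLastActive f i s) (Set.Ici t) t := by
  rcases hb : f t i with _ | _
  · have hev : ∀ᶠ s in 𝓝[≥] t, pathLastActive f i s = pathLastActive f i t := by
      rcases eq_or_lt_of_le (unitInterval.le_one' (t := t)) with rfl | ht
      · filter_upwards [self_mem_nhdsWithin] with s hs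
        rw [le_antisymm unitInterval.le_one' hs]
      obtain ⟨u, hu, hsub⟩ := (mem_nhdsGE_iff_exists_Ico_subset' ht).1 (hf.eventually_right t)
      filter_upwards [Ico_mem_nhdsGE hu] with s hs
      refine le_antisymm (sSup_le fun r hr => ?_) (sSup_le_sSup fun r hr => ⟨hr.1.trans hs.1, hr.2⟩)
      refine le_pathLastActive ?_ hr.2
      by_contra hrt
      have h1 : f r = f t := hsub ⟨(not_le.1 hrt).le, hr.1.trans_lt hs.2⟩
      have h2 := hr.2
      rw [h1, hb] at h2
      exact Bool.false_ne_true h2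
    exact (tendsto_congr' hev).2 tendsto_const_nhds
  · have hev : ∀ᶠ s in 𝓝[≥] t, pathLastActive f i s = s := by
      filter_upwards [hf.eventually_right t] with s hs
      exact pathLastActive_eq_self (by rw [hs, hb])
    rw [ContinuousWithinAt, pathLastActive_eq_self hb, tendsto_congr' hev]
    exact tendsto_nhdsWithin_of_tendsto_nhds tendsto_id

/-- A countable dense set of times that contains `t`. -/
def denseTimes (t : I) : Set I := insert t (TopologicalSpace.denseSeq I '' Set.univ)

lemma countable_denseTimes (t : I) : (denseTimes t).Countable :=
  ((Set.countable_univ).image _).insert _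

lemma dense_denseTimes (t : I) : Dense (denseTimes t) :=
  (TopologicalSpace.denseRange_denseSeq I).mono (by
    rw [denseTimes, Set.image_univ]; exact Set.subset_insert _ _)

lemma self_mem_denseTimes (t : I) : t ∈ denseTimes t := Set.mem_insert _ _

variable {J : I → Ω' → Fin n → Bool}

lemma measurable_lastActive {t : I} (hJ : ∀ u ≤ t, Measurable (J u))
    (hc : ∀ ω, IsCadlagPath fun u => J u ω) (i : Fin n) :
    Measurable fun ω => pathLastActive (fun u => J u ω) i t := by
  refine measurable_of_Ioi fun c => ?_
  have : (fun ω => pathLastActive (fun u => J u ω) i t) ⁻¹' Set.Ioi c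
      = ⋃ q ∈ denseTimes t, {ω | q ≤ t ∧ c < q ∧ J q ω i = true} := by
    ext ω
    simp only [Set.mem_preimage, Set.mem_Ioi, Set.mem_iUnion, Set.mem_ofPred_eq, exists_prop]
    exact (hc ω).lt_pathLastActive_iff (dense_denseTimes t) (self_mem_denseTimes t)
  rw [this]
  refine MeasurableSet.biUnion (countable_denseTimes t) fun q _ => ?_
  by_cases hq : q ≤ t
  · have := ((measurable_pi_apply i).comp (hJ q hq)) (measurableSet_singleton true)
    by_cases hcq : c < q
    · simp only [hq, hcq, true_and]
      exact this
    · simp [hcq]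
  · simp [hq]

lemma measurableSet_le_pathChanges (hc : ∀ ω, IsCadlagPath fun u => J u ω) (k : ℕ) (t : I)
    (hJ : ∀ u ≤ t, Measurable (J u)) :
    MeasurableSet {ω | k ≤ pathChanges (fun u => J u ω) t} := by
  induction k generalizing t with
  | zero => simp
  | succ k ih =>
    have : {ω | k + 1 ≤ pathChanges (fun u => J u ω) t}
        = ⋃ a ∈ denseTimes t, ⋃ b ∈ denseTimes t,
          {ω | a ≤ b ∧ b ≤ t ∧ k ≤ pathChanges (fun u => J u ω) a ∧ J a ω ≠ J b ω} := by
      ext ω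
      simp only [Set.mem_iUnion, Set.mem_ofPred_eq, exists_prop]
      exact (hc ω).succ_le_pathChanges_iff (dense_denseTimes t) (self_mem_denseTimes t) k
    rw [this]
    refine MeasurableSet.biUnion (countable_denseTimes t) fun a _ =>
      MeasurableSet.biUnion (countable_denseTimes t) fun b _ => ?_
    by_cases hab : a ≤ b
    · by_cases hbt : b ≤ t
      · simp only [hab, hbt, true_and]
        refine (ih a fun u hu => hJ u (hu.trans (hab.trans hbt))).inter ?_
        exact (measurableSet_eq_fun (hJ a (hab.trans hbt)) (hJ b hbt)).compl
      · simp [hbt]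
    · simp [hab]

lemma measurable_pathChanges (hc : ∀ ω, IsCadlagPath fun u => J u ω) {t : I}
    (hJ : ∀ u ≤ t, Measurable (J u)) :
    Measurable fun ω => pathChanges (fun u => J u ω) t :=
  measurable_of_Ici fun k => measurableSet_le_pathChanges hc k t hJ

lemma measurable_uncurry_J (hJ : ∀ u, Measurable (J u)) (hc : ∀ ω, IsCadlagPath fun u => J u ω) :
    Measurable fun p : I × Ω' => J p.1 p.2 :=
  measurable_uncurry_of_rightContinuous hJ fun ω t => (hc ω t).1

lemma measurable_uncurry_lastActive (hJ : ∀ u, Measurable (J u))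
    (hc : ∀ ω, IsCadlagPath fun u => J u ω) (i : Fin n) :
    Measurable fun p : I × Ω' => pathLastActive (fun u => J u p.2) i p.1 :=
  measurable_uncurry_of_rightContinuous (Z := fun t ω => pathLastActive (fun u => J u ω) i t)
    (fun _ => measurable_lastActive (fun u _ => hJ u) hc i)
    fun ω t => (hc ω).pathLastActive_rightContinuous i t

lemma measurable_uncurry_pathChanges (hJ : ∀ u, Measurable (J u))
    (hc : ∀ ω, IsCadlagPath fun u => J u ω) :
    Measurable fun p : I × Ω' => pathChanges (fun u => J u p.2) p.1 :=
  measurable_uncurry_of_rightContinuous (Z := fun t ω => pathChanges (fun u => J u ω) t)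
    (fun _ => measurable_pathChanges hc (fun u _ => hJ u))
    fun ω t => (tendsto_congr' ((hc ω).eventually_right_pathChanges t)).2 tendsto_const_nhds

/-- The time of the `k`-th change, with the value `1` if there is none. -/
def pathTime (f : I → Fin n → Bool) (k : ℕ) : I := (pathChangeTime f k).untopD 1

lemma measurable_min_pathTime (hc : ∀ ω, IsCadlagPath fun u => J u ω) (k : ℕ) {t : I}
    (hJ : ∀ u ≤ t, Measurable (J u)) :
    Measurable fun ω => min t (pathTime (fun u => J u ω) k) := by
  refine measurable_of_Iic fun c => ?_
  rcases le_or_gt t c with h | h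
  · have : (fun ω => min t (pathTime (fun u => J u ω) k)) ⁻¹' Set.Iic c = Set.univ :=
      Set.eq_univ_of_forall fun ω => (min_le_left _ _).trans h
    rw [this]
    exact MeasurableSet.univ
  · have : (fun ω => min t (pathTime (fun u => J u ω) k)) ⁻¹' Set.Iic c
        = {ω | k ≤ pathChanges (fun u => J u ω) c} := by
      ext ω
      simp only [Set.mem_preimage, Set.mem_Iic, Set.mem_ofPred_eq, min_le_iff, not_le.2 h,
        false_or, ← (hc ω).pathChangeTime_le_iff, pathTime]
      rcases hE : pathChangeTime (fun u => J u ω) k with _ | p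
      -- When there is no `k`-th change, `pathTime` has the value `1`, which exceeds `c`; so the
      -- convention agrees with the count staying below `k`.
      · have h1 : c < 1 := h.trans_le unitInterval.le_one'
        constructor
        · intro hle; exact absurd hle (not_le.2 h1)
        · intro hle; exact absurd hle (not_le.2 (WithTop.coe_lt_top c))
      · exact WithTop.coe_le_coe.symm
    rw [this]
    exact measurableSet_le_pathChanges hc k c fun u hu => hJ u (hu.trans h.le)

lemma measurable_pathTime (hc : ∀ ω, IsCadlagPath fun u => J u ω) (k : ℕ)
    (hJ : ∀ u, Measurable (J u)) : Measurable fun ω => pathTime (fun u => J u ω) k := by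
  have h := measurable_min_pathTime hc k (t := 1) fun u _ => hJ u
  simpa only [min_eq_right unitInterval.le_one'] using h

end PathMeasurability

/-! ### Freezing one of two independent σ-algebras. -/

section Diagonal

variable {Ω : Type*}

/-- The space `Ω` equipped with the σ-algebra `m'`. -/
def SubSpace {Ω : Type*} (_m' : MeasurableSpace Ω) : Type _ := Ω

instance {m' : MeasurableSpace Ω} : MeasurableSpace (SubSpace m') := m'

/-- The identity, as a map onto a coarser measurable space. -/
def toSub (m' : MeasurableSpace Ω) (ω : Ω) : SubSpace m' := ω

/-- The identity, as a map from the copy `SubSpace m'` of `Ω`. -/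
def ofSub {m' : MeasurableSpace Ω} (ω : SubSpace m') : Ω := ω

variable {m₁ m₂ m : MeasurableSpace Ω} {P : Measure Ω}

lemma measurable_toSub (h₁ : m₁ ≤ m) : Measurable (toSub m₁) := fun s hs => h₁ s hs

/-- The same sample point is used twice on the left, two independent ones on the right. Only `m₁` is
seen in one coordinate and only `m₂` in the other, so independence makes the two laws equal. -/
lemma map_diag_of_indep [IsProbabilityMeasure P] (h₁ : m₁ ≤ m) (h₂ : m₂ ≤ m)
    (hind : Indep m₁ m₂ P) :
    P.map (fun ω => (toSub m₁ ω, toSub m₂ ω))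
      = (P.prod P).map (fun p : Ω × Ω => (toSub m₁ p.1, toSub m₂ p.2)) := by
  have hU : Measurable (toSub m₁) := measurable_toSub h₁
  have hV : Measurable (toSub m₂) := measurable_toSub h₂
  have hUV : IndepFun (toSub m₁) (toSub m₂) P := by
    rw [IndepFun_iff_Indep]
    have e₁ : MeasurableSpace.comap (toSub m₁) inferInstance = m₁ := MeasurableSpace.comap_id
    have e₂ : MeasurableSpace.comap (toSub m₂) inferInstance = m₂ := MeasurableSpace.comap_id
    rwa [e₁, e₂]
  rw [(indepFun_iff_map_prod_eq_prod_map_map hU.aemeasurable hV.aemeasurable).1 hUV,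
    Measure.map_prod_map _ _ hU hV]
  rfl

/-- Fubini applies after passing to the product: the bound `K` on the inner integrals, uniform in
the frozen point, gives integrability there. -/
lemma integral_diag_of_indep [IsProbabilityMeasure P] (h₁ : m₁ ≤ m) (h₂ : m₂ ≤ m)
    (hind : Indep m₁ m₂ P) {F : SubSpace m₁ × SubSpace m₂ → ℝ} (hF : Measurable F)
    (hi : ∀ ω, Integrable (fun ω' : Ω => F (toSub m₁ ω, toSub m₂ ω')) P) {K : ℝ}
    (hK : ∀ ω, ∫ ω', |F (toSub m₁ ω, toSub m₂ ω')| ∂P ≤ K) :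
    Integrable (fun ω : Ω => F (toSub m₁ ω, toSub m₂ ω)) P ∧
      ∫ ω : Ω, F (toSub m₁ ω, toSub m₂ ω) ∂P = ∫ ω : Ω, ∫ ω' : Ω, F (toSub m₁ ω, toSub m₂ ω') ∂P ∂P := by
  have hU : Measurable (toSub m₁) := measurable_toSub h₁
  have hV : Measurable (toSub m₂) := measurable_toSub h₂
  have hd : Measurable (fun ω : Ω => (toSub m₁ ω, toSub m₂ ω)) := hU.prodMk hV
  have hp : Measurable (fun p : Ω × Ω => (toSub m₁ p.1, toSub m₂ p.2)) :=
    (hU.comp measurable_fst).prodMk (hV.comp measurable_snd)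
  have hFp : Measurable (fun p : Ω × Ω => F (toSub m₁ p.1, toSub m₂ p.2)) := hF.comp hp
  have hint : Integrable (fun p : Ω × Ω => F (toSub m₁ p.1, toSub m₂ p.2)) (P.prod P) := by
    refine (integrable_prod_iff hFp.aestronglyMeasurable).2 ⟨ae_of_all _ hi, ?_⟩
    refine Integrable.of_bound (C := K)
      hFp.norm.stronglyMeasurable.integral_prod_right'.aestronglyMeasurable
      (ae_of_all _ fun ω => ?_)
    rw [Real.norm_of_nonneg (integral_nonneg fun _ => norm_nonneg _)]
    exact hK ω
  have hmap := map_diag_of_indep h₁ h₂ hind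
  constructor
  · have h1 : Integrable F ((P.prod P).map
        (fun p : Ω × Ω => (toSub m₁ p.1, toSub m₂ p.2))) :=
      (integrable_map_measure hF.aestronglyMeasurable hp.aemeasurable).2 hint
    rw [← hmap] at h1
    exact (integrable_map_measure hF.aestronglyMeasurable hd.aemeasurable).1 h1
  · calc ∫ ω : Ω, F (toSub m₁ ω, toSub m₂ ω) ∂P
        = ∫ q, F q ∂(P.map (fun ω => (toSub m₁ ω, toSub m₂ ω))) :=
          (integral_map hd.aemeasurable hF.aestronglyMeasurable).symm
      _ = ∫ p : Ω × Ω, F (toSub m₁ p.1, toSub m₂ p.2) ∂(P.prod P) := by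
          rw [hmap]; exact integral_map hp.aemeasurable hF.aestronglyMeasurable
      _ = _ := integral_prod _ hint

/-- The events that are diagonal sections of events of `m₁ ⊗ m₂` whose sections at `ω` belong
to `C ω`. -/
@[reducible] def liftSigma (m₁ m₂ : MeasurableSpace Ω) (C : Ω → MeasurableSpace Ω) :
    MeasurableSpace Ω where
  MeasurableSet' A := ∃ B : Set (SubSpace m₁ × SubSpace m₂), MeasurableSet B ∧
    (∀ ω : Ω, ω ∈ A ↔ (toSub m₁ ω, toSub m₂ ω) ∈ B) ∧
    ∀ ω : Ω, MeasurableSet[C ω] {ω' : Ω | (toSub m₁ ω, toSub m₂ ω') ∈ B}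
  measurableSet_empty := ⟨∅, MeasurableSet.empty, fun _ => Iff.rfl, fun ω =>
    @MeasurableSet.empty Ω (C ω)⟩
  measurableSet_compl := by
    rintro A ⟨B, hB, hAB, hC⟩
    exact ⟨Bᶜ, hB.compl, fun ω => not_congr (hAB ω), fun ω => (hC ω).compl⟩
  measurableSet_iUnion := by
    intro A hA
    choose B hB hAB hC using hA
    refine ⟨⋃ i, B i, MeasurableSet.iUnion hB, fun ω => ?_, fun ω => ?_⟩
    · simp only [Set.mem_iUnion, hAB]
    · have : {ω' : Ω | (toSub m₁ ω, toSub m₂ ω') ∈ ⋃ i, B i}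
          = ⋃ i, {ω' : Ω | (toSub m₁ ω, toSub m₂ ω') ∈ B i} := by
        ext ω'; simp
      rw [this]
      exact MeasurableSet.iUnion fun i => hC i ω

lemma le_liftSigma_left {C : Ω → MeasurableSpace Ω} : m₁ ≤ liftSigma m₁ m₂ C := by
  intro A hA
  have hA' : @MeasurableSet (SubSpace m₁) _ A := hA
  exact ⟨Prod.fst ⁻¹' A, measurable_fst hA', fun ω => Iff.rfl, fun ω =>
    @MeasurableSet.const Ω (C ω) (ω ∈ A)⟩

/-- After freezing the first coordinate, the set `A` becomes an event of `C ω`, over which the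
integral vanishes by assumption. This is how conditional expectations at deterministic times are
transferred to times determined by the switching. -/
lemma setIntegral_eq_zero_of_lift [IsProbabilityMeasure P] (h₁ : m₁ ≤ m) (h₂ : m₂ ≤ m)
    (hind : Indep m₁ m₂ P) {C : Ω → MeasurableSpace Ω} (hC : ∀ ω, C ω ≤ m)
    {A : Set Ω} (hA : MeasurableSet[liftSigma m₁ m₂ C] A) (hAm : MeasurableSet A)
    {F : SubSpace m₁ × SubSpace m₂ → ℝ} (hF : Measurable F)
    (hi : ∀ ω, Integrable (fun ω' : Ω => F (toSub m₁ ω, toSub m₂ ω')) P) {K : ℝ}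
    (hK : ∀ ω, ∫ ω', |F (toSub m₁ ω, toSub m₂ ω')| ∂P ≤ K)
    (h0 : ∀ (ω : Ω) (B : Set Ω), MeasurableSet[C ω] B → ∫ ω' in B, F (toSub m₁ ω, toSub m₂ ω') ∂P = 0) :
    ∫ ω in A, F (toSub m₁ ω, toSub m₂ ω) ∂P = 0 := by
  obtain ⟨B, hB, hAB, hBC⟩ := hA
  have hG : Measurable (B.indicator F) := hF.indicator hB
  have hle : ∀ q, |B.indicator F q| ≤ |F q| := fun q => by
    by_cases hq : q ∈ B
    · rw [Set.indicator_of_mem hq]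
    · rw [Set.indicator_of_notMem hq, abs_zero]; exact abs_nonneg _
  have hmeas : ∀ ω : Ω, Measurable fun ω' : Ω => B.indicator F (toSub m₁ ω, toSub m₂ ω') := fun ω => by
    have h : Measurable (toSub m₂) := measurable_toSub h₂
    exact (hG.comp measurable_prodMk_left).comp h
  have hi' : ∀ ω, Integrable (fun ω' : Ω => B.indicator F (toSub m₁ ω, toSub m₂ ω')) P := fun ω =>
    (hi ω).mono (hmeas ω).aestronglyMeasurable (ae_of_all _ fun ω' => hle (toSub m₁ ω, toSub m₂ ω'))
  have hK' : ∀ ω, ∫ ω', |B.indicator F (toSub m₁ ω, toSub m₂ ω')| ∂P ≤ K := fun ω =>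
    (integral_mono (hi' ω).abs (hi ω).abs fun ω' => hle (toSub m₁ ω, toSub m₂ ω')).trans (hK ω)
  have h := (integral_diag_of_indep h₁ h₂ hind hG hi' hK').2
  rw [← integral_indicator hAm]
  have h1 : (A.indicator fun ω : Ω => F (toSub m₁ ω, toSub m₂ ω)) = fun ω : Ω => B.indicator F (toSub m₁ ω, toSub m₂ ω) := by
    ext ω
    by_cases hω : ω ∈ A
    · rw [Set.indicator_of_mem hω, Set.indicator_of_mem ((hAB ω).1 hω)]
    · rw [Set.indicator_of_notMem hω, Set.indicator_of_notMem fun h => hω ((hAB ω).2 h)]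
  rw [h1, h]
  refine (integral_congr_ae (ae_of_all _ fun ω => ?_)).trans (integral_zero _ _)
  change ∫ ω' : Ω, B.indicator F (toSub m₁ ω, toSub m₂ ω') ∂P = 0
  rw [← h0 ω _ (hBC ω), ← integral_indicator (hC ω _ (hBC ω))]
  rfl

end Diagonal

/-! ### Bayes' formula for a signal observed in Gaussian noise. -/

section Bayes

/-- The mean of the posterior distribution of `X`, whose density with respect to the law of `X` is
proportional to `x ↦ exp (x y - b x² / 2)`. -/
def posteriorMean {Ω : Type*} {m : MeasurableSpace Ω} (P : Measure Ω) (X : Ω → ℝ) (y b : ℝ) : ℝ :=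
  (∫ ω, X ω * Real.exp (X ω * y - b * X ω ^ 2 / 2) ∂P)
    / ∫ ω, Real.exp (X ω * y - b * X ω ^ 2 / 2) ∂P

/-- Completing the square turns the density into a shift of the mean. For `b = 0` both sides are the
Dirac mass at `0`, where the density equals `1`. -/
lemma gaussianReal_withDensity_shift (b : NNReal) (x : ℝ) :
    (gaussianReal 0 b).withDensity
      (fun y => ENNReal.ofReal (Real.exp (x * y - b * x ^ 2 / 2))) = gaussianReal (b * x) b := by
  by_cases hb : b = 0
  · subst hb
    simp only [NNReal.coe_zero, zero_mul, gaussianReal_zero_var]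
    refine Measure.ext fun s hs => ?_
    rw [withDensity_apply _ hs, ← lintegral_indicator hs,
      lintegral_dirac' _ (Measurable.indicator (by fun_prop) hs), Measure.dirac_apply' _ hs]
    by_cases h0 : (0 : ℝ) ∈ s <;> simp [h0]
  · rw [gaussianReal_of_var_ne_zero _ hb, gaussianReal_of_var_ne_zero _ hb,
      ← withDensity_mul _ (measurable_gaussianPDF _ _) (by fun_prop)]
    congr 1
    ext y
    simp only [Pi.mul_apply, gaussianPDF]
    rw [← ENNReal.ofReal_mul (gaussianPDFReal_nonneg _ _ _)]
    congr 1
    simp only [gaussianPDFReal]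
    rw [mul_assoc, ← Real.exp_add]
    congr 2
    have : (b : ℝ) ≠ 0 := by exact_mod_cast hb
    field_simp
    ring

variable {Ω : Type*} {m : MeasurableSpace Ω} {P : Measure Ω} [IsProbabilityMeasure P]

lemma map_prod_add_gaussian {X N : Ω → ℝ} (hX : Measurable X) (hN : Measurable N)
    (hind : IndepFun X N P) {b : NNReal} (hNb : P.map N = gaussianReal 0 b) :
    P.map (fun ω => (X ω, b * X ω + N ω)) = ((P.map X).prod (gaussianReal 0 b)).withDensity
      (fun p => ENNReal.ofReal (Real.exp (p.1 * p.2 - b * p.1 ^ 2 / 2))) := by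
  have hμ : IsProbabilityMeasure (P.map X) := Measure.isProbabilityMeasure_map hX.aemeasurable
  have hg : Measurable fun p : ℝ × ℝ => (p.1, (b : ℝ) * p.1 + p.2) := by fun_prop
  have h1 : P.map (fun ω => (X ω, b * X ω + N ω))
      = ((P.map X).prod (gaussianReal 0 b)).map (fun p => (p.1, (b : ℝ) * p.1 + p.2)) := by
    rw [← hNb, ← (indepFun_iff_map_prod_eq_prod_map_map hX.aemeasurable hN.aemeasurable).1 hind,
      Measure.map_map hg (hX.prodMk hN)]
    rfl
  rw [h1]
  refine Measure.ext fun s hs => ?_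
  have hk : Measurable fun p : ℝ × ℝ =>
    ENNReal.ofReal (Real.exp (p.1 * p.2 - b * p.1 ^ 2 / 2)) := by fun_prop
  rw [Measure.map_apply hg hs, Measure.prod_apply (hg hs), withDensity_apply _ hs,
    ← lintegral_indicator hs, lintegral_prod _ (hk.indicator hs).aemeasurable]
  refine lintegral_congr fun x => ?_
  have hsx : MeasurableSet (Prod.mk x ⁻¹' s) := measurable_prodMk_left hs
  have h2 : gaussianReal (b * x) b = (gaussianReal 0 b).map (fun y => b * x + y) := by
    rw [gaussianReal_map_const_add, zero_add]
  calc gaussianReal 0 b (Prod.mk x ⁻¹' ((fun p : ℝ × ℝ => (p.1, b * p.1 + p.2)) ⁻¹' s))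
      = gaussianReal (b * x) b (Prod.mk x ⁻¹' s) := by
        rw [h2, Measure.map_apply (by fun_prop) hsx]; rfl
    _ = _ := by
        rw [← gaussianReal_withDensity_shift, withDensity_apply _ hsx, ← lintegral_indicator hsx]
        rfl

/-- By `map_prod_add_gaussian` the pair (signal, observation) has density `k` with respect to a
product measure. The conditional mean given the observation is then the quotient of the integrals of
`k * x` and `k` over the law of the signal. -/
theorem posteriorMean_ae_eq_condExp {X N : Ω → ℝ} (hX : Measurable X) (hN : Measurable N)
    (hXi : Integrable X P) (hind : IndepFun X N P) {b : NNReal}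
    (hNb : P.map N = gaussianReal 0 b) :
    (fun ω => posteriorMean P X (b * X ω + N ω) b)
      =ᵐ[P] P[X | MeasurableSpace.comap (fun ω => b * X ω + N ω) inferInstance] := by
  have hμ : IsProbabilityMeasure (P.map X) := Measure.isProbabilityMeasure_map hX.aemeasurable
  set μ := P.map X with hμdef
  set γ := gaussianReal 0 b with hγ
  set k : ℝ × ℝ → ℝ := fun p => Real.exp (p.1 * p.2 - b * p.1 ^ 2 / 2) with hk
  have hkm : Measurable k := by fun_prop
  have hk0 : ∀ p, 0 < k p := fun p => Real.exp_pos _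
  set L : Ω → ℝ := fun ω => b * X ω + N ω with hL
  have hLm : Measurable L := by fun_prop
  have hXL : Measurable fun ω => (X ω, L ω) := hX.prodMk hLm
  have hmap : P.map (fun ω => (X ω, L ω)) = (μ.prod γ).withDensity
      (fun p => ENNReal.ofReal (k p)) := map_prod_add_gaussian hX hN hind hNb
  have hint : ∀ g : ℝ × ℝ → ℝ, Measurable g →
      (Integrable (fun ω => g (X ω, L ω)) P ↔ Integrable (fun p => k p * g p) (μ.prod γ)) := by
    intro g hg
    change Integrable (g ∘ fun ω => (X ω, L ω)) P ↔ _
    rw [← integrable_map_measure hg.aestronglyMeasurable hXL.aemeasurable, hmap, integrable_withDensity_iff_integrable_smul' (by fun_prop)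
        (ae_of_all _ fun p => ENNReal.ofReal_lt_top)]
    simp only [ENNReal.toReal_ofReal (hk0 _).le, smul_eq_mul]
  have hintegral : ∀ g : ℝ × ℝ → ℝ, Measurable g →
      ∫ ω, g (X ω, L ω) ∂P = ∫ p, k p * g p ∂(μ.prod γ) := by
    intro g hg
    rw [← integral_map (φ := fun ω => (X ω, L ω)) (f := g) hXL.aemeasurable
      hg.aestronglyMeasurable, hmap, integral_withDensity_eq_integral_toReal_smul (by fun_prop)
        (ae_of_all _ fun p => ENNReal.ofReal_lt_top)]
    simp only [ENNReal.toReal_ofReal (hk0 _).le, smul_eq_mul]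
  set m0 : ℝ → ℝ := fun y => ∫ x, k (x, y) ∂μ with hm0
  set m1 : ℝ → ℝ := fun y => ∫ x, k (x, y) * x ∂μ with hm1
  have hm0m : Measurable m0 := hkm.stronglyMeasurable.integral_prod_left'.measurable
  have hm1m : Measurable m1 :=
    (hkm.mul measurable_fst).stronglyMeasurable.integral_prod_left'.measurable
  have hΦ : ∀ y, posteriorMean P X y b = m1 y / m0 y := by
    intro y
    simp only [posteriorMean, hm1, hm0, hk, hμdef]
    rw [integral_map hX.aemeasurable (by fun_prop), integral_map hX.aemeasurable (by fun_prop)]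
    simp only [mul_comm (X _) (Real.exp _)]
  have hk_int : Integrable k (μ.prod γ) := by
    have := (hint (fun _ => 1) measurable_const).1 (integrable_const 1)
    simpa only [mul_one] using this
  have hkx_int : Integrable (fun p => k p * p.1) (μ.prod γ) := (hint Prod.fst measurable_fst).1 hXi
  -- The integral `m0 y` is `0` by convention where `k (·, y)` is not integrable; Fubini excludes
  -- this for almost every `y`.
  have hm0pos : ∀ᵐ y ∂γ, 0 < m0 y := by
    filter_upwards [hk_int.prod_left_ae] with y hy
    exact integral_exp_pos hy
  have hΦm : Measurable fun y => posteriorMean P X y b := by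
    simp only [hΦ]
    exact hm1m.div hm0m
  -- Integrating against `k (·, y)` cancels the denominator `m0 y` and leaves `|m1 y|`, which is
  -- integrable because the signal is.
  have hΦk : Integrable (fun p => k p * posteriorMean P X p.2 b) (μ.prod γ) := by
    have hm : Measurable fun p : ℝ × ℝ => k p * posteriorMean P X p.2 b :=
      hkm.mul (hΦm.comp measurable_snd)
    refine (integrable_prod_iff' hm.aestronglyMeasurable).2 ⟨?_, ?_⟩
    · filter_upwards [hk_int.prod_left_ae] with y hy
      exact hy.mul_const _
    · refine (hkx_int.integral_prod_right).mono
        (hm.norm.stronglyMeasurable.integral_prod_left'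
          |>.aestronglyMeasurable) ?_
      filter_upwards [hm0pos] with y hy
      have h1 : ∀ x, ‖k (x, y) * posteriorMean P X y b‖ = k (x, y) * |m1 y / m0 y| := fun x => by
        rw [norm_mul, Real.norm_of_nonneg (hk0 _).le, hΦ, Real.norm_eq_abs]
      rw [Real.norm_of_nonneg (integral_nonneg fun _ => norm_nonneg _)]
      simp only [h1]
      rw [integral_mul_const, abs_div, abs_of_pos hy, mul_div_cancel₀ _ hy.ne']
      exact le_rfl
  have hΦi : Integrable (fun ω => posteriorMean P X (L ω) b) P :=
    (hint (fun p => posteriorMean P X p.2 b) (hΦm.comp measurable_snd)).2 hΦk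
  refine ae_eq_condExp_of_forall_setIntegral_eq hLm.comap_le hXi (fun _ _ _ => hΦi.integrableOn)
    ?_ ?_
  · rintro _ ⟨B, hB, rfl⟩ -
    have hB2 : MeasurableSet (Prod.snd ⁻¹' B : Set (ℝ × ℝ)) := measurable_snd hB
    have hind : ∀ (g : ℝ × ℝ → ℝ), Measurable g → Integrable (fun p => k p * g p) (μ.prod γ) →
        ∫ ω in L ⁻¹' B, g (X ω, L ω) ∂P = ∫ y in B, ∫ x, k (x, y) * g (x, y) ∂μ ∂γ := by
      intro g hg hgi
      rw [← integral_indicator (hLm hB), ← integral_indicator hB]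
      have e1 : ((L ⁻¹' B).indicator fun ω => g (X ω, L ω))
          = fun ω => (Prod.snd ⁻¹' B).indicator g (X ω, L ω) := rfl
      rw [e1, hintegral _ (hg.indicator hB2)]
      have e2 : (fun p => k p * (Prod.snd ⁻¹' B).indicator g p)
          = (Prod.snd ⁻¹' B).indicator fun p => k p * g p := by
        ext p
        by_cases hp : p ∈ Prod.snd ⁻¹' B <;> simp [hp]
      rw [e2, integral_prod_symm _ (hgi.indicator hB2)]
      refine integral_congr_ae (ae_of_all _ fun y => ?_)
      by_cases hy : y ∈ B
      · simp [Set.indicator, hy]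
      · simp [Set.indicator, hy]
    have h1 := hind (fun p => posteriorMean P X p.2 b) (hΦm.comp measurable_snd) hΦk
    have h2 := hind Prod.fst measurable_fst hkx_int
    simp only at h1 h2
    rw [h1, h2]
    refine setIntegral_congr_ae hB ?_
    filter_upwards [hm0pos] with y hy _
    rw [integral_mul_const, hΦ, mul_div_cancel₀ _ hy.ne']
  · exact (hΦm.comp (comap_measurable L)).aestronglyMeasurable

omit [IsProbabilityMeasure P] in
lemma measurable_posteriorMean [SFinite P] {X : Ω → ℝ} (hX : Measurable X) :
    Measurable fun q : ℝ × ℝ => posteriorMean P X q.1 q.2 := by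
  refine Measurable.div ?_ ?_
  · refine StronglyMeasurable.measurable (StronglyMeasurable.integral_prod_right'
      (f := fun p : (ℝ × ℝ) × Ω =>
        X p.2 * Real.exp (X p.2 * p.1.1 - p.1.2 * X p.2 ^ 2 / 2)) ?_)
    exact Measurable.stronglyMeasurable (by fun_prop)
  · refine StronglyMeasurable.measurable (StronglyMeasurable.integral_prod_right'
      (f := fun p : (ℝ × ℝ) × Ω => Real.exp (X p.2 * p.1.1 - p.1.2 * X p.2 ^ 2 / 2)) ?_)
    exact Measurable.stronglyMeasurable (by fun_prop)

end Bayes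

/-! ### Independence, linear images of Gaussian processes, and sufficiency. -/

section IndependenceHelpers

variable {Ω : Type*} {m : MeasurableSpace Ω} {P : Measure Ω} [IsProbabilityMeasure P]

/-- The hypotheses make `U`, `V` and `X` mutually independent, so `X` can change sides; it suffices
to compare the laws on boxes. -/
lemma indepFun_prodMk_of_indepFun {α β γ : Type*} [MeasurableSpace α] [MeasurableSpace β]
    [MeasurableSpace γ] {U : Ω → α} {V : Ω → β} {X : Ω → γ} (hU : Measurable U)
    (hV : Measurable V) (hX : Measurable X) (hUV : IndepFun U V P)
    (hXUV : IndepFun X (fun ω => (U ω, V ω)) P) : IndepFun U (fun ω => (X ω, V ω)) P := by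
  rw [indepFun_iff_map_prod_eq_prod_map_map hU.aemeasurable (hX.prodMk hV).aemeasurable]
  have : IsProbabilityMeasure (P.map U) := Measure.isProbabilityMeasure_map hU.aemeasurable
  have : IsProbabilityMeasure (P.map fun ω => (X ω, V ω)) :=
    Measure.isProbabilityMeasure_map (hX.prodMk hV).aemeasurable
  have : IsProbabilityMeasure (P.map fun ω => (U ω, (X ω, V ω))) :=
    Measure.isProbabilityMeasure_map (hU.prodMk (hX.prodMk hV)).aemeasurable
  refine Measure.ext_prod₃_iff.2 fun {a b c} ha hb hc => ?_
  have hXV : IndepFun X V P := hXUV.comp measurable_id measurable_snd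
  rw [Measure.prod_prod, Measure.map_apply (hU.prodMk (hX.prodMk hV)) (ha.prod (hb.prod hc)),
    Measure.map_apply hU ha, Measure.map_apply (hX.prodMk hV) (hb.prod hc)]
  have e1 : (fun ω => (U ω, X ω, V ω)) ⁻¹' a ×ˢ b ×ˢ c
      = X ⁻¹' b ∩ (fun ω => (U ω, V ω)) ⁻¹' (a ×ˢ c) := by
    ext ω; simp only [Set.mem_preimage, Set.mem_prod, Set.mem_inter_iff]; tauto
  have e2 : (fun ω => (U ω, V ω)) ⁻¹' (a ×ˢ c) = U ⁻¹' a ∩ V ⁻¹' c := rfl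
  have e3 : (fun ω => (X ω, V ω)) ⁻¹' (b ×ˢ c) = X ⁻¹' b ∩ V ⁻¹' c := rfl
  rw [e1, hXUV.measure_inter_preimage_eq_mul _ _ hb (ha.prod hc), e2, e3,
    hUV.measure_inter_preimage_eq_mul _ _ ha hc, hXV.measure_inter_preimage_eq_mul _ _ hb hc]
  ring

omit [IsProbabilityMeasure P] in
lemma IsGaussianProcess.of_linear {S T κ : Type*} [Fintype κ] {Z : T → Ω → ℝ}
    (hZ : IsGaussianProcess Z P) {Y : S → Ω → ℝ} (a : S → κ → ℝ) (t : S → κ → T)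
    (h : ∀ s ω, Y s ω = ∑ k, a s k * Z (t s k) ω) : IsGaussianProcess Y P := by
  classical
  refine hZ.of_isGaussianProcess fun s => ⟨Finset.univ.image (t s),
    ∑ k, a s k • ContinuousLinearMap.proj (R := ℝ)
      (⟨t s k, Finset.mem_image_of_mem _ (Finset.mem_univ k)⟩ :
        {x // x ∈ Finset.univ.image (t s)}), fun ω => ?_⟩
  simp [h]

/-- If `S` and `X` are functions of a variable that is independent of `R`, then `R` is
irrelevant for the prediction of `X` from `R` and `S`. -/
lemma setIntegral_sub_eq_zero_of_sufficient {α β γ : Type*} [MeasurableSpace α]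
    [MeasurableSpace β] [MeasurableSpace γ] {R : Ω → α} {V : Ω → β} {s : β → γ} {x : β → ℝ}
    (hR : Measurable R) (hV : Measurable V) (hs : Measurable s) (hx : Measurable x)
    (hRV : IndepFun R V P) (hXi : Integrable (fun ω => x (V ω)) P) {g : γ → ℝ}
    (hg : Measurable g) (hgc : (fun ω => g (s (V ω))) =ᵐ[P]
      P[fun ω => x (V ω) | MeasurableSpace.comap (fun ω => s (V ω)) inferInstance]) {A : Set Ω}
    (hA : MeasurableSet[MeasurableSpace.comap R inferInstance ⊔
      MeasurableSpace.comap (fun ω => s (V ω)) inferInstance] A) :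
    ∫ ω in A, (x (V ω) - g (s (V ω))) ∂P = 0 := by
  rw [← MeasurableSpace.comap_prodMk] at hA
  obtain ⟨B, hB, rfl⟩ := hA
  have hS : Measurable fun ω => s (V ω) := hs.comp hV
  have hgi : Integrable (fun ω => g (s (V ω))) P := integrable_condExp.congr hgc.symm
  have hdi : Integrable (fun ω => x (V ω) - g (s (V ω))) P := hXi.sub hgi
  have hpV : IsProbabilityMeasure (P.map V) := Measure.isProbabilityMeasure_map hV.aemeasurable
  have hpR : IsProbabilityMeasure (P.map R) := Measure.isProbabilityMeasure_map hR.aemeasurable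
  have hB' : MeasurableSet {q : α × β | (q.1, s q.2) ∈ B} :=
    (measurable_fst.prodMk (hs.comp measurable_snd)) hB
  have hBm : MeasurableSet ((fun ω => (R ω, s (V ω))) ⁻¹' B) := (hR.prodMk hS) hB
  have hdm : Measurable fun v => x v - g (s v) := hx.sub (hg.comp hs)
  have hFm : Measurable ({q : α × β | (q.1, s q.2) ∈ B}.indicator
      fun q => x q.2 - g (s q.2)) := (hdm.comp measurable_snd).indicator hB'
  have hmap := (indepFun_iff_map_prod_eq_prod_map_map hR.aemeasurable hV.aemeasurable).1 hRV
  have h1 : ∫ ω in (fun ω => (R ω, s (V ω))) ⁻¹' B, (x (V ω) - g (s (V ω))) ∂P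
      = ∫ q, {q : α × β | (q.1, s q.2) ∈ B}.indicator (fun q => x q.2 - g (s q.2)) q
        ∂((P.map R).prod (P.map V)) := by
    rw [← integral_indicator hBm, ← hmap,
      integral_map (hR.prodMk hV).aemeasurable hFm.aestronglyMeasurable]
    rfl
  have hint : Integrable ({q : α × β | (q.1, s q.2) ∈ B}.indicator
      fun q => x q.2 - g (s q.2)) ((P.map R).prod (P.map V)) := by
    rw [← hmap, integrable_map_measure hFm.aestronglyMeasurable (hR.prodMk hV).aemeasurable]
    exact hdi.indicator hBm
  rw [h1, integral_prod _ hint]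
  -- With the value `r` of `R` frozen, the section of `B` is an event of the σ-algebra generated by
  -- the statistic, over which `x` and its conditional expectation have the same integral.
  refine (integral_congr_ae (ae_of_all _ fun r => ?_)).trans (integral_zero _ _)
  have hBr : MeasurableSet (Prod.mk r ⁻¹' B) := measurable_prodMk_left hB
  have hSB : MeasurableSet[MeasurableSpace.comap (fun ω => s (V ω)) inferInstance]
      ((fun ω => s (V ω)) ⁻¹' (Prod.mk r ⁻¹' B)) := ⟨_, hBr, rfl⟩
  have h2 : ∫ v, {q : α × β | (q.1, s q.2) ∈ B}.indicator (fun q => x q.2 - g (s q.2)) (r, v)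
      ∂(P.map V) = ∫ ω in (fun ω => s (V ω)) ⁻¹' (Prod.mk r ⁻¹' B),
        (x (V ω) - g (s (V ω))) ∂P := by
    rw [← integral_indicator (hS hBr)]
    exact integral_map (f := fun v => {q : α × β | (q.1, s q.2) ∈ B}.indicator
      (fun q => x q.2 - g (s q.2)) (r, v)) hV.aemeasurable
      (hFm.comp measurable_prodMk_left).aestronglyMeasurable
  change ∫ v, {q : α × β | (q.1, s q.2) ∈ B}.indicator (fun q => x q.2 - g (s q.2)) (r, v)
      ∂(P.map V) = 0
  rw [h2, integral_sub hXi.integrableOn hgi.integrableOn,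
    setIntegral_congr_ae (hS hBr) (hgc.mono fun _ h _ => h),
    setIntegral_condExp hS.comap_le hXi hSB, sub_self]

end IndependenceHelpers

/-! ### The estimate of the signal at deterministic times. -/

namespace ModulatedInformation

variable {Ω : Type*} [m : MeasurableSpace Ω] {P : Measure Ω} {n : ℕ}

lemma measurable_β (D : ModulatedInformation P n) (i : Fin n) (t : I) : Measurable (D.β i t) :=
  (D.bridge i).measurable t

lemma memLp_β (D : ModulatedInformation P n) (i : Fin n) (t : I) : MemLp (D.β i t) 2 P :=
  ((D.bridge i).gaussian.hasGaussianLaw_eval t).memLp_two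

lemma measurable_xi (D : ModulatedInformation P n) (i : Fin n) (t : I) : Measurable (D.xi i t) :=
  (D.X_measurable.const_mul _).add ((D.measurable_β i t).const_mul _)

lemma continuous_xi (D : ModulatedInformation P n) (i : Fin n) (ω : Ω) :
    Continuous fun t => D.xi i t ω :=
  (continuous_subtype_val.mul continuous_const).add
    (continuous_const.mul ((D.bridge i).continuous ω))

/-- The family of all bridges. -/
def bridges (D : ModulatedInformation P n) (ω : Ω) (p : Fin n × I) : ℝ := D.β p.1 p.2 ω

lemma measurable_bridges (D : ModulatedInformation P n) : Measurable D.bridges :=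
  measurable_pi_lambda _ fun p => D.measurable_β p.1 p.2

lemma indepFun_X_bridges (D : ModulatedInformation P n) : IndepFun D.X D.bridges P := by
  have h := D.X_indep.comp (φ := id) (ψ := fun (g : Fin n → I → ℝ) (p : Fin n × I) => g p.1 p.2)
    measurable_id (measurable_pi_lambda _ fun p => by fun_prop)
  exact h

/-- Independent Gaussian vectors are jointly Gaussian. A finite family of pairs (source, time) is
first enlarged to all sources at all the times involved, so that the vectors of the different
sources have the same index set. -/
lemma isGaussianProcess_bridges (D : ModulatedInformation P n) [IsProbabilityMeasure P] :
    IsGaussianProcess (fun (p : Fin n × I) ω => D.β p.1 p.2 ω) P where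
  hasGaussianLaw K := by
    classical
    have h1 : iIndepFun (fun (i : Fin n) ω (t : K.image Prod.snd) => D.β i t ω) P :=
      D.bridges_indep.comp (fun (_ : Fin n) (g : I → ℝ) (t : K.image Prod.snd) => g t)
        fun _ => measurable_pi_lambda _ fun t => measurable_pi_apply _
    have h2 : HasGaussianLaw (fun ω (i : Fin n) (t : K.image Prod.snd) => D.β i t ω) P :=
      iIndepFun.hasGaussianLaw (fun i => (D.bridge i).gaussian.hasGaussianLaw _) h1
    exact h2.map_fun (ContinuousLinearMap.pi fun p : K =>
      (ContinuousLinearMap.proj (R := ℝ) (φ := fun _ : K.image Prod.snd => ℝ)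
        ⟨p.1.2, Finset.mem_image_of_mem _ p.2⟩).comp
        (ContinuousLinearMap.proj (R := ℝ) (φ := fun _ : Fin n => K.image Prod.snd → ℝ) p.1.1))

lemma cov_β (D : ModulatedInformation P n) (i j : Fin n) (s t : I) :
    cov[D.β i s, D.β j t; P] = if i = j then min (s : ℝ) t - (s : ℝ) * t else 0 := by
  split_ifs with h
  · subst h; exact (D.bridge i).covariance s t
  · have h1 : IndepFun (D.β i s) (D.β j t) P := (D.bridges_indep.indepFun h).comp
      (φ := fun g : I → ℝ => g s) (ψ := fun g : I → ℝ => g t)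
      (measurable_pi_apply (X := fun _ : I => ℝ) s) (measurable_pi_apply (X := fun _ : I => ℝ) t)
    exact h1.covariance_eq_zero (D.memLp_β i s) (D.memLp_β j t)

/-- The σ-algebra generated by the information processes, the `i`-th one up to time `c i`. -/
@[reducible] def upTo (D : ModulatedInformation P n) (c : Fin n → I) : MeasurableSpace Ω :=
  ⨆ i, ⨆ u ≤ c i, MeasurableSpace.comap (D.xi i u) inferInstance

lemma upTo_le (D : ModulatedInformation P n) (c : Fin n → I) : D.upTo c ≤ m :=
  iSup_le fun i => iSup₂_le fun u _ => (D.measurable_xi i u).comap_le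

/-- The precision of the information available at the times `c`. -/
def precision (D : ModulatedInformation P n) (c : Fin n → I) : ℝ :=
  ∑ i, (c i : ℝ) / (D.vol i ^ 2 * (1 - (c i : ℝ)))

/-- The sufficient statistic for the signal at the times `c`. -/
def score (D : ModulatedInformation P n) (c : Fin n → I) (ω : Ω) : ℝ :=
  ∑ i, D.xi i (c i) ω / (D.vol i ^ 2 * (1 - (c i : ℝ)))

/-- The noise in the sufficient statistic. -/
def noise (D : ModulatedInformation P n) (c : Fin n → I) (ω : Ω) : ℝ :=
  ∑ i, (D.vol i * (1 - (c i : ℝ)))⁻¹ * D.β i (c i) ω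

lemma score_eq (D : ModulatedInformation P n) (c : Fin n → I) (ω : Ω) :
    D.score c ω = D.precision c * D.X ω + D.noise c ω := by
  rw [score, precision, noise, Finset.sum_mul, ← Finset.sum_add_distrib]
  refine Finset.sum_congr rfl fun i _ => ?_
  have := (D.vol_pos i).ne'
  rw [xi, add_div]
  congr 1
  · ring
  · rw [pow_two, mul_assoc, mul_div_mul_left _ _ this, inv_mul_eq_div]

lemma precision_nonneg (D : ModulatedInformation P n) (c : Fin n → I) : 0 ≤ D.precision c :=
  Finset.sum_nonneg fun i _ => div_nonneg (c i).2.1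
    (mul_nonneg (sq_nonneg _) (sub_nonneg.2 (c i).2.2))

lemma measurable_noise (D : ModulatedInformation P n) (c : Fin n → I) :
    Measurable (D.noise c) :=
  Finset.measurable_fun_sum _ fun i _ => (D.measurable_β i (c i)).const_mul _

lemma memLp_noise (D : ModulatedInformation P n) (c : Fin n → I) : MemLp (D.noise c) 2 P :=
  memLp_finsetSum _ fun i _ => (D.memLp_β i (c i)).const_mul _

/-- The covariance of `β` at `u` and at `c i` is `u (1 - c i)`, and the weights in `noise` are
chosen to cancel the factor `1 - c i`. Hence `vol i * β` at `u` has covariance `u` with `noise`,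
whatever the source; this is why one multiple of `noise`, proportional to `u`, removes the
correlation in `residual`. -/
lemma cov_β_noise (D : ModulatedInformation P n) [IsProbabilityMeasure P] {c : Fin n → I}
    (hc : ∀ i, c i < 1) {i : Fin n} {u : I} (hu : u ≤ c i) :
    cov[D.β i u, D.noise c; P] = u / D.vol i := by
  have h : D.noise c = fun ω => ∑ j, (fun ω => (D.vol j * (1 - (c j : ℝ)))⁻¹ * D.β j (c j) ω) ω :=
    rfl
  rw [h, covariance_fun_sum_right (fun j => (D.memLp_β j (c j)).const_mul _) (D.memLp_β i u)]
  simp only [covariance_const_mul_right, D.cov_β]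
  rw [Finset.sum_eq_single i (fun j _ hj => by rw [if_neg (Ne.symm hj), mul_zero])
    (fun h => absurd (Finset.mem_univ i) h), if_pos rfl, min_eq_left (by exact_mod_cast hu)]
  have h1 : (1 - (c i : ℝ)) ≠ 0 := by
    have : (c i : ℝ) < 1 := hc i
    linarith
  have := (D.vol_pos i).ne'
  field_simp

lemma cov_noise_self (D : ModulatedInformation P n) [IsProbabilityMeasure P] {c : Fin n → I}
    (hc : ∀ i, c i < 1) : cov[D.noise c, D.noise c; P] = D.precision c := by
  have h := covariance_fun_sum_left (μ := P) (Y := D.noise c)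
    (X := fun j ω => (D.vol j * (1 - (c j : ℝ)))⁻¹ * D.β j (c j) ω)
    (fun j => (D.memLp_β j (c j)).const_mul _) (D.memLp_noise c)
  refine h.trans (Finset.sum_congr rfl fun i _ => ?_)
  rw [covariance_const_mul_left, D.cov_β_noise hc le_rfl]
  rw [inv_mul_eq_div, div_div]
  congr 1
  ring

lemma map_noise (D : ModulatedInformation P n) [IsProbabilityMeasure P] {c : Fin n → I}
    (hc : ∀ i, c i < 1) :
    P.map (D.noise c) = gaussianReal 0 (D.precision c).toNNReal := by
  have hG : HasGaussianLaw (D.noise c) P := (IsGaussianProcess.of_linear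
    (S := Unit) (Y := fun _ => D.noise c) D.isGaussianProcess_bridges
    (fun _ i => (D.vol i * (1 - (c i : ℝ)))⁻¹) (fun _ i => (i, c i))
    (fun _ _ => rfl)).hasGaussianLaw_eval ()
  have hmean : ∫ ω, D.noise c ω ∂P = 0 := by
    simp only [noise]
    rw [integral_finsetSum _ fun i _ => ((D.memLp_β i (c i)).integrable one_le_two).const_mul _]
    refine Finset.sum_eq_zero fun i _ => ?_
    rw [integral_const_mul, (D.bridge i).mean, mul_zero]
  rw [hG.map_eq_gaussianReal, hmean, ← covariance_self hG.aemeasurable, D.cov_noise_self hc]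

/-- What remains of the information processes when the sufficient statistic is removed. -/
def residual (D : ModulatedInformation P n) (c : Fin n → I) (ω : Ω)
    (p : {p : Fin n × I // p.2 ≤ c p.1}) : ℝ :=
  D.vol p.1.1 * D.β p.1.1 p.1.2 ω - (p.1.2 : ℝ) / D.precision c * D.noise c ω

lemma measurable_residual (D : ModulatedInformation P n) (c : Fin n → I) :
    Measurable (D.residual c) :=
  measurable_pi_lambda _ fun _ =>
    ((D.measurable_β _ _).const_mul _).sub ((D.measurable_noise c).const_mul _)

lemma precision_pos (D : ModulatedInformation P n) {c : Fin n → I} (hc : ∀ i, c i < 1) {i : Fin n}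
    (hi : 0 < c i) : 0 < D.precision c :=
  Finset.sum_pos' (fun i _ => div_nonneg (c i).2.1
    (mul_nonneg (sq_nonneg _) (sub_nonneg.2 (c i).2.2))) ⟨i, Finset.mem_univ i, div_pos hi
      (mul_pos (pow_pos (D.vol_pos i) 2) (sub_pos.2 (hc i)))⟩

/-- The precision can vanish only when all the `c i` are `0`; then `u = 0` as well, and the division
by zero does no harm. -/
lemma precision_div_mul (D : ModulatedInformation P n) {c : Fin n → I} (hc : ∀ i, c i < 1)
    {i : Fin n} {u : I} (hu : u ≤ c i) : (u : ℝ) / D.precision c * D.precision c = u := by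
  by_cases h : 0 < c i
  · exact div_mul_cancel₀ _ (D.precision_pos hc h).ne'
  · have h0 : u = 0 := le_antisymm (hu.trans (not_lt.1 h)) unitInterval.nonneg'
    simp [h0]

lemma xi_eq_residual (D : ModulatedInformation P n) {c : Fin n → I} (hc : ∀ i, c i < 1)
    (p : {p : Fin n × I // p.2 ≤ c p.1}) (ω : Ω) :
    D.xi p.1.1 p.1.2 ω = D.residual c ω p + (p.1.2 : ℝ) / D.precision c * D.score c ω := by
  have h := D.precision_div_mul hc p.2
  rw [score_eq, residual, xi, mul_add, ← mul_assoc, h]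
  ring

/-- The two are jointly Gaussian, so zero covariance suffices. -/
lemma indepFun_residual_noise (D : ModulatedInformation P n) [IsProbabilityMeasure P]
    {c : Fin n → I} (hc : ∀ i, c i < 1) : IndepFun (D.residual c) (D.noise c) P := by
  have hG : IsGaussianProcess (Sum.elim (fun p ω => D.residual c ω p) (fun (_ : Unit) => D.noise c))
      P := by
    -- In the index set `Fin n × Bool`, the label `true` carries the bridge value that appears in
    -- `residual`, and `false` carries the terms of `noise`.
    refine IsGaussianProcess.of_linear (κ := Fin n × Bool) D.isGaussianProcess_bridges
      (Sum.elim (fun p k => bif k.2 then (if p.1.1 = k.1 then D.vol k.1 else 0) else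
          -((p.1.2 : ℝ) / D.precision c * (D.vol k.1 * (1 - (c k.1 : ℝ)))⁻¹))
        (fun _ k => bif k.2 then 0 else (D.vol k.1 * (1 - (c k.1 : ℝ)))⁻¹))
      (Sum.elim (fun p k => bif k.2 then (k.1, p.1.2) else (k.1, c k.1))
        (fun _ k => (k.1, c k.1))) ?_
    rintro (p | _) ω
    · simp only [Sum.elim_inl, Fintype.sum_prod_type, Fintype.sum_bool, cond_true, cond_false,
        Finset.sum_add_distrib, ite_mul, zero_mul, Finset.sum_ite_eq, Finset.mem_univ, if_true,
        residual, noise, Finset.mul_sum, neg_mul, Finset.sum_neg_distrib, sub_eq_add_neg,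
        mul_assoc]
    · simp only [Sum.elim_inr, Fintype.sum_prod_type, Fintype.sum_bool, cond_true, cond_false,
        noise, zero_mul, zero_add]
  have h := hG.indepFun_of_covariance_eq_zero (X := fun p ω => D.residual c ω p)
    (Y := fun (_ : Unit) => D.noise c)
    (fun p => ((measurable_pi_apply p).comp (D.measurable_residual c)).aemeasurable)
    (fun _ => (D.measurable_noise c).aemeasurable) ?_
  · exact h.comp measurable_id (measurable_pi_apply ())
  · intro p _
    simp only [residual]
    rw [covariance_fun_sub_left ((D.memLp_β _ _).const_mul _) ((D.memLp_noise c).const_mul _)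
      (D.memLp_noise c), covariance_const_mul_left, covariance_const_mul_left,
      D.cov_β_noise hc p.2, D.cov_noise_self hc, D.precision_div_mul hc p.2,
      mul_div_cancel₀ _ (D.vol_pos _).ne', sub_self]

/-- Everything observed is a function of `residual` and `score`. As `residual` is independent of the
pair formed by `X` and `noise`, it does not help to predict `X` once `score` is known, and Bayes'
formula applies to `score`. -/
theorem posteriorMean_score (D : ModulatedInformation P n) [IsProbabilityMeasure P]
    {c : Fin n → I} (hc : ∀ i, c i < 1) :
    (fun ω => posteriorMean P D.X (D.score c ω) (D.precision c)) =ᵐ[P] P[D.X | D.upTo c] := by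
  have hXi : Integrable D.X P := D.X_memLp.integrable one_le_two
  have hNX : IndepFun D.X (D.noise c) P := by
    have h := D.indepFun_X_bridges.comp (φ := id) (ψ := fun (g : Fin n × I → ℝ) =>
      ∑ i, (D.vol i * (1 - (c i : ℝ)))⁻¹ * g (i, c i)) measurable_id (by fun_prop)
    exact h
  have hsc : D.score c = fun ω => ((D.precision c).toNNReal : ℝ) * D.X ω + D.noise c ω := by
    ext ω
    rw [Real.coe_toNNReal _ (D.precision_nonneg c), D.score_eq]
  have hbayes := posteriorMean_ae_eq_condExp D.X_measurable (D.measurable_noise c) hXi hNX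
    (D.map_noise hc)
  simp only [← hsc] at hbayes
  have hscore : ∀ ω, ((D.precision c).toNNReal : ℝ) * D.X ω + D.noise c ω = D.score c ω :=
    fun ω => (congrFun hsc ω).symm
  simp only [hscore] at hbayes
  rw [Real.coe_toNNReal _ (D.precision_nonneg c)] at hbayes
  have hscm : Measurable (D.score c) := by
    rw [hsc]
    exact (D.X_measurable.const_mul _).add (D.measurable_noise c)
  have hR : IndepFun (D.residual c) (fun ω => (D.X ω, D.noise c ω)) P := by
    refine indepFun_prodMk_of_indepFun (D.measurable_residual c) (D.measurable_noise c)
      D.X_measurable (D.indepFun_residual_noise hc) ?_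
    have h := D.indepFun_X_bridges.comp (φ := id) (ψ := fun (g : Fin n × I → ℝ) =>
      ((fun p : {p : Fin n × I // p.2 ≤ c p.1} => D.vol p.1.1 * g p.1 - (p.1.2 : ℝ) /
          D.precision c * ∑ i, (D.vol i * (1 - (c i : ℝ)))⁻¹ * g (i, c i)),
        ∑ i, (D.vol i * (1 - (c i : ℝ)))⁻¹ * g (i, c i))) measurable_id (by fun_prop)
    exact h
  have hle : D.upTo c ≤ MeasurableSpace.comap (D.residual c) inferInstance ⊔
      MeasurableSpace.comap (D.score c) inferInstance := by
    rw [← MeasurableSpace.comap_prodMk]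
    refine iSup_le fun i => iSup₂_le fun u hu => ?_
    have h : D.xi i u = fun ω => (fun q : ({p : Fin n × I // p.2 ≤ c p.1} → ℝ) × ℝ =>
        q.1 ⟨(i, u), hu⟩ + (u : ℝ) / D.precision c * q.2) (D.residual c ω, D.score c ω) :=
      funext fun ω => D.xi_eq_residual hc ⟨(i, u), hu⟩ ω
    have h2 : Measurable fun q : ({p : Fin n × I // p.2 ≤ c p.1} → ℝ) × ℝ =>
        q.1 ⟨(i, u), hu⟩ + (u : ℝ) / D.precision c * q.2 := by fun_prop
    rw [h]
    exact (h2.comp (comap_measurable _)).comap_le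
  have hg : Measurable fun y => posteriorMean P D.X y (D.precision c) :=
    (measurable_posteriorMean D.X_measurable).comp (measurable_id.prodMk measurable_const)
  have hi : Integrable (fun ω => posteriorMean P D.X (D.score c ω) (D.precision c)) P :=
    integrable_condExp.congr hbayes.symm
  refine ae_eq_condExp_of_forall_setIntegral_eq (D.upTo_le c) hXi
    (fun _ _ _ => hi.integrableOn) (fun A hA _ => ?_) ?_
  · have hS : (fun ω => D.precision c * D.X ω + D.noise c ω) = D.score c :=
      funext fun ω => (D.score_eq c ω).symm
    have hs : ∀ ω, (fun q : ℝ × ℝ => D.precision c * q.1 + q.2) (D.X ω, D.noise c ω)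
        = D.score c ω := fun ω => (D.score_eq c ω).symm
    have h := setIntegral_sub_eq_zero_of_sufficient (P := P) (A := A) (x := Prod.fst)
      (s := fun q : ℝ × ℝ => D.precision c * q.1 + q.2)
      (g := fun y => posteriorMean P D.X y (D.precision c))
      (D.measurable_residual c) (D.X_measurable.prodMk (D.measurable_noise c)) (by fun_prop)
      measurable_fst hR hXi hg (by simp only [hs]; exact hbayes)
      (by change MeasurableSet[_ ⊔ MeasurableSpace.comap
              (fun ω => D.precision c * D.X ω + D.noise c ω) _] A
          rw [hS]
          exact hle A hA)
    have h : ∫ ω in A, (D.X ω - posteriorMean P D.X (D.score c ω) (D.precision c)) ∂P = 0 := by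
      simpa only [hs] using h
    rw [integral_sub hXi.integrableOn hi.integrableOn, sub_eq_zero] at h
    exact h.symm
  · refine (hg.comp ?_).aestronglyMeasurable
    refine Finset.measurable_fun_sum _ fun i _ => Measurable.div_const ?_ _
    exact (comap_measurable (D.xi i (c i))).mono
      (le_iSup_of_le i (le_iSup₂_of_le (c i) le_rfl le_rfl)) le_rfl

end ModulatedInformation

/-! ### Null events, and reading a process at a random time. -/

section NullSets

variable {Ω : Type*} {m₁ m : MeasurableSpace Ω} {P : Measure Ω}

-- The sets that agree almost surely with a set of `m₁` form a σ-algebra, which contains `m₁` and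
-- the null events.
open ModulatedInformation in
lemma exists_ae_eq_of_measurableSet_sup_null {A : Set Ω}
    (hA : MeasurableSet[m₁ ⊔ @nullSigma Ω m P] A) : ∃ B, MeasurableSet[m₁] B ∧ A =ᵐ[P] B := by
  have hle : m₁ ⊔ @nullSigma Ω m P ≤ eventuallyMeasurableSpace m₁ (ae P) := by
    refine sup_le (le_eventuallyMeasurableSpace) (MeasurableSpace.generateFrom_le ?_)
    rintro N ⟨-, hN⟩
    exact ⟨∅, @MeasurableSet.empty Ω m₁, ae_eq_empty.2 hN⟩
  exact hle A hA

open ModulatedInformation in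
lemma measurableSet_of_ae_eq_of_null_le [P.IsComplete] (h : nullSigma P ≤ m₁) {A B : Set Ω}
    (hB : MeasurableSet[m₁] B) (hAB : A =ᵐ[P] B) : MeasurableSet[m₁] A := by
  have hnull : ∀ N : Set Ω, P N = 0 → MeasurableSet[m₁] N := fun N hN =>
    h _ (MeasurableSpace.measurableSet_generateFrom
      ⟨Measure.IsComplete.out' N hN, hN⟩)
  have h1 : P (A \ B) = 0 := (ae_eq_set.1 hAB).1
  have h2 : P (B \ A) = 0 := (ae_eq_set.1 hAB).2
  have : A = (B \ (B \ A)) ∪ (A \ B) := by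
    ext x; simp only [Set.mem_union, Set.mem_sdiff]; tauto
  rw [this]
  exact (hB.diff (hnull _ h2)).union (hnull _ h1)

open ModulatedInformation in
lemma measurable_of_ae_eq_of_null_le [P.IsComplete] {E : Type*} [MeasurableSpace E]
    (h : nullSigma P ≤ m₁) {f g : Ω → E} (hg : Measurable[m₁] g) (hfg : f =ᵐ[P] g) :
    Measurable[m₁] f := fun s hs =>
  measurableSet_of_ae_eq_of_null_le h (hg hs) (hfg.fun_comp (· ∈ s))

end NullSets

/-- A continuous process `x` is visible, through `z`, only at times when `a` holds. If such times
come arbitrarily close to `ρ`, the value of `x` at `ρ` is a limit of visible values along countably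
many times. -/
lemma measurable_indicator_of_approx {Ω' : Type*} [MeasurableSpace Ω'] {t : I} {ρ : Ω' → I}
    (hρ : Measurable ρ) {E : Set Ω'} (hE : MeasurableSet E) {a : I → Ω' → Prop}
    (ha : ∀ u ≤ t, MeasurableSet {ω | a u ω}) {x z : I → Ω' → ℝ} (hz : ∀ u ≤ t, Measurable (z u))
    (hx : ∀ ω, Continuous fun u => x u ω) (hzx : ∀ u ω, a u ω → z u ω = x u ω)
    (hap : ∀ ω ∈ E, ∀ ε > 0, ∃ q ∈ denseTimes t, q ≤ t ∧ dist q (ρ ω) < ε ∧ a q ω) :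
    Measurable (E.indicator fun ω => x (ρ ω) ω) := by
  classical
  obtain ⟨d, hd⟩ := (countable_denseTimes t).exists_eq_range ⟨t, self_mem_denseTimes t⟩
  -- Admitting every index off `E` makes the search succeed at every point, so that the first
  -- admissible index is a measurable function.
  set p : ℕ → Ω' → ℕ → Prop := fun j ω k =>
    ω ∉ E ∨ (d k ≤ t ∧ dist (d k) (ρ ω) < 1 / ((j : ℝ) + 1) ∧ a (d k) ω) with hp
  have hex : ∀ j ω, ∃ k, p j ω k := fun j ω => by
    by_cases hω : ω ∈ E
    · obtain ⟨q, hq, hqt, hqd, hqa⟩ := hap ω hω (1 / ((j : ℝ) + 1)) (by positivity)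
      rw [hd] at hq
      obtain ⟨k, rfl⟩ := hq
      exact ⟨k, Or.inr ⟨hqt, hqd, hqa⟩⟩
    · exact ⟨0, Or.inl hω⟩
  have hpm : ∀ j k, MeasurableSet {ω | p j ω k} := fun j k => by
    have hpE : {ω | p j ω k} = Eᶜ ∪
        {ω | d k ≤ t ∧ dist (d k) (ρ ω) < 1 / ((j : ℝ) + 1) ∧ a (d k) ω} := by
      ext ω; simp [hp]
    rw [hpE]
    refine hE.compl.union ?_
    by_cases hk : d k ≤ t
    · have h1 : MeasurableSet {ω | dist (d k) (ρ ω) < 1 / ((j : ℝ) + 1)} :=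
        measurableSet_lt (measurable_const.dist hρ) measurable_const
      refine (h1.inter (ha _ hk)).congr ?_
      ext ω; simp [hk]
    · refine MeasurableSet.empty.congr ?_
      ext ω; simp [hk]
  have hN : ∀ j, Measurable fun ω => Nat.find (hex j ω) := fun j => measurable_find (hex j) (hpm j)
  have hzd : Measurable fun q : ℕ × Ω' => if d q.1 ≤ t then z (d q.1) q.2 else 0 := by
    refine measurable_from_prod_countable_right fun k => ?_
    by_cases hk : d k ≤ t
    · simpa only [hk, if_true] using hz _ hk
    · simp only [hk, if_false, measurable_const]
  refine measurable_of_tendsto_metrizable (f := fun (j : ℕ) => E.indicator fun ω =>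
    if d (Nat.find (hex j ω)) ≤ t then z (d (Nat.find (hex j ω))) ω else 0)
    (fun j => (hzd.comp ((hN j).prodMk measurable_id)).indicator hE)
    (tendsto_pi_nhds.2 fun ω => ?_)
  by_cases hω : ω ∈ E
  · simp only [Set.indicator_of_mem hω]
    have hs : ∀ j, d (Nat.find (hex j ω)) ≤ t ∧ dist (d (Nat.find (hex j ω))) (ρ ω)
        < 1 / ((j : ℝ) + 1) ∧ a (d (Nat.find (hex j ω))) ω := fun j =>
      (Nat.find_spec (hex j ω)).resolve_left (not_not.2 hω)
    have hlim : Tendsto (fun j => d (Nat.find (hex j ω))) atTop (𝓝 (ρ ω)) :=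
      tendsto_iff_dist_tendsto_zero.2 (squeeze_zero (fun _ => dist_nonneg)
        (fun j => (hs j).2.1.le) tendsto_one_div_add_atTop_nhds_zero_nat)
    refine (((hx ω).tendsto (ρ ω)).comp hlim).congr fun j => ?_
    rw [if_pos (hs j).1, hzx _ _ (hs j).2.2]
    rfl
  · simp only [Set.indicator_of_notMem hω, tendsto_const_nhds]

/-! ### Independence of the switching from the signal, and the enlarged information. -/

namespace ModulatedInformation

variable {Ω : Type*} [m : MeasurableSpace Ω] {P : Measure Ω} {n : ℕ}

/-- The σ-algebra generated by the switching process. -/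
@[reducible] def switchSigma (D : ModulatedInformation P n) : MeasurableSpace Ω :=
  MeasurableSpace.comap (fun ω (t : I) => D.J t ω) inferInstance

/-- The σ-algebra generated by the signal and the bridges. -/
@[reducible] def signalSigma (D : ModulatedInformation P n) : MeasurableSpace Ω :=
  MeasurableSpace.comap (fun ω => (D.X ω, D.bridges ω)) inferInstance

lemma switchSigma_le (D : ModulatedInformation P n) : D.switchSigma ≤ m :=
  (measurable_pi_lambda _ D.J_measurable).comap_le

lemma signalSigma_le (D : ModulatedInformation P n) : D.signalSigma ≤ m :=
  (D.X_measurable.prodMk D.measurable_bridges).comap_le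

lemma β_ae_eq_zero (D : ModulatedInformation P n) [IsProbabilityMeasure P] (i : Fin n) {t : I}
    (ht : (t : ℝ) - (t : ℝ) * t = 0) : D.β i t =ᵐ[P] 0 := by
  have h := (D.bridge i).covariance t t
  rw [min_self, ht, covariance_self (D.measurable_β i t).aemeasurable] at h
  have h2 := (evariance_eq_zero_iff (D.measurable_β i t).aemeasurable).1 (by
    rw [← (D.memLp_β i t).ofReal_variance_eq, h, ENNReal.ofReal_zero])
  rw [(D.bridge i).mean] at h2
  exact h2

lemma xi_one_ae_eq (D : ModulatedInformation P n) [IsProbabilityMeasure P] (i : Fin n) :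
    D.xi i 1 =ᵐ[P] D.X := by
  filter_upwards [D.β_ae_eq_zero i (t := 1) (by norm_num)] with ω hω
  rw [xi, hω]
  simp

lemma xi_zero_ae_eq (D : ModulatedInformation P n) [IsProbabilityMeasure P] (i : Fin n) :
    D.xi i 0 =ᵐ[P] 0 := by
  filter_upwards [D.β_ae_eq_zero i (t := 0) (by norm_num)] with ω hω
  rw [xi, hω]
  simp

/-- The model assumes independence of `J` from the information processes only. These determine the
signal and the bridges almost surely: the bridges vanish at time `1`, so any source gives `X` there,
and then `β` is recovered from `xi`. -/
lemma indep_switch_signal (D : ModulatedInformation P n) [IsProbabilityMeasure P] :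
    Indep D.switchSigma D.signalSigma P := by
  change IndepFun (fun ω (t : I) => D.J t ω) (fun ω => (D.X ω, D.bridges ω)) P
  -- Without sources nothing reveals `X`, but then there is only one activity pattern and `J` is
  -- constant.
  rcases Nat.eq_zero_or_pos n with rfl | hn
  · have : (fun ω (t : I) => D.J t ω) = fun _ _ => default := Subsingleton.elim _ _
    rw [this]
    exact indepFun_const_left _ _
  · have h := D.J_indep.comp (φ := id) (ψ := fun g : I → Fin n → ℝ => (g 1 ⟨0, hn⟩,
      fun p : Fin n × I => (g p.2 p.1 - (p.2 : ℝ) * g 1 ⟨0, hn⟩) / D.vol p.1)) measurable_id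
      (by fun_prop)
    refine h.congr ae_eq_rfl ?_
    filter_upwards [D.xi_one_ae_eq ⟨0, hn⟩] with ω hω
    have hω' : ((1 : I) : ℝ) * D.X ω + D.vol ⟨0, hn⟩ * D.β ⟨0, hn⟩ 1 ω = D.X ω := hω
    simp only [Function.comp_apply, hω']
    refine Prod.ext rfl (funext fun p => ?_)
    have := (D.vol_pos p.1).ne'
    change (_ + D.vol p.1 * D.β p.1 p.2 ω - _) / _ = D.β p.1 p.2 ω
    field_simp
    ring

lemma cadlag (D : ModulatedInformation P n) (ω : Ω) : IsCadlagPath fun u => D.J u ω :=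
  D.J_cadlag ω

lemma measurable_J_switch (D : ModulatedInformation P n) (t : I) :
    Measurable fun ω : SubSpace D.switchSigma => D.J t (ofSub ω) :=
  (measurable_pi_apply t).comp (comap_measurable fun ω (t : I) => D.J t ω)

lemma measurable_X_signal (D : ModulatedInformation P n) :
    Measurable fun ω : SubSpace D.signalSigma => D.X (ofSub ω) :=
  measurable_fst.comp (comap_measurable fun ω => (D.X ω, D.bridges ω))

lemma measurable_β_signal (D : ModulatedInformation P n) (i : Fin n) (t : I) :
    Measurable fun ω : SubSpace D.signalSigma => D.β i t (ofSub ω) :=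
  (measurable_pi_apply (i, t)).comp
    (measurable_snd.comp (comap_measurable fun ω => (D.X ω, D.bridges ω)))

lemma measurable_uncurry_β_signal (D : ModulatedInformation P n) (i : Fin n) :
    Measurable fun p : I × SubSpace D.signalSigma => D.β i p.1 (ofSub p.2) :=
  measurable_uncurry_of_rightContinuous (D.measurable_β_signal i)
    fun ω _ => ((D.bridge i).continuous (ofSub ω)).continuousWithinAt

lemma measurable_uncurry_xi_signal (D : ModulatedInformation P n) (i : Fin n) :
    Measurable fun p : I × SubSpace D.signalSigma => D.xi i p.1 (ofSub p.2) := by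
  have h1 := D.measurable_uncurry_β_signal i
  have h2 := D.measurable_X_signal
  exact ((measurable_subtype_coe.comp measurable_fst).mul (h2.comp measurable_snd)).add
    (h1.const_mul _)

lemma measurable_uncurry_β (D : ModulatedInformation P n) (i : Fin n) :
    Measurable fun p : I × Ω => D.β i p.1 p.2 :=
  measurable_uncurry_of_rightContinuous (D.measurable_β i)
    fun ω _ => ((D.bridge i).continuous ω).continuousWithinAt

lemma measurable_uncurry_xi (D : ModulatedInformation P n) (i : Fin n) :
    Measurable fun p : I × Ω => D.xi i p.1 p.2 := by
  have h1 := D.measurable_uncurry_β i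
  have h2 := D.X_measurable
  simp only [xi]
  fun_prop

lemma measurable_precision (D : ModulatedInformation P n) : Measurable D.precision := by
  unfold precision
  fun_prop

lemma measurable_score_signal (D : ModulatedInformation P n) :
    Measurable fun p : (Fin n → I) × SubSpace D.signalSigma => D.score p.1 (ofSub p.2) := by
  refine Finset.measurable_fun_sum _ fun i _ => Measurable.div ?_ (by fun_prop)
  have h : Measurable fun p : (Fin n → I) × SubSpace D.signalSigma => (p.1 i, p.2) := by fun_prop
  exact (D.measurable_uncurry_xi_signal i).comp h

lemma measurable_uncurry_score (D : ModulatedInformation P n) :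
    Measurable fun p : (Fin n → I) × Ω => D.score p.1 p.2 := by
  refine Finset.measurable_fun_sum _ fun i _ => Measurable.div ?_ (by fun_prop)
  have h : Measurable fun p : (Fin n → I) × Ω => (p.1 i, p.2) := by fun_prop
  exact (D.measurable_uncurry_xi i).comp h

/-- The times at which the sources were last active. -/
def lastTimes (D : ModulatedInformation P n) (t : I) (ω : Ω) (i : Fin n) : I :=
  D.lastActive i t ω

lemma lastTimes_lt_one (D : ModulatedInformation P n) {t : I} (ht : t < 1) (ω : Ω) (i : Fin n) :
    D.lastTimes t ω i < 1 := (pathLastActive_le i t).trans_lt ht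

lemma le_lastTimes (D : ModulatedInformation P n) {u t : I} (hut : u ≤ t) {ω : Ω} {i : Fin n}
    (h : D.J u ω i = true) : u ≤ D.lastTimes t ω i := le_pathLastActive hut h

/-- The full information at time `t < 1`, enlarged by the whole switching process. -/
@[reducible] def fullSigma (D : ModulatedInformation P n) (t : I) : MeasurableSpace Ω :=
  D.switchSigma ⊔ D.rawSigma t

lemma fullSigma_le (D : ModulatedInformation P n) (t : I) : D.fullSigma t ≤ m :=
  sup_le D.switchSigma_le (D.rawSigma_le t)

/-- For a frozen switching path, the modulated process at `u ≤ t` shows source `i` only if it is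
active at `u`, and then `u` is at most its last active time. At `t = 1` this fails, as `X` itself is
observed. -/
lemma fullSigma_le_liftSigma (D : ModulatedInformation P n) {t : I} (ht : t < 1) :
    D.fullSigma t ≤
      liftSigma D.switchSigma D.signalSigma fun ω => D.upTo (D.lastTimes t ω) := by
  refine sup_le le_liftSigma_left (sup_le (sup_le ?_ ?_) ?_)
  · refine iSup₂_le fun u hu => ?_
    rintro _ ⟨B, hB, rfl⟩
    have hm : Measurable fun q : SubSpace D.switchSigma × SubSpace D.signalSigma =>
        fun i : Fin n => if D.J u (ofSub q.1) i = true then D.xi i u (ofSub q.2) else 0 := by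
      refine measurable_pi_lambda _ fun i => Measurable.ite ?_ ?_ measurable_const
      · exact ((measurable_pi_apply i).comp ((D.measurable_J_switch u).comp measurable_fst))
          (measurableSet_singleton true)
      · exact (D.measurable_uncurry_xi_signal i).comp (measurable_const.prodMk measurable_snd)
    refine ⟨_, hm hB, fun ω => Iff.rfl, fun ω => ?_⟩
    have hs : Measurable[D.upTo (D.lastTimes t ω)] fun ω' : Ω =>
        fun i : Fin n => if D.J u ω i = true then D.xi i u ω' else 0 := by
      refine @measurable_pi_lambda _ _ _ (D.upTo (D.lastTimes t ω)) _ _ fun i => ?_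
      by_cases hi : D.J u ω i = true
      · simp only [hi, if_true]
        exact (comap_measurable (D.xi i u)).mono
          (le_iSup_of_le i (le_iSup₂_of_le u (D.le_lastTimes hu hi) le_rfl)) le_rfl
      · simp only [hi]
        exact measurable_const
    exact hs hB
  · refine iSup₂_le fun u _ => le_trans ?_ le_liftSigma_left
    exact ((measurable_pi_apply u).comp
      (comap_measurable fun ω (t : I) => D.J t ω)).comap_le
  · rw [show (fun ω => if t = 1 then D.X ω else 0) = fun _ => 0 by simp [ht.ne],
      MeasurableSpace.comap_const]
    exact bot_le

/-- The explicit best estimate of the signal. -/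
def estimate (D : ModulatedInformation P n) (t : I) (ω : Ω) : ℝ :=
  posteriorMean P D.X (D.score (D.lastTimes t ω) ω) (D.precision (D.lastTimes t ω))

end ModulatedInformation

/-! ### Conditional expectations with a random σ-algebra of conditioning. -/

section Diagonal

variable {Ω : Type*} {m₁ m₂ m : MeasurableSpace Ω} {P : Measure Ω}

/-- The difference of `F` and `X` integrates to zero over each frozen event. Conditional
expectations do not increase the mean absolute value, so the mean of `|X|` bounds all frozen
integrals of `F`. -/
lemma setIntegral_eq_of_lift [IsProbabilityMeasure P] (h₁ : m₁ ≤ m) (h₂ : m₂ ≤ m)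
    (hind : Indep m₁ m₂ P) {C : Ω → MeasurableSpace Ω} (hC : ∀ ω, C ω ≤ m)
    {A : Set Ω} (hA : MeasurableSet[liftSigma m₁ m₂ C] A) (hAm : MeasurableSet A)
    {F : SubSpace m₁ × SubSpace m₂ → ℝ} (hF : Measurable F) {X : Ω → ℝ} (hXi : Integrable X P)
    (hX : Measurable fun ω : SubSpace m₂ => X (ofSub ω))
    (hFX : ∀ ω, (fun ω' : Ω => F (toSub m₁ ω, toSub m₂ ω')) =ᵐ[P] P[X | C ω]) :
    Integrable (fun ω : Ω => F (toSub m₁ ω, toSub m₂ ω)) P ∧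
      ∫ ω in A, F (toSub m₁ ω, toSub m₂ ω) ∂P = ∫ ω in A, X ω ∂P := by
  have hFi : ∀ ω : Ω, Integrable (fun ω' : Ω => F (toSub m₁ ω, toSub m₂ ω')) P := fun ω =>
    integrable_condExp.congr (hFX ω).symm
  have hFK : ∀ ω : Ω, ∫ ω' : Ω, |F (toSub m₁ ω, toSub m₂ ω')| ∂P ≤ ∫ ω, |X ω| ∂P := fun ω => by
    refine (integral_congr_ae ?_).trans_le (integral_abs_condExp_le (m := C ω) X)
    filter_upwards [hFX ω] with ω' h
    rw [h]
  have hX2 : Measurable fun q : SubSpace m₁ × SubSpace m₂ => X (ofSub q.2) := by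
    simpa only [Function.comp_def] using hX.comp measurable_snd
  have hei : Integrable (fun ω : Ω => F (toSub m₁ ω, toSub m₂ ω)) P :=
    (integral_diag_of_indep h₁ h₂ hind hF hFi hFK).1
  refine ⟨hei, ?_⟩
  have h := setIntegral_eq_zero_of_lift h₁ h₂ hind hC hA hAm
    (F := fun q => F q - X (ofSub q.2)) (K := (∫ ω, |X ω| ∂P) + ∫ ω, |X ω| ∂P)
    (hF.sub hX2) (fun ω => (hFi ω).sub hXi) (fun ω => ?_) (fun ω B hB => ?_)
  · have h' : ∫ ω in A, (F (toSub m₁ ω, toSub m₂ ω) - X ω) ∂P = 0 := h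
    rwa [integral_sub hei.integrableOn hXi.integrableOn, sub_eq_zero] at h'
  · have h2 : ∫ ω' : Ω, |F (toSub m₁ ω, toSub m₂ ω') - X ω'| ∂P ≤
        ∫ ω' : Ω, (|F (toSub m₁ ω, toSub m₂ ω')| + |X ω'|) ∂P :=
      integral_mono ((hFi ω).sub hXi).abs ((hFi ω).abs.add hXi.abs) fun ω' => abs_sub _ _
    rw [integral_add (hFi ω).abs hXi.abs] at h2
    exact h2.trans (add_le_add (hFK ω) le_rfl)
  · change ∫ ω' in B, (F (toSub m₁ ω, toSub m₂ ω') - X ω') ∂P = 0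
    rw [integral_sub (hFi ω).integrableOn hXi.integrableOn,
      setIntegral_congr_ae (hC ω B hB) ((hFX ω).mono fun _ h _ => h),
      setIntegral_condExp (hC ω) hXi hB, sub_self]

end Diagonal

/-! ### The explicit estimate, and what is measurable with respect to the observations. -/

namespace ModulatedInformation

variable {Ω : Type*} [m : MeasurableSpace Ω] {P : Measure Ω} {n : ℕ}

lemma integrable_X (D : ModulatedInformation P n) [IsProbabilityMeasure P] : Integrable D.X P :=
  D.X_memLp.integrable one_le_two

lemma measurable_lastTimes_switch (D : ModulatedInformation P n) (t : I) :
    Measurable fun ω : SubSpace D.switchSigma => D.lastTimes t (ofSub ω) :=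
  measurable_pi_lambda _ fun i => measurable_lastActive
    (J := fun u (ω : SubSpace D.switchSigma) => D.J u (ofSub ω))
    (fun u _ => D.measurable_J_switch u) (fun ω => D.cadlag (ofSub ω)) i

lemma measurable_uncurry_lastTimes (D : ModulatedInformation P n) :
    Measurable fun p : I × Ω => D.lastTimes p.1 p.2 :=
  measurable_pi_lambda _ fun i => measurable_uncurry_lastActive
    (J := D.J) D.J_measurable D.cadlag i

/-- The best estimate, as a function of two copies of the sample point, the first of which
determines the switching process, and the second the signal and the bridges. -/
def estimateLift (D : ModulatedInformation P n) (t : I)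
    (q : SubSpace D.switchSigma × SubSpace D.signalSigma) : ℝ :=
  posteriorMean P D.X (D.score (D.lastTimes t (ofSub q.1)) (ofSub q.2))
    (D.precision (D.lastTimes t (ofSub q.1)))

lemma measurable_estimateLift (D : ModulatedInformation P n) [IsProbabilityMeasure P] (t : I) :
    Measurable (D.estimateLift t) := by
  have h1 : Measurable fun q : SubSpace D.switchSigma × SubSpace D.signalSigma =>
      D.lastTimes t (ofSub q.1) := by
    simpa only [Function.comp_def] using (D.measurable_lastTimes_switch t).comp measurable_fst
  have h2 : Measurable fun q : SubSpace D.switchSigma × SubSpace D.signalSigma =>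
      D.score (D.lastTimes t (ofSub q.1)) (ofSub q.2) := by
    simpa only [Function.comp_def] using D.measurable_score_signal.comp (h1.prodMk measurable_snd)
  have h3 : Measurable fun q : SubSpace D.switchSigma × SubSpace D.signalSigma =>
      D.precision (D.lastTimes t (ofSub q.1)) := by
    simpa only [Function.comp_def] using D.measurable_precision.comp h1
  unfold estimateLift
  simpa only [Function.comp_def] using
    (measurable_posteriorMean (P := P) D.X_measurable).comp (h2.prodMk h3)

lemma measurable_uncurry_estimate (D : ModulatedInformation P n) [IsProbabilityMeasure P] :
    Measurable fun p : I × Ω => D.estimate p.1 p.2 := by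
  have h1 := D.measurable_uncurry_lastTimes
  have h2 : Measurable fun p : I × Ω => D.score (D.lastTimes p.1 p.2) p.2 := by
    simpa only [Function.comp_def] using D.measurable_uncurry_score.comp (h1.prodMk measurable_snd)
  have h3 : Measurable fun p : I × Ω => D.precision (D.lastTimes p.1 p.2) := by
    simpa only [Function.comp_def] using D.measurable_precision.comp h1
  unfold estimate
  simpa only [Function.comp_def] using
    (measurable_posteriorMean (P := P) D.X_measurable).comp (h2.prodMk h3)

/-- With the switching frozen this is `posteriorMean_score` at the last active times, which are
smaller than `1`. -/
lemma setIntegral_estimate (D : ModulatedInformation P n) [IsProbabilityMeasure P] {t : I}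
    (ht : t < 1) {A : Set Ω} (hA : MeasurableSet[D.fullSigma t] A) :
    Integrable (D.estimate t) P ∧ ∫ ω in A, D.estimate t ω ∂P = ∫ ω in A, D.X ω ∂P := by
  have h1 : ∀ ω : Ω, (fun ω' : Ω => D.estimateLift t (toSub D.switchSigma ω,
      toSub D.signalSigma ω')) =ᵐ[P] P[D.X | D.upTo (D.lastTimes t ω)] := fun ω => by
    have h := D.posteriorMean_score (c := D.lastTimes t ω) (D.lastTimes_lt_one ht ω)
    exact h
  have h2 := D.fullSigma_le_liftSigma ht A hA
  have h3 := D.fullSigma_le t A hA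
  have h4 := D.measurable_estimateLift t
  have h5 := D.measurable_X_signal
  have h := setIntegral_eq_of_lift D.switchSigma_le D.signalSigma_le D.indep_switch_signal
    (fun _ => D.upTo_le _) h2 h3 h4 D.integrable_X h5 h1
  exact h

/-- The observations up to time `t`, completed. -/
@[reducible] def obsSigma (D : ModulatedInformation P n) (t : I) : MeasurableSpace Ω :=
  D.rawSigma t ⊔ nullSigma P

lemma obsSigma_le (D : ModulatedInformation P n) (t : I) : D.obsSigma t ≤ m :=
  sup_le (D.rawSigma_le t) nullSigma_le

lemma obsSigma_mono (D : ModulatedInformation P n) : Monotone D.obsSigma :=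
  fun _ _ h => sup_le_sup_right (D.rawSigma_mono h) _

lemma measurable_J_obs (D : ModulatedInformation P n) {u t : I} (hu : u ≤ t) :
    Measurable fun ω : SubSpace (D.obsSigma t) => D.J u (ofSub ω) :=
  (comap_measurable (D.J u)).mono (le_sup_of_le_left (le_sup_of_le_left
    (le_sup_of_le_right (le_iSup₂_of_le u hu le_rfl)))) le_rfl

lemma measurable_modulated_obs (D : ModulatedInformation P n) {u t : I} (hu : u ≤ t) (i : Fin n) :
    Measurable fun ω : SubSpace (D.obsSigma t) => D.modulated u (ofSub ω) i := by
  have h : Measurable fun ω : SubSpace (D.obsSigma t) => D.modulated u (ofSub ω) :=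
    (comap_measurable (D.modulated u)).mono
      (le_sup_of_le_left (le_sup_of_le_left (le_sup_of_le_left (le_iSup₂_of_le u hu le_rfl))))
      le_rfl
  exact measurable_pi_iff.1 h i

/-- The value of an information process at an observable time near which the source is active is
observable. -/
lemma measurable_indicator_xi_obs (D : ModulatedInformation P n) {t : I} (i : Fin n) {ρ : Ω → I}
    (hρ : Measurable fun ω : SubSpace (D.obsSigma t) => ρ (ofSub ω)) {E : Set Ω}
    (hE : MeasurableSet[D.obsSigma t] E)
    (h : ∀ ω ∈ E, ∀ ε > 0, ∃ q ∈ denseTimes t, q ≤ t ∧ dist q (ρ ω) < ε ∧ D.J q ω i = true) :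
    Measurable[D.obsSigma t] (E.indicator fun ω => D.xi i (ρ ω) ω) :=
  measurable_indicator_of_approx (Ω' := SubSpace (D.obsSigma t)) (t := t) hρ hE
    (a := fun u ω => D.J u (ofSub ω) i = true)
    (fun _ hu => ((measurable_pi_apply i).comp (D.measurable_J_obs hu))
      (measurableSet_singleton true))
    (x := fun u ω => D.xi i u (ofSub ω)) (z := fun u ω => D.modulated u (ofSub ω) i)
    (fun _ hu => D.measurable_modulated_obs hu i) (fun ω => D.continuous_xi i (ofSub ω))
    (fun _ _ ha => if_pos ha) h

lemma measurable_lastActive_obs (D : ModulatedInformation P n) (t : I) (i : Fin n) :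
    Measurable fun ω : SubSpace (D.obsSigma t) => D.lastActive i t (ofSub ω) :=
  measurable_lastActive (J := fun u (ω : SubSpace (D.obsSigma t)) => D.J u (ofSub ω))
    (fun _ hu => D.measurable_J_obs hu) (fun ω => D.cadlag (ofSub ω)) i

/-- The last active time is a limit of times at which the source is visible, so continuity makes the
value there observable, whether or not the source is active at that very time. -/
lemma measurable_xi_lastActive_obs (D : ModulatedInformation P n) [IsProbabilityMeasure P]
    [P.IsComplete] (t : I) (i : Fin n) :
    Measurable[D.obsSigma t] fun ω => D.xi i (D.lastActive i t ω) ω := by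
  set E : Set Ω := {ω | ∃ q ∈ denseTimes t, q ≤ t ∧ D.J q ω i = true} with hE
  have hEm : MeasurableSet[D.obsSigma t] E := by
    have : E = ⋃ q ∈ denseTimes t, {ω | q ≤ t ∧ D.J q ω i = true} := by
      ext ω; simp only [hE, Set.mem_iUnion, Set.mem_ofPred_eq, exists_prop]
    rw [this]
    refine MeasurableSet.biUnion (countable_denseTimes t) fun q _ => ?_
    by_cases hq : q ≤ t
    · simp only [hq, true_and]
      exact ((measurable_pi_apply i).comp (D.measurable_J_obs hq)) (measurableSet_singleton true)
    · simp only [hq, false_and]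
      exact MeasurableSet.const False
  have hapx : ∀ ω ∈ E, ∀ ε > 0, ∃ q ∈ denseTimes t, q ≤ t ∧ dist q (D.lastActive i t ω) < ε
      ∧ D.J q ω i = true := by
    rintro ω ⟨q₀, hq₀, hq₀t, hJ⟩ ε hε
    have hle : q₀ ≤ D.lastActive i t ω := le_pathLastActive (f := fun u => D.J u ω) hq₀t hJ
    rcases hle.eq_or_lt with heq | hlt
    · exact ⟨q₀, hq₀, hq₀t, by rw [← heq, dist_self]; exact hε, hJ⟩
    · set ρ := D.lastActive i t ω
      have hpos : (0 : ℝ) ≤ max (q₀ : ℝ) ((ρ : ℝ) - ε / 2) := le_max_of_le_left q₀.2.1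
      have hlt' : max (q₀ : ℝ) ((ρ : ℝ) - ε / 2) < ρ := max_lt hlt (by linarith)
      set c : I := ⟨max (q₀ : ℝ) ((ρ : ℝ) - ε / 2), hpos, hlt'.le.trans ρ.2.2⟩
      have hc : c < ρ := hlt'
      obtain ⟨q, hq, hqt, hcq, hJq⟩ :=
        ((D.cadlag ω).lt_pathLastActive_iff (dense_denseTimes t) (self_mem_denseTimes t)).1 hc
      have hqρ : q ≤ ρ := le_pathLastActive (f := fun u => D.J u ω) hqt hJq
      refine ⟨q, hq, hqt, ?_, hJq⟩
      rw [Subtype.dist_eq, Real.dist_eq, abs_sub_comm, abs_of_nonneg (sub_nonneg.2 (show (q : ℝ) ≤ ρ from hqρ))]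
      have : (ρ : ℝ) - ε / 2 < q := (le_max_right _ _).trans_lt hcq
      linarith
  have h := D.measurable_indicator_xi_obs i (D.measurable_lastActive_obs t i) hEm hapx
  -- Off `E` the source has never been seen and its last active time is `0` by convention; the
  -- information process vanishes there almost surely, and null events are observable.
  refine measurable_of_ae_eq_of_null_le (P := P) le_sup_right h ?_
  filter_upwards [D.xi_zero_ae_eq i] with ω hω
  by_cases hωE : ω ∈ E
  · rw [Set.indicator_of_mem hωE]
  · have h0 : D.lastActive i t ω = 0 := by
      by_contra hne
      have hpos : 0 < D.lastActive i t ω := lt_of_le_of_ne unitInterval.nonneg' (Ne.symm hne)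
      obtain ⟨q, hq, hqt, -, hJq⟩ :=
        ((D.cadlag ω).lt_pathLastActive_iff (dense_denseTimes t) (self_mem_denseTimes t)).1 hpos
      exact hωE ⟨q, hq, hqt, hJq⟩
    rw [Set.indicator_of_notMem hωE, h0, hω]
    rfl

lemma measurable_xi_active_obs (D : ModulatedInformation P n) (t : I) (i : Fin n) :
    Measurable[D.obsSigma t] fun ω => if D.J t ω i = true then D.xi i t ω else 0 :=
  D.measurable_modulated_obs le_rfl i

lemma measurable_of_J_obs (D : ModulatedInformation P n) {E : Type*} [MeasurableSpace E] (t : I)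
    (g : (Fin n → Bool) → E) : Measurable[D.obsSigma t] fun ω => g (D.J t ω) :=
  (measurable_of_finite g).comp (D.measurable_J_obs le_rfl)

lemma measurable_volHat_obs (D : ModulatedInformation P n) (t : I) :
    Measurable[D.obsSigma t] (D.volHat t) :=
  D.measurable_of_J_obs t fun b =>
    (√(∑ i ∈ Finset.univ.filter fun i => b i = true, (D.vol i ^ 2)⁻¹))⁻¹

lemma measurable_xiHat_obs (D : ModulatedInformation P n) (t : I) :
    Measurable[D.obsSigma t] (D.xiHat t) := by
  have h : D.xiHat t = fun ω => D.volHat t ω ^ 2 * ∑ i, (D.vol i ^ 2)⁻¹ *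
      (if D.J t ω i = true then D.xi i t ω else 0) := by
    ext ω
    rw [xiHat, active, Finset.sum_filter]
    simp only [mul_ite, mul_zero]
  rw [h]
  exact ((D.measurable_volHat_obs t).pow_const 2).mul (Finset.measurable_fun_sum _ fun i _ =>
    (D.measurable_xi_active_obs t i).const_mul _)

lemma measurable_eta_obs (D : ModulatedInformation P n) [IsProbabilityMeasure P] [P.IsComplete]
    (t : I) : Measurable[D.obsSigma t] (D.eta t) := by
  refine @measurable_pi_lambda _ _ _ (D.obsSigma t) _ _ fun x => ?_
  have h : (fun ω => D.eta t ω x) = fun ω => ∏ i, if D.J t ω i = true then 1 else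
      gaussH x (D.xi i (D.lastActive i t ω) ω) (D.lastActive i t ω) (D.vol i) := by
    ext ω
    have hc : (D.active t ω)ᶜ = Finset.univ.filter fun i => ¬ D.J t ω i = true := by
      ext i; simp [active]
    rw [eta, hc, Finset.prod_filter]
    refine Finset.prod_congr rfl fun i _ => ?_
    split_ifs <;> rfl
  rw [h]
  refine Finset.measurable_fun_prod _ fun i _ => Measurable.ite ?_ measurable_const ?_
  · exact ((measurable_pi_apply i).comp (D.measurable_J_obs le_rfl)) (measurableSet_singleton true)
  · have h1 := D.measurable_xi_lastActive_obs t i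
    have h2 : Measurable[D.obsSigma t] fun ω => (D.lastActive i t ω : ℝ) :=
      measurable_subtype_coe.comp (D.measurable_lastActive_obs t i)
    have h3 : Measurable fun q : ℝ × ℝ => gaussH x q.1 q.2 (D.vol i) := by
      unfold gaussH
      fun_prop
    exact h3.comp (h1.prodMk h2)

lemma infoSigma_le_obsSigma (D : ModulatedInformation P n) [IsProbabilityMeasure P] [P.IsComplete]
    (t : I) : D.infoSigma t ≤ D.obsSigma t :=
  ((D.measurable_xiHat_obs t).prodMk
    ((D.measurable_volHat_obs t).prodMk (D.measurable_eta_obs t))).comap_le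

end ModulatedInformation

/-! ### The estimate depends on the effective and complementary information only. -/

lemma exists_measurable_parabola_coeff (S : Set ℝ) : ∃ g : (S → ℝ) → ℝ × ℝ, Measurable g ∧
    ∀ (y b : ℝ) (x : S), (x : ℝ) * (g fun x => (x : ℝ) * y - b * (x : ℝ) ^ 2 / 2).1
      - (g fun x => (x : ℝ) * y - b * (x : ℝ) ^ 2 / 2).2 * (x : ℝ) ^ 2 / 2
      = (x : ℝ) * y - b * (x : ℝ) ^ 2 / 2 := by
  by_cases h : ∃ c : S, (c : ℝ) ≠ 0
  · obtain ⟨c, hc⟩ := h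
    by_cases h' : ∃ d : S, (d : ℝ) ≠ 0 ∧ (d : ℝ) ≠ c
    · obtain ⟨d, hd, hdc⟩ := h'
      -- At a nonzero point, `q x / x = y - b x / 2`; two such points determine `y` and `b`.
      -- Evaluation at finitely many points is measurable even if the state space is uncountable.
      refine ⟨fun q => (q c / c + (q c / c - q d / d) / (d - c) * c,
        2 * ((q c / c - q d / d) / (d - c))), by fun_prop, fun y b x => ?_⟩
      have hdc' : (d : ℝ) - c ≠ 0 := sub_ne_zero.2 hdc
      field_simp
      ring
    · push Not at h'
      -- With a single nonzero point the parabola is determined by one value, so a linear function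
      -- with that value serves.
      refine ⟨fun q => (q c / c, 0), by fun_prop, fun y b x => ?_⟩
      rcases eq_or_ne (x : ℝ) 0 with hx | hx
      · simp [hx]
      · rw [h' x hx]
        field_simp
        ring
  · push Not at h
    exact ⟨fun _ => 0, measurable_const, fun y b x => by simp [h x]⟩

lemma posteriorMean_congr {Ω : Type*} {m : MeasurableSpace Ω} (P : Measure Ω) {X : Ω → ℝ}
    {y y' b b' : ℝ} (h : ∀ ω, X ω * y - b * X ω ^ 2 / 2 = X ω * y' - b' * X ω ^ 2 / 2) :
    posteriorMean P X y b = posteriorMean P X y' b' := by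
  simp only [posteriorMean, h]

namespace ModulatedInformation

variable {Ω : Type*} {m' : MeasurableSpace Ω} [m : MeasurableSpace Ω] {P : Measure Ω} {n : ℕ}

lemma J_eq_true_iff_mem_active (D : ModulatedInformation P n) {t : I} {ω : Ω} {i : Fin n} :
    i ∈ D.active t ω ↔ D.J t ω i = true := by simp [active]

lemma lastTimes_eq_of_mem_active (D : ModulatedInformation P n) {t : I} {ω : Ω} {i : Fin n}
    (h : i ∈ D.active t ω) : D.lastTimes t ω i = t :=
  pathLastActive_eq_self (D.J_eq_true_iff_mem_active.1 h)

lemma sum_active_pos (D : ModulatedInformation P n) {t : I} {ω : Ω}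
    (h : (D.active t ω).Nonempty) : 0 < ∑ i ∈ D.active t ω, (D.vol i ^ 2)⁻¹ :=
  Finset.sum_pos (fun i _ => inv_pos.2 (pow_pos (D.vol_pos i) 2)) h

lemma volHat_sq (D : ModulatedInformation P n) (t : I) (ω : Ω) :
    D.volHat t ω ^ 2 = (∑ i ∈ D.active t ω, (D.vol i ^ 2)⁻¹)⁻¹ := by
  rw [volHat, inv_pow, Real.sq_sqrt]
  exact Finset.sum_nonneg fun i _ => inv_nonneg.2 (sq_nonneg _)

/-- The effective and the complementary information determine the likelihood of the signal. -/
lemma likelihood_eq (D : ModulatedInformation P n) {t : I} (ht : t < 1) (ω : Ω) (x : D.S) :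
    (x : ℝ) * D.score (D.lastTimes t ω) ω - D.precision (D.lastTimes t ω) * (x : ℝ) ^ 2 / 2
      = (x * D.xiHat t ω - t * (x : ℝ) ^ 2 / 2) / (D.volHat t ω ^ 2 * (1 - (t : ℝ)))
        + Real.log (D.eta t ω x) := by
  set f : Fin n → ℝ := fun i => ((x : ℝ) * D.xi i (D.lastTimes t ω i) ω
    - D.lastTimes t ω i * (x : ℝ) ^ 2 / 2) / (D.vol i ^ 2 * (1 - (D.lastTimes t ω i : ℝ))) with hf
  have h1 : (x : ℝ) * D.score (D.lastTimes t ω) ω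
      - D.precision (D.lastTimes t ω) * (x : ℝ) ^ 2 / 2 = ∑ i, f i := by
    rw [score, precision, Finset.mul_sum, Finset.sum_mul, Finset.sum_div,
      ← Finset.sum_sub_distrib]
    refine Finset.sum_congr rfl fun i _ => ?_
    rw [hf]
    ring
  have h2 : Real.log (D.eta t ω x) = ∑ i ∈ (D.active t ω)ᶜ, f i := by
    simp only [eta, gaussH]
    rw [Real.log_prod fun i _ => (Real.exp_pos _).ne']
    exact Finset.sum_congr rfl fun i _ => Real.log_exp _
  rw [h1, h2, ← Finset.sum_add_sum_compl (D.active t ω) f]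
  congr 1
  rcases (D.active t ω).eq_empty_or_nonempty with he | hne
  -- With no active source `volHat` is `0`, and the quotient is `0` by the convention on division,
  -- as is the empty sum.
  · rw [volHat_sq, he]
    simp
  · have hs := D.sum_active_pos hne
    have ht' : (1 : ℝ) - t ≠ 0 := (sub_pos.2 (show (t : ℝ) < 1 from ht)).ne'
    have h3 : ∑ i ∈ D.active t ω, f i = ∑ i ∈ D.active t ω, (D.vol i ^ 2)⁻¹ *
        (x * D.xi i t ω - t * (x : ℝ) ^ 2 / 2) / (1 - t) := by
      refine Finset.sum_congr rfl fun i hi => ?_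
      rw [hf]
      simp only [D.lastTimes_eq_of_mem_active hi]
      have := (D.vol_pos i).ne'
      field_simp
    rw [h3, xiHat, volHat_sq, ← Finset.sum_div]
    have h4 : ∑ i ∈ D.active t ω, (D.vol i ^ 2)⁻¹ * (x * D.xi i t ω - t * (x : ℝ) ^ 2 / 2)
        = x * ∑ i ∈ D.active t ω, (D.vol i ^ 2)⁻¹ * D.xi i t ω
          - (∑ i ∈ D.active t ω, (D.vol i ^ 2)⁻¹) * (t * (x : ℝ) ^ 2 / 2) := by
      rw [Finset.mul_sum, Finset.sum_mul, ← Finset.sum_sub_distrib]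
      exact Finset.sum_congr rfl fun i _ => by ring
    rw [h4]
    generalize ∑ i ∈ D.active t ω, (D.vol i ^ 2)⁻¹ * D.xi i t ω = z
    generalize ∑ i ∈ D.active t ω, (D.vol i ^ 2)⁻¹ = s at hs
    field_simp

/-- By `likelihood_eq` the information determines the log-likelihood as a function on the state
space. Its coefficients need not be unique there, but any choice gives the same posterior mean
because `X` takes values in the state space. -/
lemma measurable_estimate_info (D : ModulatedInformation P n) [IsProbabilityMeasure P] {t : I}
    (ht : t < 1) : Measurable[D.infoSigma t] (D.estimate t) := by
  obtain ⟨g, hg, hgq⟩ := exists_measurable_parabola_coeff D.S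
  set Q : ℝ × ℝ × (D.S → ℝ) → D.S → ℝ := fun p x =>
    (x * p.1 - t * (x : ℝ) ^ 2 / 2) / (p.2.1 ^ 2 * (1 - (t : ℝ))) + Real.log (p.2.2 x) with hQ
  have hQm : Measurable Q := by
    rw [hQ]
    refine measurable_pi_lambda _ fun x => ?_
    fun_prop
  have he : D.estimate t = fun ω => (fun p => posteriorMean P D.X (g (Q p)).1 (g (Q p)).2)
      (D.xiHat t ω, D.volHat t ω, D.eta t ω) := by
    ext ω
    rw [estimate]
    refine posteriorMean_congr P fun ω' => ?_
    have hq : Q (D.xiHat t ω, D.volHat t ω, D.eta t ω) = fun x : D.S =>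
        (x : ℝ) * D.score (D.lastTimes t ω) ω
          - D.precision (D.lastTimes t ω) * (x : ℝ) ^ 2 / 2 :=
      funext fun x => (D.likelihood_eq ht ω x).symm
    rw [hq]
    exact (hgq _ _ ⟨D.X ω', D.X_mem ω'⟩).symm
  have hm : Measurable fun p : ℝ × ℝ × (D.S → ℝ) => posteriorMean P D.X (g (Q p)).1 (g (Q p)).2 := by
    simpa only [Function.comp_def, Prod.mk.eta] using
      (measurable_posteriorMean (P := P) D.X_measurable).comp (hg.comp hQm)
  rw [he]
  exact hm.comp (comap_measurable fun ω => (D.xiHat t ω, D.volHat t ω, D.eta t ω))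

/-- The information at time `t`, enlarged by the whole switching process and completed. -/
@[reducible] def wholeSigma (D : ModulatedInformation P n) (t : I) : MeasurableSpace Ω :=
  D.fullSigma t ⊔ nullSigma P

lemma wholeSigma_le (D : ModulatedInformation P n) (t : I) : D.wholeSigma t ≤ m :=
  sup_le (D.fullSigma_le t) nullSigma_le

lemma wholeSigma_mono (D : ModulatedInformation P n) : Monotone D.wholeSigma :=
  fun _ _ h => sup_le_sup_right (sup_le_sup_left (D.rawSigma_mono h) _) _

lemma obsSigma_le_wholeSigma (D : ModulatedInformation P n) (t : I) :
    D.obsSigma t ≤ D.wholeSigma t := sup_le_sup_right le_sup_right _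

lemma switchSigma_le_wholeSigma (D : ModulatedInformation P n) (t : I) :
    D.switchSigma ≤ D.wholeSigma t := le_sup_of_le_left le_sup_left

lemma integrable_estimate (D : ModulatedInformation P n) [IsProbabilityMeasure P] {t : I}
    (ht : t < 1) : Integrable (D.estimate t) P :=
  (D.setIntegral_estimate ht (@MeasurableSet.univ _ (D.fullSigma t))).1

lemma setIntegral_estimate_whole (D : ModulatedInformation P n) [IsProbabilityMeasure P] {t : I}
    (ht : t < 1) {A : Set Ω} (hA : MeasurableSet[D.wholeSigma t] A) :
    ∫ ω in A, D.estimate t ω ∂P = ∫ ω in A, D.X ω ∂P := by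
  obtain ⟨B, hB, hAB⟩ := exists_ae_eq_of_measurableSet_sup_null hA
  rw [setIntegral_congr_set hAB, setIntegral_congr_set hAB]
  exact (D.setIntegral_estimate ht hB).2

/-- One variable serves for all σ-algebras between `infoSigma` and `wholeSigma`: it is measurable
for the smallest and has the right integrals over the events of the largest. -/
lemma estimate_ae_eq_condExp (D : ModulatedInformation P n) [IsProbabilityMeasure P]
    {t : I} (ht : t < 1) (hm' : m' ≤ D.wholeSigma t)
    (hinfo : D.infoSigma t ≤ m') : D.estimate t =ᵐ[P] P[D.X | m'] :=
  ae_eq_condExp_of_forall_setIntegral_eq (hm'.trans (D.wholeSigma_le t)) D.integrable_X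
    (fun _ _ _ => (D.integrable_estimate ht).integrableOn)
    (fun _ hs _ => D.setIntegral_estimate_whole ht (hm' _ hs))
    ((D.measurable_estimate_info ht).mono hinfo le_rfl).stronglyMeasurable.aestronglyMeasurable

lemma IsBestEstimate.integrable {D : ModulatedInformation P n} {Y : I → Ω → ℝ}
    (hY : D.IsBestEstimate Y) {t : I} (ht : t < 1) : Integrable (Y t) P :=
  integrable_condExp.congr (hY.version t ht).symm

variable [IsProbabilityMeasure P] [P.IsComplete]

theorem isBestEstimate_estimate (D : ModulatedInformation P n) : D.IsBestEstimate D.estimate where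
  measurable := D.measurable_uncurry_estimate
  version t ht := D.estimate_ae_eq_condExp ht
    ((D.infoSigma_le_obsSigma t).trans (D.obsSigma_le_wholeSigma t)) le_rfl

variable {D : ModulatedInformation P n} {Y : I → Ω → ℝ}

lemma IsBestEstimate.ae_eq_condExp (hY : D.IsBestEstimate Y) {t : I} (ht : t < 1)
    (hm' : m' ≤ D.wholeSigma t) (hinfo : D.infoSigma t ≤ m') :
    Y t =ᵐ[P] P[D.X | m'] :=
  (hY.version t ht).trans ((D.isBestEstimate_estimate.version t ht).symm.trans
    (D.estimate_ae_eq_condExp ht hm' hinfo))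

lemma IsBestEstimate.setIntegral_eq (hY : D.IsBestEstimate Y) {t : I} (ht : t < 1) {A : Set Ω}
    (hA : MeasurableSet[D.wholeSigma t] A) : ∫ ω in A, Y t ω ∂P = ∫ ω in A, D.X ω ∂P := by
  rw [setIntegral_congr_ae (D.wholeSigma_le t A hA) ((hY.ae_eq_condExp ht le_rfl
    ((D.infoSigma_le_obsSigma t).trans (D.obsSigma_le_wholeSigma t))).mono fun _ h _ => h),
    setIntegral_condExp (D.wholeSigma_le t) D.integrable_X hA]

end ModulatedInformation

/-! ### Integrability of the drift. -/

lemma integrable_inv_sqrt_one_sub : Integrable fun s : I => (√(1 - (s : ℝ)))⁻¹ := by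
  have h1 : IntervalIntegrable (fun x : ℝ => x ^ (-(1 / 2) : ℝ)) volume 0 1 :=
    intervalIntegral.intervalIntegrable_rpow' (by norm_num)
  have h2 := (h1.comp_sub_left 1).symm
  simp only [sub_zero, sub_self] at h2
  rw [intervalIntegrable_iff_integrableOn_Icc_of_le zero_le_one] at h2
  have h3 : Integrable (fun x : ℝ => (1 - x) ^ (-(1 / 2) : ℝ))
      (Measure.map ((↑) : I → ℝ) volume) := by
    rw [show Measure.map ((↑) : I → ℝ) volume = volume.restrict I from
      map_comap_subtype_coe measurableSet_Icc volume]
    exact h2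
  have h4 := ((MeasurableEmbedding.subtype_coe measurableSet_Icc).integrable_map_iff).1 h3
  refine h4.congr (ae_of_all _ fun s => ?_)
  simp only [Function.comp_apply]
  rw [Real.rpow_neg (sub_nonneg.2 s.2.2), ← Real.sqrt_eq_rpow]

lemma integral_abs_le_sqrt_variance {Ω : Type*} [MeasurableSpace Ω] {P : Measure Ω}
    [IsProbabilityMeasure P] {f : Ω → ℝ} (hf : MemLp f 2 P) (h0 : ∫ ω, f ω ∂P = 0) :
    ∫ ω, |f ω| ∂P ≤ √(Var[f; P]) := by
  refine Real.le_sqrt_of_sq_le ?_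
  have h1 := variance_nonneg (fun ω => |f ω|) P
  have h2 : Var[fun ω => |f ω|; P] = _ := variance_eq_sub (μ := P) hf.abs
  rw [variance_eq_sub hf, h0]
  rw [h2] at h1
  simp only [Pi.pow_apply, sq_abs] at h1 ⊢
  linarith

lemma ae_lt_one : ∀ᵐ t : I, t < 1 := by
  have h : ({1} : Set I)ᶜ ∈ ae (volume : Measure I) := compl_mem_ae_iff.2 (by simp)
  filter_upwards [h] with t ht
  exact lt_of_le_of_ne unitInterval.le_one' ht

namespace ModulatedInformation

variable {Ω : Type*} [m : MeasurableSpace Ω] {P : Measure Ω} {n : ℕ}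

/-- The weight of source `i` in the effective information when `a` is the activity pattern. -/
def weight (D : ModulatedInformation P n) (a : Fin n → Bool) (i : Fin n) : ℝ :=
  (if a i = true then (D.vol i ^ 2)⁻¹ else 0) / ∑ j, if a j = true then (D.vol j ^ 2)⁻¹ else 0

/-- The effective information of the sources in the activity pattern `a`. -/
def effective (D : ModulatedInformation P n) (a : Fin n → Bool) (t : I) (ω : Ω) : ℝ :=
  ∑ i, D.weight a i * D.xi i t ω

lemma weight_of_false (D : ModulatedInformation P n) {a : Fin n → Bool} {i : Fin n}
    (h : a i ≠ true) : D.weight a i = 0 := by simp [weight, h]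

lemma weight_summand_nonneg (D : ModulatedInformation P n) (a : Fin n → Bool) (i : Fin n) :
    0 ≤ if a i = true then (D.vol i ^ 2)⁻¹ else 0 := by
  split_ifs
  · exact inv_nonneg.2 (sq_nonneg _)
  · exact le_rfl

lemma weight_nonneg (D : ModulatedInformation P n) (a : Fin n → Bool) (i : Fin n) :
    0 ≤ D.weight a i :=
  div_nonneg (D.weight_summand_nonneg a i) (Finset.sum_nonneg fun j _ => D.weight_summand_nonneg a j)

lemma weight_le_one (D : ModulatedInformation P n) (a : Fin n → Bool) (i : Fin n) :
    D.weight a i ≤ 1 :=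
  div_le_one_of_le₀ (Finset.single_le_sum (f := fun j => if a j = true then (D.vol j ^ 2)⁻¹ else 0)
    (fun j _ => D.weight_summand_nonneg a j) (Finset.mem_univ i))
    (Finset.sum_nonneg fun j _ => D.weight_summand_nonneg a j)

lemma sum_weight (D : ModulatedInformation P n) {a : Fin n → Bool} (h : ∃ i, a i = true) :
    ∑ i, D.weight a i = 1 := by
  obtain ⟨i, hi⟩ := h
  have hpos : 0 < ∑ j, if a j = true then (D.vol j ^ 2)⁻¹ else 0 := by
    refine Finset.sum_pos' (fun j _ => D.weight_summand_nonneg a j) ⟨i, Finset.mem_univ i, ?_⟩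
    rw [if_pos hi]
    exact inv_pos.2 (pow_pos (D.vol_pos i) 2)
  simp only [weight]
  rw [← Finset.sum_div, div_self hpos.ne']

lemma active_nonempty_iff (D : ModulatedInformation P n) {t : I} {ω : Ω} :
    (D.active t ω).Nonempty ↔ ∃ i, D.J t ω i = true := by
  simp only [Finset.Nonempty, J_eq_true_iff_mem_active]

lemma xiHat_eq_effective (D : ModulatedInformation P n) (t : I) (ω : Ω) :
    D.xiHat t ω = D.effective (D.J t ω) t ω := by
  rw [xiHat, volHat_sq, effective, active, Finset.sum_filter, Finset.sum_filter, Finset.mul_sum]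
  refine Finset.sum_congr rfl fun i _ => ?_
  rw [weight]
  split_ifs <;> ring

lemma effective_eq (D : ModulatedInformation P n) {a : Fin n → Bool} (h : ∃ i, a i = true)
    (t : I) (ω : Ω) : D.effective a t ω
      = (t : ℝ) * D.X ω + ∑ i, D.weight a i * D.vol i * D.β i t ω := by
  have h1 : ∀ i, D.weight a i * D.xi i t ω
      = D.weight a i * ((t : ℝ) * D.X ω) + D.weight a i * D.vol i * D.β i t ω := fun i => by
    rw [xi]; ring
  rw [effective, Finset.sum_congr rfl fun i _ => h1 i, Finset.sum_add_distrib, ← Finset.sum_mul,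
    D.sum_weight h, one_mul]

lemma continuous_effective (D : ModulatedInformation P n) (a : Fin n → Bool) (ω : Ω) :
    Continuous fun t => D.effective a t ω :=
  continuous_finsetSum _ fun i _ => continuous_const.mul (D.continuous_xi i ω)

lemma abs_X_sub_effective_le (D : ModulatedInformation P n) {a : Fin n → Bool}
    (h : ∃ i, a i = true) (t : I) (ω : Ω) :
    |D.X ω - D.effective a t ω| ≤ (1 - (t : ℝ)) * |D.X ω| + ∑ i, D.vol i * |D.β i t ω| := by
  rw [D.effective_eq h, show D.X ω - ((t : ℝ) * D.X ω + ∑ i, D.weight a i * D.vol i * D.β i t ω)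
    = (1 - (t : ℝ)) * D.X ω - ∑ i, D.weight a i * D.vol i * D.β i t ω by ring]
  refine (abs_sub _ _).trans (add_le_add ?_ ((Finset.abs_sum_le_sum_abs _ _).trans
    (Finset.sum_le_sum fun i _ => ?_)))
  · rw [abs_mul, abs_of_nonneg (sub_nonneg.2 t.2.2)]
  · rw [abs_mul, abs_of_nonneg (mul_nonneg (D.weight_nonneg a i) (D.vol_pos i).le)]
    exact mul_le_mul_of_nonneg_right
      (mul_le_of_le_one_left (D.vol_pos i).le (D.weight_le_one a i)) (abs_nonneg _)

lemma measurable_uncurry_active (D : ModulatedInformation P n) :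
    MeasurableSet {p : I × Ω | (D.active p.1 p.2).Nonempty} := by
  have h : {p : I × Ω | (D.active p.1 p.2).Nonempty} =
      (fun p : I × Ω => D.J p.1 p.2) ⁻¹' {a | ∃ i, a i = true} := by
    ext p; exact D.active_nonempty_iff
  rw [h]
  exact measurable_uncurry_J (J := D.J) D.J_measurable D.cadlag (Set.toFinite _).measurableSet

lemma measurable_uncurry_xiHat (D : ModulatedInformation P n) :
    Measurable fun p : I × Ω => D.xiHat p.1 p.2 := by
  simp only [xiHat_eq_effective, effective]
  refine Finset.measurable_fun_sum _ fun i _ => Measurable.mul ?_ (D.measurable_uncurry_xi i)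
  have h := measurable_uncurry_J (J := D.J) D.J_measurable D.cadlag
  simpa only [Function.comp_def] using (measurable_of_finite fun a => D.weight a i).comp h

lemma measurableSet_active_obs (D : ModulatedInformation P n) (t : I) :
    MeasurableSet[D.obsSigma t] {ω | (D.active t ω).Nonempty} := by
  have h : {ω | (D.active t ω).Nonempty} = (D.J t) ⁻¹' {a | ∃ i, a i = true} := by
    ext ω; exact D.active_nonempty_iff
  rw [h]
  exact D.measurable_J_obs le_rfl (Set.toFinite _).measurableSet

/-- The drift at the times at which some source is active, and zero at the other times. -/
def activeDrift (D : ModulatedInformation P n) (Y : I → Ω → ℝ) (p : I × Ω) : ℝ :=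
  {p : I × Ω | (D.active p.1 p.2).Nonempty}.indicator (fun p => D.drift Y p.1 p.2) p

lemma IsBestEstimate.measurable_activeDrift {D : ModulatedInformation P n} {Y : I → Ω → ℝ}
    (hY : D.IsBestEstimate Y) :
    Measurable (D.activeDrift Y) := by
  refine Measurable.indicator ?_ D.measurable_uncurry_active
  have h : Measurable fun p : I × Ω => Y p.1 p.2 := hY.measurable
  have h' := D.measurable_uncurry_xiHat
  unfold drift
  fun_prop

lemma activeDrift_eq (D : ModulatedInformation P n) (Y : I → Ω → ℝ) (t : I) (ω : Ω) : D.activeDrift Y (t, ω) =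
    {ω | (D.active t ω).Nonempty}.indicator (fun ω => Y t ω - D.xiHat t ω) ω / (1 - (t : ℝ)) := by
  by_cases hω : (D.active t ω).Nonempty <;>
    simp [activeDrift, drift, hω]

variable [IsProbabilityMeasure P]

/-- The increment is centred with variance `|s - t| - (s - t)²`. -/
lemma integral_abs_β_sub_le (D : ModulatedInformation P n) (i : Fin n) (s t : I) :
    ∫ ω, |D.β i s ω - D.β i t ω| ∂P ≤ √|(s : ℝ) - t| := by
  have hs := D.memLp_β i s
  have ht := D.memLp_β i t
  have h0 : ∫ ω, (D.β i s ω - D.β i t ω) ∂P = 0 := by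
    rw [integral_sub (hs.integrable one_le_two) (ht.integrable one_le_two), (D.bridge i).mean,
      (D.bridge i).mean, sub_zero]
  refine (integral_abs_le_sqrt_variance (hs.sub ht) h0).trans (Real.sqrt_le_sqrt ?_)
  rw [variance_sub hs ht, ← covariance_self hs.aemeasurable, ← covariance_self ht.aemeasurable,
    (D.bridge i).covariance, (D.bridge i).covariance, (D.bridge i).covariance, min_self, min_self]
  rcases le_total (s : ℝ) t with h | h
  · rw [min_eq_left h, abs_of_nonpos (sub_nonpos.2 h)]
    nlinarith [sq_nonneg ((s : ℝ) - t)]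
  · rw [min_eq_right h, abs_of_nonneg (sub_nonneg.2 h)]
    nlinarith [sq_nonneg ((s : ℝ) - t)]

lemma integral_abs_β_le (D : ModulatedInformation P n) (i : Fin n) (t : I) :
    ∫ ω, |D.β i t ω| ∂P ≤ √(1 - (t : ℝ)) := by
  have h := D.integral_abs_β_sub_le i t 1
  rw [abs_sub_comm, Set.Icc.coe_one, abs_of_nonneg (sub_nonneg.2 t.2.2)] at h
  refine (integral_congr_ae ?_).trans_le h
  filter_upwards [D.β_ae_eq_zero i (t := 1) (by norm_num)] with ω hω
  rw [hω, Pi.zero_apply, sub_zero]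

lemma integrable_β (D : ModulatedInformation P n) (i : Fin n) (t : I) : Integrable (D.β i t) P :=
  (D.memLp_β i t).integrable one_le_two

/-- The constant in the bound of the distance between the signal and the effective information. -/
def gapBound (D : ModulatedInformation P n) : ℝ := (∫ ω, |D.X ω| ∂P) + ∑ i, D.vol i

lemma integral_gap_le (D : ModulatedInformation P n) (t : I) :
    Integrable (fun ω => (1 - (t : ℝ)) * |D.X ω| + ∑ i, D.vol i * |D.β i t ω|) P ∧
    ∫ ω, ((1 - (t : ℝ)) * |D.X ω| + ∑ i, D.vol i * |D.β i t ω|) ∂P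
      ≤ D.gapBound * √(1 - (t : ℝ)) := by
  have hX := D.integrable_X.abs.const_mul (1 - (t : ℝ))
  have hβ : ∀ i, Integrable (fun ω => D.vol i * |D.β i t ω|) P :=
    fun i => (D.integrable_β i t).abs.const_mul _
  refine ⟨hX.add (integrable_finsetSum _ fun i _ => hβ i), ?_⟩
  rw [integral_add hX (integrable_finsetSum _ fun i _ => hβ i), integral_finsetSum _ fun i _ => hβ i,
    integral_const_mul, gapBound, add_mul, Finset.sum_mul]
  have h0 : 0 ≤ 1 - (t : ℝ) := sub_nonneg.2 t.2.2
  refine add_le_add ?_ (Finset.sum_le_sum fun i _ => ?_)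
  · rw [mul_comm]
    refine mul_le_mul_of_nonneg_left ?_ (integral_nonneg fun _ => abs_nonneg _)
    exact Real.le_sqrt_of_sq_le (by nlinarith [t.2.1, t.2.2])
  · rw [integral_const_mul]
    exact mul_le_mul_of_nonneg_left (D.integral_abs_β_le i t) (D.vol_pos i).le

variable [P.IsComplete] {D : ModulatedInformation P n} {Y : I → Ω → ℝ}

/-- Where a source is active, `Y - xiHat` is the conditional expectation of `X - xiHat` given the
observations. So the bound for `X - xiHat`, which is small near time `1` because the bridges return
to zero, carries over. -/
lemma IsBestEstimate.integral_abs_sub_xiHat_le (hY : D.IsBestEstimate Y) {t : I} (ht : t < 1) :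
    Integrable ({ω | (D.active t ω).Nonempty}.indicator fun ω => Y t ω - D.xiHat t ω) P ∧
    ∫ ω, |{ω | (D.active t ω).Nonempty}.indicator (fun ω => Y t ω - D.xiHat t ω) ω| ∂P
      ≤ D.gapBound * √(1 - (t : ℝ)) := by
  have hle := D.obsSigma_le t
  set E : Set Ω := {ω | (D.active t ω).Nonempty} with hE
  have hEm : MeasurableSet[D.obsSigma t] E := D.measurableSet_active_obs t
  have hgap := D.integral_gap_le t
  have hpt : ∀ ω, |E.indicator (fun ω => D.X ω - D.xiHat t ω) ω| ≤
      (1 - (t : ℝ)) * |D.X ω| + ∑ i, D.vol i * |D.β i t ω| := fun ω => by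
    by_cases hω : ω ∈ E
    · rw [Set.indicator_of_mem hω, xiHat_eq_effective]
      exact D.abs_X_sub_effective_le (D.active_nonempty_iff.1 hω) t ω
    · rw [Set.indicator_of_notMem hω, abs_zero]
      exact add_nonneg (mul_nonneg (sub_nonneg.2 t.2.2) (abs_nonneg _))
        (Finset.sum_nonneg fun i _ => mul_nonneg (D.vol_pos i).le (abs_nonneg _))
  have hxm : Measurable[D.obsSigma t] (D.xiHat t) := D.measurable_xiHat_obs t
  have hVi : Integrable (E.indicator fun ω => D.X ω - D.xiHat t ω) P :=
    hgap.1.mono ((D.X_measurable.sub (hxm.mono hle le_rfl)).indicator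
      (hle _ hEm)).aestronglyMeasurable
      (ae_of_all _ fun ω => (hpt ω).trans (le_abs_self _))
  have hXi := D.integrable_X
  have hxi : Integrable (E.indicator (D.xiHat t)) P := by
    refine ((hXi.indicator (hle _ hEm)).sub hVi).congr (ae_of_all _ fun ω => ?_)
    by_cases hω : ω ∈ E <;> simp [hω]
  have hce : P[E.indicator fun ω => D.X ω - D.xiHat t ω | D.obsSigma t]
      =ᵐ[P] E.indicator fun ω => Y t ω - D.xiHat t ω := by
    have h0 : (E.indicator fun ω => D.X ω - D.xiHat t ω)
        = E.indicator D.X - E.indicator (D.xiHat t) := by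
      ext ω; by_cases hω : ω ∈ E <;> simp [hω]
    have h1 := condExp_sub (μ := P) (hXi.indicator (hle _ hEm)) hxi (D.obsSigma t)
    have h2 := condExp_indicator (μ := P) hXi hEm
    have h3 : P[E.indicator (D.xiHat t) | D.obsSigma t] = E.indicator (D.xiHat t) :=
      condExp_of_stronglyMeasurable hle (hxm.indicator hEm).stronglyMeasurable hxi
    have h4 := hY.ae_eq_condExp ht (D.obsSigma_le_wholeSigma t) (D.infoSigma_le_obsSigma t)
    rw [h0]
    filter_upwards [h1, h2, h4] with ω e1 e2 e4
    rw [e1, Pi.sub_apply, e2, h3]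
    by_cases hω : ω ∈ E
    · simp only [Set.indicator_of_mem hω, e4]
    · simp only [Set.indicator_of_notMem hω, sub_zero]
  refine ⟨integrable_condExp.congr hce, ?_⟩
  calc ∫ ω, |E.indicator (fun ω => Y t ω - D.xiHat t ω) ω| ∂P
      = ∫ ω, |(P[E.indicator fun ω => D.X ω - D.xiHat t ω | D.obsSigma t]) ω| ∂P :=
        integral_congr_ae (hce.symm.fun_comp abs)
    _ ≤ ∫ ω, |E.indicator (fun ω => D.X ω - D.xiHat t ω) ω| ∂P := integral_abs_condExp_le _
    _ ≤ _ := (integral_mono hVi.abs hgap.1 hpt).trans hgap.2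

/-- Dividing the bound of order `√(1 - t)` by `1 - t` leaves `1 / √(1 - t)`, which is integrable up
to `1`. -/
theorem IsBestEstimate.integrable_activeDrift (hY : D.IsBestEstimate Y) :
    Integrable (D.activeDrift Y) ((volume : Measure I).prod P) := by
  have hm := hY.measurable_activeDrift
  refine (integrable_prod_iff hm.aestronglyMeasurable).2 ⟨?_, ?_⟩
  · filter_upwards [ae_lt_one] with t ht
    simp only [activeDrift_eq]
    exact (hY.integral_abs_sub_xiHat_le ht).1.div_const _
  · refine (integrable_inv_sqrt_one_sub.const_mul D.gapBound).mono'
      hm.norm.stronglyMeasurable.integral_prod_right'.aestronglyMeasurable ?_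
    filter_upwards [ae_lt_one] with t ht
    have h0 : 0 < 1 - (t : ℝ) := sub_pos.2 ht
    rw [Real.norm_of_nonneg (integral_nonneg fun _ => norm_nonneg _)]
    simp only [activeDrift_eq, Real.norm_eq_abs, abs_div, abs_of_pos h0, integral_div]
    rw [div_le_iff₀ h0, mul_assoc]
    refine (hY.integral_abs_sub_xiHat_le ht).2.trans (le_of_eq ?_)
    rw [inv_mul_eq_div, Real.div_sqrt]

end ModulatedInformation

/-! ### Innovations of the bridges. -/

namespace ModulatedInformation

variable {Ω : Type*} [m : MeasurableSpace Ω] {P : Measure Ω} {n : ℕ}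

/-- The part of a bridge that is independent of the past. -/
def innovation (D : ModulatedInformation P n) (i : Fin n) (r s : I) (ω : Ω) : ℝ :=
  D.β i s ω - (1 - (s : ℝ)) / (1 - (r : ℝ)) * D.β i r ω

lemma measurable_innovation (D : ModulatedInformation P n) (i : Fin n) (r s : I) :
    Measurable (D.innovation i r s) :=
  (D.measurable_β i s).sub ((D.measurable_β i r).const_mul _)

lemma measurable_β_lift (D : ModulatedInformation P n) (i : Fin n) {κ : Ω → I}
    (hκ : Measurable fun ω : SubSpace D.switchSigma => κ (ofSub ω)) :
    Measurable fun q : SubSpace D.switchSigma × SubSpace D.signalSigma =>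
      D.β i (κ (ofSub q.1)) (ofSub q.2) := by
  have h1 : Measurable fun q : SubSpace D.switchSigma × SubSpace D.signalSigma =>
      (κ (ofSub q.1), q.2) := by
    have h2 : Measurable fun q : SubSpace D.switchSigma × SubSpace D.signalSigma =>
      κ (ofSub q.1) := by
      simpa only [Function.comp_def] using hκ.comp measurable_fst
    exact h2.prodMk measurable_snd
  simpa only [Function.comp_def] using (D.measurable_uncurry_β_signal i).comp h1

variable [IsProbabilityMeasure P]

lemma integrable_innovation (D : ModulatedInformation P n) (i : Fin n) (r s : I) :
    Integrable (D.innovation i r s) P :=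
  (D.integrable_β i s).sub ((D.integrable_β i r).const_mul _)

lemma integral_innovation (D : ModulatedInformation P n) (i : Fin n) (r s : I) :
    ∫ ω, D.innovation i r s ω ∂P = 0 := by
  simp only [innovation]
  rw [integral_sub (D.integrable_β i s) ((D.integrable_β i r).const_mul _), integral_const_mul,
    (D.bridge i).mean, (D.bridge i).mean, mul_zero, sub_zero]

/-- For `p ≤ r ≤ s` the covariances with `β` at `p` are `p (1 - s)` for `β` at `s` and `p (1 - r)`
for `β` at `r`; the factor `(1 - s) / (1 - r)` makes them cancel, and for Gaussian families this
means independence. -/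
lemma indepFun_innovation_past (D : ModulatedInformation P n) (i : Fin n) {r s : I} (hr : r < 1)
    (hrs : r ≤ s) : IndepFun (D.innovation i r s)
      (fun ω (p : {p : Fin n × I // p.2 ≤ r}) => D.β p.1.1 p.1.2 ω) P := by
  have hG : IsGaussianProcess (Sum.elim (fun (_ : Unit) => D.innovation i r s)
      (fun (p : {p : Fin n × I // p.2 ≤ r}) ω => D.β p.1.1 p.1.2 ω)) P := by
    refine IsGaussianProcess.of_linear (κ := Bool) D.isGaussianProcess_bridges
      (Sum.elim (fun _ k => bif k then 1 else -((1 - (s : ℝ)) / (1 - (r : ℝ))))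
        (fun _ k => bif k then 1 else 0))
      (Sum.elim (fun _ k => bif k then (i, s) else (i, r)) (fun p _ => p.1)) ?_
    rintro (_ | p) ω
    · simp only [Sum.elim_inl, Fintype.sum_bool, cond_true, cond_false, innovation]
      ring
    · simp only [Sum.elim_inr, Fintype.sum_bool, cond_true, cond_false]
      ring
  have h := hG.indepFun_of_covariance_eq_zero (X := fun (_ : Unit) => D.innovation i r s)
    (Y := fun (p : {p : Fin n × I // p.2 ≤ r}) ω => D.β p.1.1 p.1.2 ω)
    (fun _ => (D.measurable_innovation i r s).aemeasurable)
    (fun p => (D.measurable_β _ _).aemeasurable) ?_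
  · exact h.comp (measurable_pi_apply ()) measurable_id
  · intro _ p
    have hr' : (0 : ℝ) < 1 - r := sub_pos.2 hr
    have hpr : (p.1.2 : ℝ) ≤ r := p.2
    have hps : (p.1.2 : ℝ) ≤ s := hpr.trans hrs
    rw [show D.innovation i r s = fun ω => D.β i s ω - (1 - (s : ℝ)) / (1 - (r : ℝ)) * D.β i r ω
        from rfl, covariance_fun_sub_left (D.memLp_β _ _) ((D.memLp_β _ _).const_mul _) (D.memLp_β _ _),
      covariance_const_mul_left, D.cov_β, D.cov_β]
    split_ifs
    · rw [min_eq_right hpr, min_eq_right hps]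
      field_simp
      ring
    · rw [mul_zero, sub_zero]

lemma setIntegral_innovation (D : ModulatedInformation P n) (i : Fin n) {r s : I} (hr : r < 1)
    (hrs : r ≤ s) {c : Fin n → I} (hc : ∀ j, c j ≤ r) {B : Set Ω}
    (hB : MeasurableSet[D.upTo c] B) : ∫ ω in B, D.innovation i r s ω ∂P = 0 := by
  set V : Ω → ℝ × ({p : Fin n × I // p.2 ≤ r} → ℝ) := fun ω => (D.X ω, fun p => D.β p.1.1 p.1.2 ω)
    with hV
  have hpm : Measurable fun ω (p : {p : Fin n × I // p.2 ≤ r}) => D.β p.1.1 p.1.2 ω :=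
    measurable_pi_lambda _ fun p => D.measurable_β _ _
  have hind : IndepFun (D.innovation i r s) V P := by
    refine indepFun_prodMk_of_indepFun (D.measurable_innovation i r s) hpm D.X_measurable
      (D.indepFun_innovation_past i hr hrs) ?_
    have h := D.indepFun_X_bridges.comp (φ := id) (ψ := fun (g : Fin n × I → ℝ) =>
      (g (i, s) - (1 - (s : ℝ)) / (1 - (r : ℝ)) * g (i, r),
        fun p : {p : Fin n × I // p.2 ≤ r} => g p.1)) measurable_id (by fun_prop)
    exact h
  have hle : D.upTo c ≤ MeasurableSpace.comap V inferInstance := by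
    refine iSup_le fun j => iSup₂_le fun u hu => ?_
    have h2 : Measurable fun q : ℝ × ({p : Fin n × I // p.2 ≤ r} → ℝ) =>
        (u : ℝ) * q.1 + D.vol j * q.2 ⟨(j, u), hu.trans (hc j)⟩ := by fun_prop
    exact (h2.comp (comap_measurable V)).comap_le
  have hVm : MeasurableSpace.comap V inferInstance ≤ m := (D.X_measurable.prodMk hpm).comap_le
  have h1 := condExp_indep_eq (μ := P) (D.measurable_innovation i r s).comap_le hVm
    (comap_measurable (D.innovation i r s)).stronglyMeasurable hind
  rw [← setIntegral_condExp hVm (D.integrable_innovation i r s) (hle B hB),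
    setIntegral_congr_ae (g := fun _ => 0) (hVm _ (hle B hB))
      (h1.mono fun ω h _ => by rw [h, D.integral_innovation]), integral_zero]

/-- The time `κ` and the coefficient `c` depend on the switching only. Freezing the switching makes
them constant, and `setIntegral_innovation` applies; `κ` may look into the future of `J`. -/
lemma setIntegral_mul_innovation (D : ModulatedInformation P n) (i : Fin n) {r : I} (hr : r < 1)
    {κ : Ω → I} (hκ : Measurable fun ω : SubSpace D.switchSigma => κ (ofSub ω))
    (hrκ : ∀ ω, r ≤ κ ω) {c : Ω → ℝ}
    (hc : Measurable fun ω : SubSpace D.switchSigma => c (ofSub ω)) {K : ℝ} (hK : ∀ ω, |c ω| ≤ K)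
    {A : Set Ω} (hA : MeasurableSet[D.wholeSigma r] A) :
    ∫ ω in A, c ω * D.innovation i r (κ ω) ω ∂P = 0 := by
  obtain ⟨B, hB, hAB⟩ := exists_ae_eq_of_measurableSet_sup_null hA
  rw [setIntegral_congr_set hAB]
  have h1 : Measurable fun q : SubSpace D.switchSigma × SubSpace D.signalSigma => c (ofSub q.1) := by
    simpa only [Function.comp_def] using hc.comp measurable_fst
  have h2 : Measurable fun q : SubSpace D.switchSigma × SubSpace D.signalSigma =>
      κ (ofSub q.1) := by
    simpa only [Function.comp_def] using hκ.comp measurable_fst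
  have h3 := D.measurable_β_lift i hκ
  have h4 : Measurable fun q : SubSpace D.switchSigma × SubSpace D.signalSigma =>
      D.β i r (ofSub q.2) := by
    simpa only [Function.comp_def] using (D.measurable_β_signal i r).comp measurable_snd
  have hF : Measurable fun q : SubSpace D.switchSigma × SubSpace D.signalSigma =>
      c (ofSub q.1) * D.innovation i r (κ (ofSub q.1)) (ofSub q.2) := by
    have h5 : Measurable fun q : SubSpace D.switchSigma × SubSpace D.signalSigma =>
        (1 - (κ (ofSub q.1) : ℝ)) / (1 - (r : ℝ)) :=
      (measurable_const.sub (measurable_subtype_coe.comp h2)).div_const _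
    exact h1.mul (h3.sub (h5.mul h4))
  have h5 := D.fullSigma_le_liftSigma hr B hB
  have h6 := D.fullSigma_le r B hB
  have hr' : (0 : ℝ) < 1 - r := sub_pos.2 hr
  -- In the constant, the mean of `|β|` at `r` covers the second term of the innovation, whose
  -- coefficient is at most `1`, and the summand `1` covers the bridge at `κ`, of mean size at most
  -- `√(1 - κ)`.
  have h := setIntegral_eq_zero_of_lift D.switchSigma_le D.signalSigma_le D.indep_switch_signal
    (fun _ => D.upTo_le _) h5 h6 hF (fun ω => (D.integrable_innovation i r (κ ω)).const_mul (c ω))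
    (K := K * ((∫ ω, |D.β i r ω| ∂P) + 1)) ?_ ?_
  · exact h
  · intro ω
    change ∫ ω', |c ω * D.innovation i r (κ ω) ω'| ∂P ≤ _
    simp only [abs_mul]
    rw [integral_const_mul]
    refine mul_le_mul (hK ω) ?_ (integral_nonneg fun _ => abs_nonneg _)
      ((abs_nonneg _).trans (hK ω))
    have hq : |(1 - (κ ω : ℝ)) / (1 - (r : ℝ))| ≤ 1 := by
      rw [abs_of_nonneg (div_nonneg (sub_nonneg.2 (κ ω).2.2) hr'.le), div_le_one hr']
      exact sub_le_sub_left (show (r : ℝ) ≤ κ ω from hrκ ω) 1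
    have h7 : ∫ ω', |D.innovation i r (κ ω) ω'| ∂P
        ≤ ∫ ω', (|D.β i r ω'| + |D.β i (κ ω) ω'|) ∂P := by
      refine integral_mono (D.integrable_innovation i r _).abs
        ((D.integrable_β i r).abs.add (D.integrable_β i _).abs) fun ω' => ?_
      refine (abs_sub _ _).trans ?_
      rw [add_comm, abs_mul]
      exact add_le_add_left (mul_le_of_le_one_left (abs_nonneg _) hq) _
    rw [integral_add (D.integrable_β i r).abs (D.integrable_β i _).abs] at h7
    refine h7.trans (add_le_add_right ((D.integral_abs_β_le i _).trans ?_) _)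
    exact Real.sqrt_le_one.2 (by linarith [(κ ω).2.1])
  · intro ω B' hB'
    change ∫ ω' in B', c ω * D.innovation i r (κ ω) ω' ∂P = 0
    rw [integral_const_mul, D.setIntegral_innovation i hr (hrκ ω)
      (fun j => pathLastActive_le j r) hB', mul_zero]

lemma integrable_β_sub_random (D : ModulatedInformation P n) (i : Fin n) {κ κ' : Ω → I}
    (hκ : Measurable fun ω : SubSpace D.switchSigma => κ (ofSub ω))
    (hκ' : Measurable fun ω : SubSpace D.switchSigma => κ' (ofSub ω)) {δ : ℝ}
    (hδ : ∀ ω, |(κ ω : ℝ) - κ' ω| ≤ δ) :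
    Integrable (fun ω => D.β i (κ ω) ω - D.β i (κ' ω) ω) P ∧
      ∫ ω, |D.β i (κ ω) ω - D.β i (κ' ω) ω| ∂P ≤ √δ := by
  have hF := (D.measurable_β_lift i hκ).sub (D.measurable_β_lift i hκ')
  have hi : ∀ ω : Ω, Integrable (fun ω' : Ω => D.β i (κ ω) ω' - D.β i (κ' ω) ω') P :=
    fun ω => (D.integrable_β i _).sub (D.integrable_β i _)
  have hb : ∀ ω : Ω, ∫ ω', |D.β i (κ ω) ω' - D.β i (κ' ω) ω'| ∂P ≤ √δ := fun ω =>
    (D.integral_abs_β_sub_le i _ _).trans (Real.sqrt_le_sqrt (hδ ω))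
  refine ⟨(integral_diag_of_indep D.switchSigma_le D.signalSigma_le D.indep_switch_signal hF hi
    hb).1, ?_⟩
  have hF' : Measurable fun q : SubSpace D.switchSigma × SubSpace D.signalSigma =>
      |D.β i (κ (ofSub q.1)) (ofSub q.2) - D.β i (κ' (ofSub q.1)) (ofSub q.2)| := hF.abs
  have h := (integral_diag_of_indep (K := √δ) D.switchSigma_le D.signalSigma_le
    D.indep_switch_signal hF' (fun ω => (hi ω).abs) fun ω => ?_).2
  · refine h.trans_le ?_
    calc ∫ ω, (∫ ω', |D.β i (κ ω) ω' - D.β i (κ' ω) ω'| ∂P) ∂P ≤ ∫ _, √δ ∂P := by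
          refine integral_mono_of_nonneg (ae_of_all _ fun ω => integral_nonneg fun _ => abs_nonneg _)
            (integrable_const _) (ae_of_all _ hb)
      _ = √δ := by simp
  · simp only [abs_abs]
    exact hb ω

lemma integrable_β_random (D : ModulatedInformation P n) (i : Fin n) {κ : Ω → I}
    (hκ : Measurable fun ω : SubSpace D.switchSigma => κ (ofSub ω)) :
    Integrable (fun ω => D.β i (κ ω) ω) P := by
  refine (D.integrable_β_sub_random i (κ' := fun _ => 0) (δ := 1) hκ measurable_const
    fun ω => ?_).1.congr ?_
  · rw [Set.Icc.coe_zero, sub_zero, abs_of_nonneg (κ ω).2.1]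
    exact (κ ω).2.2
  · filter_upwards [D.β_ae_eq_zero i (t := 0) (by norm_num)] with ω hω
    rw [hω, Pi.zero_apply, sub_zero]

end ModulatedInformation

/-! ### State changes and activity patterns. -/

namespace ModulatedInformation

variable {Ω : Type*} [m : MeasurableSpace Ω] {P : Measure Ω} {n : ℕ}

/-- The time of the `k`-th state change, `1` if there are fewer than `k` of them. -/
def switchTime (D : ModulatedInformation P n) (k : ℕ) (ω : Ω) : I :=
  pathTime (fun r => D.J r ω) k

/-- The activity pattern after the `k`-th state change. -/
def pattern (D : ModulatedInformation P n) (k : ℕ) (ω : Ω) : Fin n → Bool :=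
  D.J (D.switchTime k ω) ω

section Paths

variable (D : ModulatedInformation P n) {k : ℕ} {s t : I} {ω : Ω}

lemma changes_mono (ω : Ω) : Monotone fun t => D.changes t ω := (D.cadlag ω).pathChanges_mono

lemma changeTime_le_iff : D.changeTime k ω ≤ t ↔ k ≤ D.changes t ω :=
  (D.cadlag ω).pathChangeTime_le_iff

lemma lt_changeTime_iff : (t : WithTop I) < D.changeTime k ω ↔ D.changes t ω < k :=
  (D.cadlag ω).lt_pathChangeTime_iff

lemma switchTime_eq (h : D.changeTime k ω = s) : D.switchTime k ω = s := by
  change (D.changeTime k ω).untopD 1 = s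
  rw [h, WithTop.untopD_coe]

lemma changeTime_eq_switchTime (h : k ≤ D.changes t ω) :
    D.changeTime k ω = D.switchTime k ω := by
  obtain ⟨s, hs⟩ := WithTop.ne_top_iff_exists.1
    ((D.changeTime_le_iff.2 h).trans_lt (WithTop.coe_lt_top t)).ne
  rw [← hs, D.switchTime_eq hs.symm]

lemma switchTime_le (h : k ≤ D.changes t ω) : D.switchTime k ω ≤ t := by
  have h1 := D.changeTime_le_iff.2 h
  rwa [D.changeTime_eq_switchTime h, WithTop.coe_le_coe] at h1

lemma changes_switchTime (h : k ≤ D.changes t ω) : D.changes (D.switchTime k ω) ω = k :=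
  (D.cadlag ω).pathChanges_changeTime (D.changeTime_eq_switchTime h)

lemma switchTime_eq_one (h : ∀ t, D.changes t ω < k) : D.switchTime k ω = 1 := by
  have h1 : D.changeTime k ω = ⊤ := WithTop.eq_top_iff_forall_gt.2 fun t =>
    D.lt_changeTime_iff.2 (h t)
  change (D.changeTime k ω).untopD 1 = 1
  rw [h1]
  rfl

lemma le_switchTime (hk : D.changes t ω < k) : t ≤ D.switchTime k ω := by
  by_cases h1 : ∃ s, k ≤ D.changes s ω
  · obtain ⟨s, hs⟩ := h1
    by_contra hlt
    have h2 := D.changes_mono ω (not_le.1 hlt).le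
    simp only [D.changes_switchTime hs] at h2
    omega
  · push Not at h1
    rw [D.switchTime_eq_one h1]
    exact unitInterval.le_one'

/-- The restriction `t < 1` is due to the value `1` of `switchTime` when there is no `k`-th change.
-/
lemma switchTime_le_iff (ht : t < 1) : D.switchTime k ω ≤ t ↔ k ≤ D.changes t ω := by
  refine ⟨fun h => ?_, D.switchTime_le⟩
  by_cases h1 : ∃ s, k ≤ D.changes s ω
  · obtain ⟨s, hs⟩ := h1
    have h2 := D.changes_mono ω h
    simpa only [D.changes_switchTime hs] using h2
  · push Not at h1
    rw [D.switchTime_eq_one h1] at h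
    exact absurd ht (not_lt.2 h)

lemma changes_eq_iff (ht : t < 1) :
    D.changes t ω = k ↔ D.switchTime k ω ≤ t ∧ t < D.switchTime (k + 1) ω := by
  rw [D.switchTime_le_iff ht, ← not_le, D.switchTime_le_iff ht]
  omega

lemma switchTime_mono (k : ℕ) (ω : Ω) : D.switchTime k ω ≤ D.switchTime (k + 1) ω := by
  by_contra h
  rw [not_le] at h
  have h1 := h.trans_le (unitInterval.le_one' (t := D.switchTime k ω))
  have h2 := (D.switchTime_le_iff h1).1 le_rfl
  exact absurd (D.switchTime_le (k := k) (by omega)) (not_le.2 h)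

lemma J_eq_pattern (h : D.changes s ω = k) : D.J s ω = D.pattern k ω :=
  (D.cadlag ω).eq_of_pathChanges_eq (h.trans (D.changes_switchTime h.ge).symm)

lemma mem_activeFrom_iff :
    ω ∈ D.activeFrom k ↔ k ≤ D.changes 1 ω ∧ ∃ i, D.pattern k ω i = true := by
  constructor
  · rintro ⟨s, hs, ha⟩
    refine ⟨D.changeTime_le_iff.1 (hs ▸ WithTop.coe_le_coe.2 unitInterval.le_one'), ?_⟩
    rw [pattern, D.switchTime_eq hs]
    exact D.active_nonempty_iff.1 ha
  · rintro ⟨h, ha⟩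
    exact ⟨_, D.changeTime_eq_switchTime h, D.active_nonempty_iff.2 ha⟩

lemma active_of_mem_activeFrom (h : ω ∈ D.activeFrom k) (hs : D.changes s ω = k) :
    (D.active s ω).Nonempty := by
  rw [D.active_nonempty_iff, D.J_eq_pattern hs]
  exact (D.mem_activeFrom_iff.1 h).2

end Paths

section Switch

variable (D : ModulatedInformation P n) (k : ℕ)

lemma measurable_switchTime_switch :
    Measurable fun ω : SubSpace D.switchSigma => D.switchTime k (ofSub ω) :=
  measurable_pathTime (J := fun u (ω : SubSpace D.switchSigma) => D.J u (ofSub ω))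
    (fun ω => D.cadlag (ofSub ω)) k D.measurable_J_switch

lemma measurable_pattern_switch :
    Measurable fun ω : SubSpace D.switchSigma => D.pattern k (ofSub ω) := by
  unfold pattern
  have h := measurable_uncurry_J (J := fun u (ω : SubSpace D.switchSigma) => D.J u (ofSub ω))
    D.measurable_J_switch fun ω => D.cadlag (ofSub ω)
  have h2 := h.comp ((D.measurable_switchTime_switch k).prodMk measurable_id)
  simpa only [Function.comp_def, id_eq] using h2

lemma measurable_changes_switch (t : I) :
    Measurable fun ω : SubSpace D.switchSigma => D.changes t (ofSub ω) :=
  measurable_pathChanges (J := fun u (ω : SubSpace D.switchSigma) => D.J u (ofSub ω))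
    (fun ω => D.cadlag (ofSub ω)) fun u _ => D.measurable_J_switch u

lemma measurableSet_changes_eq_switch (t : I) :
    MeasurableSet[D.switchSigma] {ω | D.changes t ω = k} :=
  D.measurable_changes_switch t (measurableSet_singleton k)

lemma measurableSet_activeFrom_switch : MeasurableSet[D.switchSigma] (D.activeFrom k) := by
  have h : D.activeFrom k = ((fun ω => D.changes 1 ω) ⁻¹' Set.Ici k) ∩
      (D.pattern k ⁻¹' {a | ∃ i, a i = true}) := by
    ext ω; exact D.mem_activeFrom_iff
  rw [h]
  exact (D.measurable_changes_switch 1 measurableSet_Ici).inter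
    (D.measurable_pattern_switch k (Set.toFinite _).measurableSet)

lemma measurable_weight_pattern_switch (i : Fin n) :
    Measurable fun ω : SubSpace D.switchSigma => D.weight (D.pattern k (ofSub ω)) i * D.vol i := by
  have h := (measurable_of_finite fun a => D.weight a i * D.vol i).comp
    (D.measurable_pattern_switch k)
  simpa only [Function.comp_def] using h

lemma abs_weight_mul_vol_le (a : Fin n → Bool) (i : Fin n) : |D.weight a i * D.vol i| ≤ D.vol i := by
  rw [abs_of_nonneg (mul_nonneg (D.weight_nonneg a i) (D.vol_pos i).le)]
  exact mul_le_of_le_one_left (D.vol_pos i).le (D.weight_le_one a i)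

lemma measurable_min_max_switch (r u : I) :
    Measurable fun ω : SubSpace D.switchSigma => max r (min u (D.switchTime k (ofSub ω))) :=
  measurable_const.max (measurable_const.min (D.measurable_switchTime_switch k))

lemma measurable_uncurry_changes : Measurable fun p : I × Ω => D.changes p.1 p.2 :=
  measurable_uncurry_pathChanges (J := D.J) D.J_measurable D.cadlag

end Switch

end ModulatedInformation

/-! ### The martingale property with respect to the enlarged information. -/

namespace ModulatedInformation

variable {Ω : Type*} [m : MeasurableSpace Ω] {P : Measure Ω} {n : ℕ}

/-- The increment of the effective information between the `k`-th and the `k + 1`-st state change,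
up to time `u`. -/
def level (D : ModulatedInformation P n) (k : ℕ) (u : I) (ω : Ω) : ℝ :=
  D.effective (D.pattern k ω) (min u (D.switchTime (k + 1) ω)) ω
    - D.effective (D.pattern k ω) (min u (D.switchTime k ω)) ω

/-- The integral of the drift between the `k`-th and the `k + 1`-st state change, up to time `u`. -/
def compensator (D : ModulatedInformation P n) (Y : I → Ω → ℝ) (k : ℕ) (u : I) (ω : Ω) : ℝ :=
  ∫ s in {s : I | s ≤ u ∧ D.changes s ω = k}, D.activeDrift Y (s, ω)

/-- The martingale part of the effective information between the `k`-th and the `k + 1`-st state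
change, up to time `u`. -/
def segment (D : ModulatedInformation P n) (Y : I → Ω → ℝ) (k : ℕ) (u : I) : Ω → ℝ :=
  (D.activeFrom k).indicator fun ω => D.level k u ω - D.compensator Y k u ω

/-- The forecast at time `r` of the slope of the effective information with the activity pattern
after the `k`-th state change. -/
def slope (D : ModulatedInformation P n) (k : ℕ) (r : I) (ω : Ω) : ℝ :=
  D.X ω - (∑ i, D.weight (D.pattern k ω) i * D.vol i * D.β i r ω) / (1 - (r : ℝ))

/-- The time spent in `(r, u]` between the `k`-th and the `k + 1`-st state change. -/
def occupation (D : ModulatedInformation P n) (k : ℕ) (r u : I) (ω : Ω) : ℝ :=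
  (max r (min u (D.switchTime (k + 1) ω)) : I) - (max r (min u (D.switchTime k ω)) : I)

variable (D : ModulatedInformation P n)

/-- Only what happens in `[r, u]` counts: `max r (min u ρ)` is the time `ρ` clipped to that
interval. The clipped times are known from the switching and do not precede `r`, as the innovations
require. -/
lemma level_sub_level {k : ℕ} {r u : I} (hru : r ≤ u) (ω : Ω) :
    D.level k u ω - D.level k r ω
      = D.effective (D.pattern k ω) (max r (min u (D.switchTime (k + 1) ω))) ω
        - D.effective (D.pattern k ω) (max r (min u (D.switchTime k ω))) ω := by
  have h : ∀ ρ : I, D.effective (D.pattern k ω) (min u ρ) ω - D.effective (D.pattern k ω) (min r ρ) ω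
      = D.effective (D.pattern k ω) (max r (min u ρ)) ω - D.effective (D.pattern k ω) r ω := fun ρ => by
    rcases le_total r ρ with h | h
    · rw [min_eq_left h, max_eq_right (le_min hru h)]
    · rw [min_eq_right h, min_eq_right (h.trans hru), max_eq_left h, sub_self, sub_self]
  have h1 := h (D.switchTime k ω)
  have h2 := h (D.switchTime (k + 1) ω)
  rw [level, level]
  linarith

/-- Each bridge is its innovation plus `(1 - s) / (1 - r)` times its value at `r`. The second part
is linear in `s` and, together with `X`, contributes the slope. -/
lemma effective_sub_effective {k : ℕ} {r : I} (hr : r < 1) {ω : Ω} (hω : ω ∈ D.activeFrom k)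
    (s s' : I) : D.effective (D.pattern k ω) s' ω - D.effective (D.pattern k ω) s ω
      = ((s' : ℝ) - s) * D.slope k r ω + ∑ i, (D.weight (D.pattern k ω) i * D.vol i
        * D.innovation i r s' ω - D.weight (D.pattern k ω) i * D.vol i * D.innovation i r s ω) := by
  have ha := (D.mem_activeFrom_iff.1 hω).2
  have hr' : (1 : ℝ) - r ≠ 0 := (sub_pos.2 (show (r : ℝ) < 1 from hr)).ne'
  rw [D.effective_eq ha, D.effective_eq ha, slope, mul_sub, Finset.sum_div, Finset.mul_sum,
    sub_add, ← Finset.sum_sub_distrib]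
  have h : ∑ i, (((s' : ℝ) - s) * (D.weight (D.pattern k ω) i * D.vol i * D.β i r ω / (1 - (r : ℝ)))
      - (D.weight (D.pattern k ω) i * D.vol i * D.innovation i r s' ω
        - D.weight (D.pattern k ω) i * D.vol i * D.innovation i r s ω))
      = ∑ i, (D.weight (D.pattern k ω) i * D.vol i * D.β i s ω
        - D.weight (D.pattern k ω) i * D.vol i * D.β i s' ω) := by
    refine Finset.sum_congr rfl fun i _ => ?_
    rw [innovation, innovation]
    field_simp
    ring
  rw [h, Finset.sum_sub_distrib]
  ring

/-- The line of slope `slope` found in `effective_sub_effective` reaches `X` at time `1`. So the gap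
to `X`, divided by `1 - s`, has the same slope up to innovations. -/
lemma X_sub_effective {k : ℕ} {r : I} (hr : r < 1) {ω : Ω} (hω : ω ∈ D.activeFrom k)
    (s : I) : D.X ω - D.effective (D.pattern k ω) s ω = (1 - (s : ℝ)) * D.slope k r ω
      - ∑ i, D.weight (D.pattern k ω) i * D.vol i * D.innovation i r s ω := by
  have ha := (D.mem_activeFrom_iff.1 hω).2
  have hr' : (1 : ℝ) - r ≠ 0 := (sub_pos.2 (show (r : ℝ) < 1 from hr)).ne'
  rw [D.effective_eq ha, slope, mul_sub, Finset.sum_div, Finset.mul_sum, sub_sub,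
    ← Finset.sum_add_distrib]
  have h : ∑ i, ((1 - (s : ℝ)) * (D.weight (D.pattern k ω) i * D.vol i * D.β i r ω / (1 - (r : ℝ)))
      + D.weight (D.pattern k ω) i * D.vol i * D.innovation i r s ω)
      = ∑ i, D.weight (D.pattern k ω) i * D.vol i * D.β i s ω := by
    refine Finset.sum_congr rfl fun i _ => ?_
    rw [innovation]
    field_simp
    ring
  rw [h]
  ring

lemma volume_occupation (k : ℕ) (r u : I) (ω : Ω) :
    volume.real {s : I | r < s ∧ s ≤ u ∧ D.changes s ω = k} = D.occupation k r u ω := by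
  set ρ := D.switchTime k ω with hρ
  set τ := D.switchTime (k + 1) ω with hτ
  have hρτ : ρ ≤ τ := D.switchTime_mono k ω
  have hae : ∀ a : I, ∀ᵐ s : I, s ≠ a := fun a => by
    have h : ({a} : Set I)ᶜ ∈ ae (volume : Measure I) := compl_mem_ae_iff.2 (by simp)
    filter_upwards [h] with s hs using hs
  -- The endpoints, and the time `1` where `changes_eq_iff` is not available, are null and can be
  -- ignored.
  have h : {s : I | r < s ∧ s ≤ u ∧ D.changes s ω = k}
      =ᵐ[volume] Set.Ioc (max r (min u ρ)) (max r (min u τ)) := by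
    filter_upwards [hae 1, hae ρ, hae τ] with s h1 h2 h3
    have hs1 : s < 1 := lt_of_le_of_ne unitInterval.le_one' h1
    refine propext ?_
    change (r < s ∧ s ≤ u ∧ D.changes s ω = k) ↔
      (max r (min u ρ) < s ∧ s ≤ max r (min u τ))
    rw [D.changes_eq_iff hs1, ← hρ, ← hτ, max_lt_iff, min_lt_iff, le_max_iff, le_min_iff]
    constructor
    · rintro ⟨a, b, c, d⟩
      exact ⟨⟨a, Or.inr (lt_of_le_of_ne c h2.symm)⟩, Or.inr ⟨b, d.le⟩⟩
    · rintro ⟨⟨a, b⟩, c⟩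
      obtain ⟨c, d⟩ := c.resolve_left (not_le.2 a)
      exact ⟨a, c, (b.resolve_left (not_lt.2 c)).le, lt_of_le_of_ne d h3⟩
  rw [measureReal_congr h, measureReal_def, unitInterval.volume_Ioc, ENNReal.toReal_ofReal]
  · rfl
  · exact sub_nonneg.2 (show max r (min u ρ) ≤ max r (min u τ) from
      max_le_max le_rfl (min_le_min le_rfl hρτ))

lemma integrable_weight_mul (k : ℕ) (i : Fin n) {f : Ω → ℝ} (hf : Integrable f P) :
    Integrable (fun ω => D.weight (D.pattern k ω) i * D.vol i * f ω) P := by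
  have h : Measurable fun ω => D.weight (D.pattern k ω) i * D.vol i :=
    (D.measurable_weight_pattern_switch k i).mono D.switchSigma_le le_rfl
  exact hf.bdd_mul h.aestronglyMeasurable (ae_of_all _ fun ω =>
    D.abs_weight_mul_vol_le (D.pattern k ω) i)

lemma measurableSet_segmentTimes (k : ℕ) (u : I) (ω : Ω) :
    MeasurableSet {s : I | s ≤ u ∧ D.changes s ω = k} :=
  measurableSet_Iic.inter ((D.changes_mono ω).measurable (measurableSet_singleton k))

lemma compensator_sub_compensator {Y : I → Ω → ℝ} {k : ℕ} {r u : I} (hru : r ≤ u) {ω : Ω}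
    (hω : Integrable fun s => D.activeDrift Y (s, ω)) :
    D.compensator Y k u ω - D.compensator Y k r ω
      = ∫ s in {s : I | r < s ∧ s ≤ u ∧ D.changes s ω = k}, D.activeDrift Y (s, ω) := by
  have hsub : {s : I | s ≤ r ∧ D.changes s ω = k} ⊆ {s : I | s ≤ u ∧ D.changes s ω = k} :=
    fun s hs => ⟨hs.1.trans hru, hs.2⟩
  rw [compensator, compensator, ← setIntegral_sdiff (D.measurableSet_segmentTimes k r ω)
    hω.integrableOn hsub]
  congr 2
  ext s
  change (_ ∧ _) ∧ ¬ (_ ∧ _) ↔ _ ∧ _ ∧ _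
  rw [← not_le]
  tauto

lemma measurableSet_activeFrom (k : ℕ) :
    MeasurableSet (D.activeFrom k) := D.switchSigma_le _ (D.measurableSet_activeFrom_switch k)

variable [IsProbabilityMeasure P]

lemma integrable_slope (k : ℕ) (r : I) : Integrable (D.slope k r) P :=
  D.integrable_X.sub ((integrable_finsetSum _ fun i _ =>
    D.integrable_weight_mul k i (D.integrable_β i r)).div_const _)

lemma integrable_innovation_random (i : Fin n) (r : I) {κ : Ω → I}
    (hκ : Measurable fun ω : SubSpace D.switchSigma => κ (ofSub ω)) :
    Integrable (fun ω => D.innovation i r (κ ω) ω) P := by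
  refine (D.integrable_β_random i hκ).sub ((D.integrable_β i r).bdd_mul (c := 1 / |1 - (r : ℝ)|)
    ?_ (ae_of_all _ fun ω => ?_))
  · have h : Measurable κ := hκ.mono D.switchSigma_le le_rfl
    exact (Measurable.div_const (measurable_const.sub (measurable_subtype_coe.comp h))
      _).aestronglyMeasurable
  · rw [norm_div, Real.norm_eq_abs, Real.norm_eq_abs, abs_of_nonneg (sub_nonneg.2 (κ ω).2.2)]
    exact div_le_div_of_nonneg_right (by linarith [(κ ω).2.1]) (abs_nonneg _)

/-- After subtraction of the linear part only innovations at the clipped change times remain, and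
these integrate to zero over events of the enlarged past. -/
lemma setIntegral_level_sub {k : ℕ} {r u : I} (hr : r < 1) (hru : r ≤ u) {B : Set Ω}
    (hB : MeasurableSet[D.wholeSigma r] B) :
    IntegrableOn (fun ω => D.level k u ω - D.level k r ω - D.occupation k r u ω * D.slope k r ω)
      (B ∩ D.activeFrom k) P ∧ ∫ ω in B ∩ D.activeFrom k,
      (D.level k u ω - D.level k r ω - D.occupation k r u ω * D.slope k r ω) ∂P = 0 := by
  have hE := D.switchSigma_le_wholeSigma r _ (D.measurableSet_activeFrom_switch k)
  have hBE : MeasurableSet[D.wholeSigma r] (B ∩ D.activeFrom k) :=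
    @MeasurableSet.inter _ (D.wholeSigma r) _ _ hB hE
  have hBEm := D.wholeSigma_le r _ hBE
  have hκ1 := D.measurable_min_max_switch (k + 1) r u
  have hκ0 := D.measurable_min_max_switch k r u
  have hi1 : ∀ i, Integrable (fun ω => D.weight (D.pattern k ω) i * D.vol i
      * D.innovation i r (max r (min u (D.switchTime (k + 1) ω))) ω) P := fun i =>
    D.integrable_weight_mul k i (D.integrable_innovation_random i r hκ1)
  have hi0 : ∀ i, Integrable (fun ω => D.weight (D.pattern k ω) i * D.vol i
      * D.innovation i r (max r (min u (D.switchTime k ω))) ω) P := fun i =>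
    D.integrable_weight_mul k i (D.integrable_innovation_random i r hκ0)
  have hcongr : Set.EqOn (fun ω => ∑ i, (D.weight (D.pattern k ω) i * D.vol i
      * D.innovation i r (max r (min u (D.switchTime (k + 1) ω))) ω
      - D.weight (D.pattern k ω) i * D.vol i
        * D.innovation i r (max r (min u (D.switchTime k ω))) ω))
      (fun ω => D.level k u ω - D.level k r ω - D.occupation k r u ω * D.slope k r ω)
      (B ∩ D.activeFrom k) := fun ω hω => by
    simp only [D.level_sub_level hru, D.effective_sub_effective hr hω.2, occupation]
    ring
  have hint : Integrable (fun ω => ∑ i, (D.weight (D.pattern k ω) i * D.vol i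
      * D.innovation i r (max r (min u (D.switchTime (k + 1) ω))) ω
      - D.weight (D.pattern k ω) i * D.vol i
        * D.innovation i r (max r (min u (D.switchTime k ω))) ω)) P :=
    integrable_finsetSum _ fun i _ => (hi1 i).sub (hi0 i)
  refine ⟨hint.integrableOn.congr_fun hcongr hBEm, ?_⟩
  rw [← setIntegral_congr_fun hBEm hcongr]
  refine (integral_finsetSum _ fun i _ => ((hi1 i).sub (hi0 i)).integrableOn).trans
    (Finset.sum_eq_zero fun i _ => ?_)
  refine (integral_sub (hi1 i).integrableOn (hi0 i).integrableOn).trans ?_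
  rw [D.setIntegral_mul_innovation i hr hκ1 (fun _ => le_max_left _ _)
      (D.measurable_weight_pattern_switch k i)
      (fun ω => D.abs_weight_mul_vol_le (D.pattern k ω) i) hBE,
    D.setIntegral_mul_innovation i hr hκ0 (fun _ => le_max_left _ _)
      (D.measurable_weight_pattern_switch k i)
      (fun ω => D.abs_weight_mul_vol_le (D.pattern k ω) i) hBE, sub_zero]

lemma integrable_effective_random (k : ℕ) {κ : Ω → I}
    (hκ : Measurable fun ω : SubSpace D.switchSigma => κ (ofSub ω)) :
    Integrable (fun ω => D.effective (D.pattern k ω) (κ ω) ω) P := by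
  have hκm : Measurable κ := hκ.mono D.switchSigma_le le_rfl
  refine integrable_finsetSum _ fun i _ => ?_
  have h1 : Integrable (fun ω => (κ ω : ℝ) * D.X ω) P :=
    D.integrable_X.bdd_mul (c := 1) (measurable_subtype_coe.comp hκm).aestronglyMeasurable
      (ae_of_all _ fun ω => by
        rw [Real.norm_eq_abs, abs_of_nonneg (κ ω).2.1]; exact (κ ω).2.2)
  have h2 : Integrable (fun ω => D.xi i (κ ω) ω) P :=
    h1.add ((D.integrable_β_random i hκ).const_mul _)
  refine ((D.integrable_weight_mul k i h2).const_mul (D.vol i)⁻¹).congr (ae_of_all _ fun ω => ?_)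
  have := (D.vol_pos i).ne'
  simp only []
  field_simp

lemma integrable_level (k : ℕ) (u : I) :
    Integrable (D.level k u) P :=
  (D.integrable_effective_random k (measurable_const.min (D.measurable_switchTime_switch (k + 1)))).sub
    (D.integrable_effective_random k (measurable_const.min (D.measurable_switchTime_switch k)))

variable [P.IsComplete] {D} {Y : I → Ω → ℝ}

/-- Over events of the enlarged past, `Y` at time `s` may be replaced by `X`; then `X_sub_effective`
leaves only innovations. -/
lemma IsBestEstimate.setIntegral_activeDrift_sub_slope (hY : D.IsBestEstimate Y) {k : ℕ} {r s : I}
    (hs : s < 1) (hrs : r ≤ s) {B : Set Ω} (hB : MeasurableSet[D.wholeSigma r] B)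
    (hBE : B ⊆ D.activeFrom k) (hBs : ∀ ω ∈ B, D.changes s ω = k) :
    ∫ ω in B, (D.activeDrift Y (s, ω) - D.slope k r ω) ∂P = 0 := by
  have hr : r < 1 := hrs.trans_lt hs
  have hs' : (0 : ℝ) < 1 - s := sub_pos.2 hs
  have hBm := D.wholeSigma_le r B hB
  have hcongr : Set.EqOn (fun ω => D.activeDrift Y (s, ω) - D.slope k r ω)
      (fun ω => ((Y s ω - D.X ω) - ∑ i, D.weight (D.pattern k ω) i * D.vol i
        * D.innovation i r s ω) / (1 - (s : ℝ))) B := fun ω hω => by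
    have h1 := D.X_sub_effective hr (hBE hω) s
    have h2 : D.activeDrift Y (s, ω) = (Y s ω - D.effective (D.pattern k ω) s ω) / (1 - (s : ℝ)) := by
      rw [activeDrift_eq, Set.indicator_of_mem (show ω ∈ {ω | (D.active s ω).Nonempty} from
        D.active_of_mem_activeFrom (hBE hω) (hBs ω hω)), xiHat_eq_effective,
        D.J_eq_pattern (hBs ω hω)]
    simp only [h2]
    rw [eq_div_iff hs'.ne', sub_mul, div_mul_cancel₀ _ hs'.ne']
    linarith
  have hi : ∀ i, Integrable (fun ω => D.weight (D.pattern k ω) i * D.vol i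
      * D.innovation i r s ω) P := fun i =>
    D.integrable_weight_mul k i (D.integrable_innovation i r s)
  have hYX : Integrable (fun ω => Y s ω - D.X ω) P := (hY.integrable hs).sub D.integrable_X
  rw [setIntegral_congr_fun hBm hcongr, integral_div, integral_sub hYX.integrableOn
    (integrable_finsetSum _ fun i _ => hi i).integrableOn,
    integral_sub (hY.integrable hs).integrableOn D.integrable_X.integrableOn,
    hY.setIntegral_eq hs (D.wholeSigma_mono hrs B hB), sub_self,
    integral_finsetSum _ fun i _ => (hi i).integrableOn, Finset.sum_eq_zero, sub_self, zero_div]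
  intro i _
  exact D.setIntegral_mul_innovation i hr (κ := fun _ => s) measurable_const (fun _ => hrs)
    (D.measurable_weight_pattern_switch k i)
    (fun ω => D.abs_weight_mul_vol_le (D.pattern k ω) i) hB

lemma IsBestEstimate.integrable_compensator (hY : D.IsBestEstimate Y) (k : ℕ) (u : I) :
    Integrable (D.compensator Y k u) P := by
  have hS : MeasurableSet {p : I × Ω | p.1 ≤ u ∧ D.changes p.1 p.2 = k} :=
    (measurable_fst measurableSet_Iic).inter
      (D.measurable_uncurry_changes (measurableSet_singleton k))
  refine (hY.integrable_activeDrift.indicator hS).integral_prod_right.congr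
    (ae_of_all _ fun ω => ?_)
  rw [compensator, ← integral_indicator (D.measurableSet_segmentTimes k u ω)]
  rfl

lemma IsBestEstimate.ae_integrable_activeDrift (hY : D.IsBestEstimate Y) :
    ∀ᵐ ω ∂P, Integrable (fun s => D.activeDrift Y (s, ω)) :=
  hY.integrable_activeDrift.prod_left_ae

/-- Fubini reduces the claim to a fixed time `s`. Whether `s` lies between the two state changes is
known from the switching, so this condition can be absorbed into the event; the time spent there is
`occupation`. -/
lemma IsBestEstimate.setIntegral_compensator_sub (hY : D.IsBestEstimate Y) {k : ℕ} {r u : I}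
    (hru : r ≤ u) {B : Set Ω} (hB : MeasurableSet[D.wholeSigma r] B) :
    IntegrableOn (fun ω => D.compensator Y k u ω - D.compensator Y k r ω
        - D.occupation k r u ω * D.slope k r ω) (B ∩ D.activeFrom k) P ∧
    ∫ ω in B ∩ D.activeFrom k, (D.compensator Y k u ω - D.compensator Y k r ω
      - D.occupation k r u ω * D.slope k r ω) ∂P = 0 := by
  have hE := D.switchSigma_le_wholeSigma r _ (D.measurableSet_activeFrom_switch k)
  have hBE : MeasurableSet[D.wholeSigma r] (B ∩ D.activeFrom k) :=
    @MeasurableSet.inter _ (D.wholeSigma r) _ _ hB hE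
  have hBEm := D.wholeSigma_le r _ hBE
  set S : Set (I × Ω) := {p | (r < p.1 ∧ p.1 ≤ u ∧ D.changes p.1 p.2 = k) ∧
    p.2 ∈ B ∩ D.activeFrom k} with hS
  have hSm : MeasurableSet S :=
    ((measurable_fst measurableSet_Ioi).inter ((measurable_fst measurableSet_Iic).inter
      (D.measurable_uncurry_changes (measurableSet_singleton k)))).inter (measurable_snd hBEm)
  set G : I × Ω → ℝ := S.indicator fun p => D.activeDrift Y p - D.slope k r p.2 with hG
  have hGi : Integrable G ((volume : Measure I).prod P) :=
    (hY.integrable_activeDrift.sub ((D.integrable_slope k r).comp_snd _)).indicator hSm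
  have hT : ∀ ω, MeasurableSet {s : I | r < s ∧ s ≤ u ∧ D.changes s ω = k} := fun ω =>
    measurableSet_Ioi.inter (D.measurableSet_segmentTimes k u ω)
  have h1 : ∀ᵐ ω ∂P, ∫ s, G (s, ω) = (B ∩ D.activeFrom k).indicator (fun ω =>
      D.compensator Y k u ω - D.compensator Y k r ω - D.occupation k r u ω * D.slope k r ω) ω := by
    filter_upwards [hY.ae_integrable_activeDrift] with ω hω
    by_cases hωB : ω ∈ B ∩ D.activeFrom k
    · set T : Set I := {s : I | r < s ∧ s ≤ u ∧ D.changes s ω = k} with hT'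
      have h2 : (fun s => G (s, ω)) = T.indicator fun s => D.activeDrift Y (s, ω) - D.slope k r ω := by
        ext s
        by_cases hs : r < s ∧ s ≤ u ∧ D.changes s ω = k
        · rw [hG, Set.indicator_of_mem (show (s, ω) ∈ S from ⟨hs, hωB⟩),
            Set.indicator_of_mem (show s ∈ T from hs)]
        · rw [hG, Set.indicator_of_notMem (show (s, ω) ∉ S from fun h => hs h.1),
            Set.indicator_of_notMem (show s ∉ T from hs)]
      rw [Set.indicator_of_mem hωB, D.compensator_sub_compensator hru hω, h2,
        integral_indicator (hT ω), integral_sub hω.integrableOn (integrable_const _),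
        setIntegral_const, D.volume_occupation, smul_eq_mul]
    · rw [Set.indicator_of_notMem hωB]
      refine (integral_congr_ae (ae_of_all _ fun s => ?_)).trans (integral_zero _ _)
      exact Set.indicator_of_notMem (fun h => hωB h.2) _
  have h2 : ∀ᵐ s : I, ∫ ω, G (s, ω) ∂P = 0 := by
    filter_upwards [ae_lt_one] with s hs
    by_cases hsr : r < s ∧ s ≤ u
    · have h3 : MeasurableSet[D.wholeSigma r] (B ∩ D.activeFrom k ∩ {ω | D.changes s ω = k}) :=
        @MeasurableSet.inter _ (D.wholeSigma r) _ _ hBE (D.switchSigma_le_wholeSigma r _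
          (D.measurableSet_changes_eq_switch k s))
      have h4 : (fun ω => G (s, ω)) = (B ∩ D.activeFrom k ∩ {ω | D.changes s ω = k}).indicator
          fun ω => D.activeDrift Y (s, ω) - D.slope k r ω := by
        ext ω
        by_cases hω : ω ∈ B ∩ D.activeFrom k ∩ {ω | D.changes s ω = k}
        · rw [hG, Set.indicator_of_mem (show (s, ω) ∈ S from ⟨⟨hsr.1, hsr.2, hω.2⟩, hω.1⟩),
            Set.indicator_of_mem hω]
        · rw [hG, Set.indicator_of_notMem (show (s, ω) ∉ S from fun h => hω ⟨h.2, h.1.2.2⟩),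
            Set.indicator_of_notMem hω]
      rw [h4, integral_indicator (D.wholeSigma_le r _ h3)]
      exact hY.setIntegral_activeDrift_sub_slope hs hsr.1.le h3 (fun ω hω => hω.1.2)
        fun ω hω => hω.2
    · refine (integral_congr_ae (ae_of_all _ fun ω => ?_)).trans (integral_zero _ _)
      exact Set.indicator_of_notMem (fun h => hsr ⟨h.1.1, h.1.2.1⟩) _
  have h5 : Integrable (fun ω => ∫ s, G (s, ω)) P := hGi.integral_prod_right
  refine ⟨(integrable_indicator_iff hBEm).1 (h5.congr h1), ?_⟩
  rw [← integral_indicator hBEm, ← integral_congr_ae h1]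
  have h6 := integral_integral_swap (f := fun s ω => G (s, ω)) hGi
  rw [← h6, integral_congr_ae h2, integral_zero]

lemma IsBestEstimate.integrable_segment (hY : D.IsBestEstimate Y) (k : ℕ) (u : I) :
    Integrable (D.segment Y k u) P :=
  ((D.integrable_level k u).sub (hY.integrable_compensator k u)).indicator
    (D.measurableSet_activeFrom k)

/-- The increments of `level` and of `compensator` are both matched by `occupation * slope`, so the
integrals of their difference cancel. -/
theorem IsBestEstimate.setIntegral_segment_eq (hY : D.IsBestEstimate Y) (k : ℕ) {r u : I}
    (hru : r ≤ u) {B : Set Ω} (hB : MeasurableSet[D.wholeSigma r] B) :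
    ∫ ω in B, D.segment Y k u ω ∂P = ∫ ω in B, D.segment Y k r ω ∂P := by
  -- The case `r = 1` is trivial and must be set apart, because `slope` divides by `1 - r`.
  rcases (unitInterval.le_one' (t := r)).eq_or_lt with rfl | hr
  · rw [le_antisymm unitInterval.le_one' hru]
  have hEm := D.measurableSet_activeFrom k
  obtain ⟨h1, h1'⟩ := D.setIntegral_level_sub (k := k) hr hru hB
  obtain ⟨h2, h2'⟩ := hY.setIntegral_compensator_sub (k := k) hru hB
  have h3 := integral_sub h1 h2
  rw [h1', h2', sub_zero] at h3
  have hl := fun v => (D.integrable_level k v).sub (hY.integrable_compensator k v)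
  rw [segment, segment, setIntegral_indicator hEm, setIntegral_indicator hEm, ← sub_eq_zero]
  refine Eq.trans ?_ h3
  refine (integral_sub (hl u).integrableOn (hl r).integrableOn).symm.trans ?_
  refine integral_congr_ae (ae_of_all _ fun ω => ?_)
  simp only [Pi.sub_apply]
  ring

end ModulatedInformation

/-! ### Progressive measurability and adaptedness of the segments. -/

lemma measurable_stopped_of_rightContinuous {Ω' E : Type*} [MeasurableSpace Ω']
    [TopologicalSpace E] [TopologicalSpace.PseudoMetrizableSpace E] [MeasurableSpace E]
    [BorelSpace E] {Z : I → Ω' → E} {t : I} (hm : ∀ u ≤ t, Measurable (Z u))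
    (hc : ∀ ω u, ContinuousWithinAt (fun s => Z s ω) (Set.Ici u) u) :
    Measurable fun p : I × Ω' => Z (min p.1 t) p.2 := by
  refine measurable_uncurry_of_rightContinuous (Z := fun u ω => Z (min u t) ω)
    (fun u => hm _ (min_le_right _ _)) fun ω u => ?_
  have h1 : ContinuousWithinAt (fun s : I => min s t) (Set.Ici u) u :=
    (continuous_id.min continuous_const).continuousWithinAt
  exact ContinuousWithinAt.comp (g := fun s => Z s ω) (f := fun s : I => min s t) (x := u)
    (hc ω (min u t)) h1 fun s hs => min_le_min_right t (show u ≤ s from hs)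

namespace ModulatedInformation

variable {Ω : Type*} [m : MeasurableSpace Ω] {P : Measure Ω} {n : ℕ}

variable (D : ModulatedInformation P n)

lemma measurable_J_stopped (t : I) : Measurable fun p : I × SubSpace (D.obsSigma t) =>
    D.J (min p.1 t) (ofSub p.2) :=
  measurable_stopped_of_rightContinuous (Z := fun u (ω : SubSpace (D.obsSigma t)) => D.J u (ofSub ω))
    (fun _ hu => D.measurable_J_obs hu) fun ω u => (D.cadlag (ofSub ω) u).1

lemma measurable_changes_obs {u t : I} (hut : u ≤ t) :
    Measurable fun ω : SubSpace (D.obsSigma t) => D.changes u (ofSub ω) :=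
  measurable_pathChanges (J := fun u (ω : SubSpace (D.obsSigma t)) => D.J u (ofSub ω))
    (fun ω => D.cadlag (ofSub ω)) fun _ hv => D.measurable_J_obs (hv.trans hut)

lemma measurable_changes_stopped (t : I) : Measurable fun p : I × SubSpace (D.obsSigma t) =>
    D.changes (min p.1 t) (ofSub p.2) :=
  measurable_stopped_of_rightContinuous
    (Z := fun u (ω : SubSpace (D.obsSigma t)) => D.changes u (ofSub ω))
    (fun _ hu => D.measurable_changes_obs hu) fun ω u =>
      (tendsto_congr' ((D.cadlag (ofSub ω)).eventually_right_pathChanges u)).2 tendsto_const_nhds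

lemma xiHat_rightContinuous (ω : Ω) (u : I) :
    ContinuousWithinAt (fun s => D.xiHat s ω) (Set.Ici u) u := by
  refine ((D.continuous_effective (D.J u ω) ω).continuousWithinAt).congr_of_eventuallyEq ?_
    (D.xiHat_eq_effective u ω)
  filter_upwards [(D.cadlag ω).eventually_right u] with s hs
  rw [xiHat_eq_effective, hs]

lemma measurable_xiHat_stopped (t : I) : Measurable fun p : I × SubSpace (D.obsSigma t) =>
    D.xiHat (min p.1 t) (ofSub p.2) :=
  measurable_stopped_of_rightContinuous
    (Z := fun u (ω : SubSpace (D.obsSigma t)) => D.xiHat u (ofSub ω))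
    (fun u hu => (D.measurable_xiHat_obs u).mono (D.obsSigma_mono hu) le_rfl)
    fun ω u => D.xiHat_rightContinuous (ofSub ω) u

lemma measurable_lastTimes_stopped (t : I) (i : Fin n) :
    Measurable fun p : I × SubSpace (D.obsSigma t) => D.lastTimes (min p.1 t) (ofSub p.2) i := by
  have h1 : ∀ u ≤ t, Measurable fun ω : SubSpace (D.obsSigma t) => D.lastTimes u (ofSub ω) i :=
    fun u hu => measurable_lastActive (J := fun u (ω : SubSpace (D.obsSigma t)) => D.J u (ofSub ω))
      (fun _ hv => D.measurable_J_obs (hv.trans hu)) (fun ω => D.cadlag (ofSub ω)) i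
  have h2 : ∀ (ω : SubSpace (D.obsSigma t)) (u : I),
      ContinuousWithinAt (fun s => D.lastTimes s (ofSub ω) i) (Set.Ici u) u :=
    fun ω u => (D.cadlag (ofSub ω)).pathLastActive_rightContinuous i u
  exact measurable_stopped_of_rightContinuous h1 h2

lemma measurable_min_switchTime_obs (k : ℕ) (t : I) :
    Measurable fun ω : SubSpace (D.obsSigma t) => min t (D.switchTime k (ofSub ω)) :=
  measurable_min_pathTime (J := fun u (ω : SubSpace (D.obsSigma t)) => D.J u (ofSub ω))
    (fun ω => D.cadlag (ofSub ω)) k fun _ hu => D.measurable_J_obs hu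

lemma measurableSet_le_changes_obs (k : ℕ) (t : I) :
    MeasurableSet[D.obsSigma t] {ω | k ≤ D.changes t ω} :=
  D.measurable_changes_obs le_rfl measurableSet_Ici

lemma measurableSet_pattern_obs (k : ℕ) (t : I) (S : Set (Fin n → Bool)) :
    MeasurableSet[D.obsSigma t] {ω | k ≤ D.changes t ω ∧ D.pattern k ω ∈ S} := by
  have h1 : Measurable fun ω : SubSpace (D.obsSigma t) =>
      D.J (min (min t (D.switchTime k (ofSub ω))) t) (ofSub ω) := by
    have h2 := (D.measurable_J_stopped t).comp
      ((D.measurable_min_switchTime_obs k t).prodMk measurable_id)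
    simpa only [Function.comp_def, id_eq] using h2
  have h3 : {ω | k ≤ D.changes t ω ∧ D.pattern k ω ∈ S} = {ω | k ≤ D.changes t ω} ∩
      (fun ω => D.J (min (min t (D.switchTime k ω)) t) ω) ⁻¹' S := by
    ext ω
    refine and_congr_right fun h => ?_
    rw [Set.mem_preimage, min_eq_right (D.switchTime_le h), min_eq_left (D.switchTime_le h)]
    rfl
  rw [h3]
  exact @MeasurableSet.inter _ (D.obsSigma t) _ _ (D.measurableSet_le_changes_obs k t)
    (h1 (Set.toFinite _).measurableSet)

lemma measurableSet_activeFrom_obs (k : ℕ) (t : I) :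
    MeasurableSet[D.obsSigma t] (D.activeFrom k ∩ {ω | k ≤ D.changes t ω}) := by
  have h : D.activeFrom k ∩ {ω | k ≤ D.changes t ω} =
      {ω | k ≤ D.changes t ω ∧ D.pattern k ω ∈ {a : Fin n → Bool | ∃ i, a i = true}} := by
    ext ω
    constructor
    · rintro ⟨h1, h2⟩
      exact ⟨h2, (D.mem_activeFrom_iff.1 h1).2⟩
    · rintro ⟨h1, h2⟩
      exact ⟨D.mem_activeFrom_iff.2 ⟨h1.trans (D.changes_mono ω unitInterval.le_one'), h2⟩, h1⟩
  rw [h]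
  exact D.measurableSet_pattern_obs k t _

lemma exists_dense_near_switchTime {k : ℕ} {t : I} {ω : Ω} (h : k ≤ D.changes t ω) {ε : ℝ}
    (hε : 0 < ε) : ∃ q ∈ denseTimes t, q ≤ t ∧ dist q (min t (D.switchTime k ω)) < ε ∧
      D.changes q ω = k := by
  rw [min_eq_right (D.switchTime_le h)]
  have h1 : ∀ᶠ q in 𝓝[≥] D.switchTime k ω, dist q (D.switchTime k ω) < ε ∧ D.changes q ω = k := by
    filter_upwards [nhdsWithin_le_nhds (Metric.ball_mem_nhds _ hε),
      (D.cadlag ω).eventually_right_pathChanges (D.switchTime k ω)] with q hq hq'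
    exact ⟨hq, hq'.trans (D.changes_switchTime h)⟩
  obtain ⟨q, hq, -, hqt, hp⟩ := exists_mem_dense_right (dense_denseTimes t) (self_mem_denseTimes t)
    (D.switchTime_le h) h1
  exact ⟨q, hq, hqt, hp⟩

/-- At the next change the pattern is already a different one, so it is approached from the left. If
that change comes after `t`, the time `t` itself serves. -/
lemma exists_dense_near_switchTime_succ {k : ℕ} {t : I} {ω : Ω} (h : k ≤ D.changes t ω) {ε : ℝ}
    (hε : 0 < ε) : ∃ q ∈ denseTimes t, q ≤ t ∧ dist q (min t (D.switchTime (k + 1) ω)) < ε ∧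
      D.changes q ω = k := by
  rcases h.eq_or_lt with heq | hlt
  · refine ⟨t, self_mem_denseTimes t, le_rfl, ?_, heq.symm⟩
    rw [min_eq_left (D.le_switchTime (by omega)), dist_self]
    exact hε
  · have hle : D.switchTime (k + 1) ω ≤ t := D.switchTime_le hlt
    rw [min_eq_right hle]
    have h0 : D.switchTime k ω < D.switchTime (k + 1) ω := by
      refine lt_of_le_of_ne (D.switchTime_mono k ω) fun hne => ?_
      have h1 := D.changes_switchTime h
      rw [hne, D.changes_switchTime hlt] at h1
      omega
    set τ := D.switchTime (k + 1) ω
    have h1 : ∀ᶠ q in 𝓝[<] τ, D.switchTime k ω < q ∧ q < τ ∧ dist q τ < ε := by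
      filter_upwards [nhdsWithin_le_nhds (Metric.ball_mem_nhds τ hε), Ioo_mem_nhdsLT h0]
        with q hq hq'
      exact ⟨hq'.1, hq'.2, hq⟩
    obtain ⟨a, ha, hsub⟩ := (mem_nhdsLT_iff_exists_Ioo_subset' h0).1 h1
    obtain ⟨q, hq, haq, hqτ⟩ := exists_mem_dense_lt (dense_denseTimes t) ha
    obtain ⟨h2, -, h3⟩ := hsub ⟨haq, hqτ⟩
    exact ⟨q, hq, hqτ.le.trans hle, h3,
      (D.changes_eq_iff (hqτ.trans_le unitInterval.le_one')).2 ⟨h2.le, hqτ⟩⟩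

/-- Near the time in question the `k`-th pattern is in force, so each source with nonzero weight is
visible there, and `measurable_indicator_xi_obs` applies. -/
lemma measurable_effective_obs_of_approx {k k' : ℕ} {t : I}
    (h : ∀ ω, k ≤ D.changes t ω → ∀ ε > 0, ∃ q ∈ denseTimes t, q ≤ t ∧
      dist q (min t (D.switchTime k' ω)) < ε ∧ D.changes q ω = k) :
    Measurable[D.obsSigma t] ({ω | k ≤ D.changes t ω}.indicator fun ω =>
      D.effective (D.pattern k ω) (min t (D.switchTime k' ω)) ω) := by
  have h1 : ∀ i, Measurable[D.obsSigma t]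
      ({ω | k ≤ D.changes t ω ∧ D.pattern k ω ∈ {a : Fin n → Bool | a i = true}}.indicator
        fun ω => D.xi i (min t (D.switchTime k' ω)) ω) := fun i => by
    refine D.measurable_indicator_xi_obs i (D.measurable_min_switchTime_obs k' t)
      (D.measurableSet_pattern_obs k t _) fun ω hω ε hε => ?_
    obtain ⟨q, hq, hqt, hd, hc⟩ := h ω hω.1 ε hε
    refine ⟨q, hq, hqt, hd, ?_⟩
    rw [D.J_eq_pattern hc]
    exact hω.2
  have h2 : Measurable[D.obsSigma t] fun ω => D.J (min (min t (D.switchTime k ω)) t) ω := by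
    have h2 := (D.measurable_J_stopped t).comp
      ((D.measurable_min_switchTime_obs k t).prodMk measurable_id)
    simp only [Function.comp_def, id_eq] at h2
    exact h2
  have h3 : ({ω | k ≤ D.changes t ω}.indicator fun ω =>
      D.effective (D.pattern k ω) (min t (D.switchTime k' ω)) ω) = fun ω =>
      ∑ i, D.weight (D.J (min (min t (D.switchTime k ω)) t) ω) i *
        {ω | k ≤ D.changes t ω ∧ D.pattern k ω ∈ {a : Fin n → Bool | a i = true}}.indicator
        (fun ω => D.xi i (min t (D.switchTime k' ω)) ω) ω := by
    ext ω
    by_cases hω : k ≤ D.changes t ω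
    · rw [Set.indicator_of_mem (show ω ∈ {ω | k ≤ D.changes t ω} from hω), effective]
      refine Finset.sum_congr rfl fun i _ => ?_
      rw [min_eq_right (D.switchTime_le hω), min_eq_left (D.switchTime_le hω)]
      change D.weight (D.pattern k ω) i * _ = D.weight (D.pattern k ω) i * _
      by_cases hi : D.pattern k ω i = true
      · rw [Set.indicator_of_mem (show ω ∈ {ω | k ≤ D.changes t ω ∧
          D.pattern k ω ∈ {a : Fin n → Bool | a i = true}} from ⟨hω, hi⟩)]
      · rw [D.weight_of_false hi, zero_mul, zero_mul]
    · rw [Set.indicator_of_notMem (show ω ∉ {ω | k ≤ D.changes t ω} from hω)]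
      refine (Finset.sum_eq_zero fun i _ => ?_).symm
      rw [Set.indicator_of_notMem fun h => hω h.1, mul_zero]
  rw [h3]
  refine Finset.measurable_fun_sum _ fun i _ => Measurable.mul ?_ (h1 i)
  exact (measurable_of_finite fun a => D.weight a i).comp h2

lemma segment_eq_zero (Y : I → Ω → ℝ) {k : ℕ} {t : I} {ω : Ω} (h : D.changes t ω < k) :
    D.segment Y k t ω = 0 := by
  have h1 : D.level k t ω = 0 := by
    rw [level, min_eq_left (D.le_switchTime h), min_eq_left (D.le_switchTime (by omega)), sub_self]
  have h2 : D.compensator Y k t ω = 0 := by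
    have h3 : {s : I | s ≤ t ∧ D.changes s ω = k} = ∅ := by
      refine Set.eq_empty_of_forall_notMem fun s hs => ?_
      have h4 : D.changes s ω ≤ D.changes t ω := D.changes_mono ω hs.1
      have h5 := hs.2
      omega
    rw [compensator, h3, setIntegral_empty]
  rw [segment]
  exact Set.indicator_apply_eq_zero.2 fun _ => by rw [h1, h2, sub_self]

variable [IsProbabilityMeasure P] [P.IsComplete]

lemma measurable_xi_lastTimes_stopped (t : I) (i : Fin n) :
    Measurable fun p : I × SubSpace (D.obsSigma t) =>
      D.xi i (D.lastTimes (min p.1 t) (ofSub p.2) i) (ofSub p.2) :=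
  measurable_stopped_of_rightContinuous
    (Z := fun u (ω : SubSpace (D.obsSigma t)) => D.xi i (D.lastTimes u (ofSub ω) i) (ofSub ω))
    (fun u hu => (D.measurable_xi_lastActive_obs u i).mono (D.obsSigma_mono hu) le_rfl)
    fun ω u => ((D.continuous_xi i (ofSub ω)).tendsto _).comp
      ((D.cadlag (ofSub ω)).pathLastActive_rightContinuous i u)

lemma measurable_estimate_stopped (t : I) : Measurable fun p : I × SubSpace (D.obsSigma t) =>
    D.estimate (min p.1 t) (ofSub p.2) := by
  have h1 : ∀ i, Measurable fun p : I × SubSpace (D.obsSigma t) =>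
      (D.lastTimes (min p.1 t) (ofSub p.2) i : ℝ) := fun i =>
    measurable_subtype_coe.comp (D.measurable_lastTimes_stopped t i)
  have h2 : Measurable fun p : I × SubSpace (D.obsSigma t) =>
      D.score (D.lastTimes (min p.1 t) (ofSub p.2)) (ofSub p.2) := by
    refine Finset.measurable_fun_sum _ fun i _ => ?_
    exact (D.measurable_xi_lastTimes_stopped t i).div
      ((measurable_const.sub (h1 i)).const_mul (D.vol i ^ 2))
  have h3 : Measurable fun p : I × SubSpace (D.obsSigma t) =>
      D.precision (D.lastTimes (min p.1 t) (ofSub p.2)) := by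
    refine Finset.measurable_fun_sum _ fun i _ => ?_
    exact (h1 i).div ((measurable_const.sub (h1 i)).const_mul (D.vol i ^ 2))
  unfold estimate
  simpa only [Function.comp_def] using
    (measurable_posteriorMean (P := P) D.X_measurable).comp (h2.prodMk h3)

/-- The explicit estimate is progressively measurable, so its time integral up to `t` is observable
at `t`. For another version this is deduced from `compensator_ae_eq`. -/
lemma measurable_compensator_estimate_obs (k : ℕ) (t : I) :
    Measurable[D.obsSigma t] (D.compensator D.estimate k t) := by
  have h1 : Measurable fun p : I × SubSpace (D.obsSigma t) =>
      D.activeDrift D.estimate (min p.1 t, ofSub p.2) := by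
    have h2 : Measurable fun p : I × SubSpace (D.obsSigma t) =>
        D.drift D.estimate (min p.1 t) (ofSub p.2) := by
      refine ((D.measurable_estimate_stopped t).sub (D.measurable_xiHat_stopped t)).div ?_
      exact measurable_const.sub (measurable_subtype_coe.comp (measurable_fst.min measurable_const))
    have h3 : MeasurableSet {p : I × SubSpace (D.obsSigma t) |
        (D.active (min p.1 t) (ofSub p.2)).Nonempty} := by
      simp only [D.active_nonempty_iff]
      exact D.measurable_J_stopped t (Set.toFinite {a : Fin n → Bool | ∃ i, a i = true}).measurableSet
    exact h2.indicator h3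
  have h4 : MeasurableSet {p : I × SubSpace (D.obsSigma t) |
      p.1 ≤ t ∧ D.changes (min p.1 t) (ofSub p.2) = k} :=
    (measurable_fst measurableSet_Iic).inter
      (D.measurable_changes_stopped t (measurableSet_singleton k))
  have h5 := (h1.indicator h4).stronglyMeasurable.integral_prod_left' (μ := (volume : Measure I))
  have h6 : D.compensator D.estimate k t = fun ω => ∫ s, {p : I × SubSpace (D.obsSigma t) |
      p.1 ≤ t ∧ D.changes (min p.1 t) (ofSub p.2) = k}.indicator
      (fun p => D.activeDrift D.estimate (min p.1 t, ofSub p.2)) (s, toSub (D.obsSigma t) ω) := by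
    ext ω
    rw [compensator, ← integral_indicator (D.measurableSet_segmentTimes k t ω)]
    refine integral_congr_ae (ae_of_all _ fun s => ?_)
    by_cases hs : s ≤ t
    · simp only [Set.indicator_apply, Set.mem_ofPred_eq, hs, min_eq_left hs]
      rfl
    · simp only [Set.indicator_apply, Set.mem_ofPred_eq, hs, false_and, if_false]
  rw [h6]
  exact h5.measurable

/-- Two versions agree almost surely at each time before `1`; by Fubini almost every path of one
agrees with that of the other at almost every time, which is all that the integral sees. -/
lemma IsBestEstimate.compensator_ae_eq {D : ModulatedInformation P n} {Y : I → Ω → ℝ}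
    (hY : D.IsBestEstimate Y) (k : ℕ) (t : I) :
    D.compensator Y k t =ᵐ[P] D.compensator D.estimate k t := by
  have h1 : ∀ᵐ s : I, ∀ᵐ ω ∂P, Y s ω = D.estimate s ω := by
    filter_upwards [ae_lt_one] with s hs
    exact (hY.version s hs).trans (D.isBestEstimate_estimate.version s hs).symm
  have h2 : MeasurableSet {p : I × Ω | Y p.1 p.2 = D.estimate p.1 p.2} :=
    measurableSet_eq_fun hY.measurable D.measurable_uncurry_estimate
  have h3 : ∀ᵐ ω ∂P, ∀ᵐ s : I, Y s ω = D.estimate s ω := (Measure.ae_ae_comm h2).1 h1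
  filter_upwards [h3] with ω hω
  refine integral_congr_ae (ae_restrict_of_ae ?_)
  filter_upwards [hω] with s hs
  simp only [activeDrift, Set.indicator_apply, drift, hs]

lemma IsBestEstimate.measurable_compensator_obs {D : ModulatedInformation P n} {Y : I → Ω → ℝ}
    (hY : D.IsBestEstimate Y) (k : ℕ) (t : I) :
    Measurable[D.obsSigma t] (D.compensator Y k t) :=
  measurable_of_ae_eq_of_null_le le_sup_right (D.measurable_compensator_estimate_obs k t)
    (hY.compensator_ae_eq k t)

lemma IsBestEstimate.measurable_segment_obs {D : ModulatedInformation P n} {Y : I → Ω → ℝ}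
    (hY : D.IsBestEstimate Y) (k : ℕ) (t : I) :
    Measurable[D.obsSigma t] (D.segment Y k t) := by
  have h1 := D.measurable_effective_obs_of_approx (k := k) (k' := k + 1) (t := t)
    fun ω hω ε hε => D.exists_dense_near_switchTime_succ hω hε
  have h0 := D.measurable_effective_obs_of_approx (k := k) (k' := k) (t := t)
    fun ω hω ε hε => D.exists_dense_near_switchTime hω hε
  have h2 := hY.measurable_compensator_obs k t
  have h3 := ((h1.sub h0).sub h2).indicator (D.measurableSet_activeFrom_obs k t)
  convert h3 using 1
  ext ω
  by_cases hω : ω ∈ D.activeFrom k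
  · by_cases hωt : k ≤ D.changes t ω
    · have hm : ω ∈ {ω | k ≤ D.changes t ω} := hωt
      rw [segment, Set.indicator_of_mem hω, Set.indicator_of_mem (show ω ∈ D.activeFrom k ∩
        {ω | k ≤ D.changes t ω} from ⟨hω, hωt⟩)]
      simp only [Pi.sub_apply, Set.indicator_of_mem hm]
      rfl
    · rw [Set.indicator_of_notMem fun h => hωt h.2]
      exact D.segment_eq_zero Y (not_le.1 hωt)
  · rw [segment, Set.indicator_of_notMem hω, Set.indicator_of_notMem fun h => hω h.1]

end ModulatedInformation

/-! ### Passage to the right-continuous filtration. -/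

namespace ModulatedInformation

variable {Ω : Type*} [m : MeasurableSpace Ω] {P : Measure Ω} {n : ℕ}

lemma obsSigma_le_filtration (D : ModulatedInformation P n) (t : I) :
    D.obsSigma t ≤ D.filtration t :=
  Filtration.le_rightCont (⟨fun t => D.rawSigma t ⊔ nullSigma P,
    fun _ _ h => sup_le_sup_right (D.rawSigma_mono h) _,
    fun t => sup_le (D.rawSigma_le t) nullSigma_le⟩ : Filtration I m) t

lemma filtration_le_obsSigma (D : ModulatedInformation P n) {t r : I} (h : t < r) :
    D.filtration t ≤ D.obsSigma r := by
  have h1 : (𝓝[>] t).NeBot := nhdsGT_neBot_of_exists_gt ⟨r, h⟩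
  rw [filtration, Filtration.rightCont_eq_of_neBot_nhdsGT]
  exact iInf₂_le r h

variable (D : ModulatedInformation P n)

lemma abs_max_min_sub_le {t r : I} (htr : t ≤ r) (a b : I) :
    |((max t (min r a) : I) : ℝ) - (max t (min r b) : I)| ≤ (r : ℝ) - t := by
  have h : ∀ a : I, (t : ℝ) ≤ (max t (min r a) : I) ∧ ((max t (min r a) : I) : ℝ) ≤ r := fun a =>
    ⟨le_max_left t (min r a), max_le htr (min_le_left r a)⟩
  have ha := h a
  have hb := h b
  rw [abs_le]
  constructor <;> linarith

lemma abs_level_sub_le {k : ℕ} {t r : I} (htr : t ≤ r) {ω : Ω} (hω : ω ∈ D.activeFrom k) :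
    |D.level k r ω - D.level k t ω| ≤ ((r : ℝ) - t) * |D.X ω| +
      ∑ i, D.vol i * |D.β i (max t (min r (D.switchTime (k + 1) ω))) ω
        - D.β i (max t (min r (D.switchTime k ω))) ω| := by
  have ha := (D.mem_activeFrom_iff.1 hω).2
  rw [D.level_sub_level htr, D.effective_eq ha, D.effective_eq ha]
  set s := max t (min r (D.switchTime (k + 1) ω)) with hs
  set s' := max t (min r (D.switchTime k ω)) with hs'
  have h1 : (s : ℝ) * D.X ω + ∑ i, D.weight (D.pattern k ω) i * D.vol i * D.β i s ω
      - ((s' : ℝ) * D.X ω + ∑ i, D.weight (D.pattern k ω) i * D.vol i * D.β i s' ω)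
      = ((s : ℝ) - s') * D.X ω
        + ∑ i, D.weight (D.pattern k ω) i * D.vol i * (D.β i s ω - D.β i s' ω) := by
    simp only [mul_sub, Finset.sum_sub_distrib]
    ring
  rw [h1]
  refine (abs_add_le _ _).trans (add_le_add ?_ ((Finset.abs_sum_le_sum_abs _ _).trans
    (Finset.sum_le_sum fun i _ => ?_)))
  · rw [abs_mul]
    exact mul_le_mul_of_nonneg_right (abs_max_min_sub_le htr _ _) (abs_nonneg _)
  · rw [abs_mul]
    exact mul_le_mul_of_nonneg_right
      ((le_abs_self _).trans (abs_abs _).le |>.trans (D.abs_weight_mul_vol_le _ i)) (abs_nonneg _)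

variable [IsProbabilityMeasure P]

/-- The clipped change times are at most `r - t` apart. Freezing the switching bounds the mean
bridge increment by `√(r - t)`, which gives continuity in mean without any maximal inequality. -/
lemma abs_setIntegral_level_sub_le {k : ℕ} {t r : I} (htr : t ≤ r) {A : Set Ω}
    (hA : MeasurableSet A) (hAE : A ⊆ D.activeFrom k) :
    |(∫ ω in A, D.level k r ω ∂P) - ∫ ω in A, D.level k t ω ∂P|
      ≤ ((r : ℝ) - t) * (∫ ω, |D.X ω| ∂P) + ∑ i, D.vol i * √((r : ℝ) - t) := by
  have hβ : ∀ i, Integrable (fun ω => D.β i (max t (min r (D.switchTime (k + 1) ω))) ω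
        - D.β i (max t (min r (D.switchTime k ω))) ω) P ∧
      ∫ ω, |D.β i (max t (min r (D.switchTime (k + 1) ω))) ω
        - D.β i (max t (min r (D.switchTime k ω))) ω| ∂P ≤ √((r : ℝ) - t) := fun i =>
    D.integrable_β_sub_random i (D.measurable_min_max_switch (k + 1) t r)
      (D.measurable_min_max_switch k t r) fun ω => abs_max_min_sub_le htr _ _
  have hX : Integrable (fun ω => ((r : ℝ) - t) * |D.X ω|) P := D.integrable_X.abs.const_mul _
  have hs : ∀ i, Integrable (fun ω => D.vol i * |D.β i (max t (min r (D.switchTime (k + 1) ω))) ω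
        - D.β i (max t (min r (D.switchTime k ω))) ω|) P := fun i => (hβ i).1.abs.const_mul _
  have hlev : Integrable (fun ω => D.level k r ω - D.level k t ω) P :=
    (D.integrable_level k r).sub (D.integrable_level k t)
  have hbound := hX.add (integrable_finsetSum Finset.univ fun i _ => hs i)
  rw [← integral_sub (D.integrable_level k r).integrableOn (D.integrable_level k t).integrableOn]
  calc |∫ ω in A, (D.level k r ω - D.level k t ω) ∂P|
      ≤ ∫ ω in A, |D.level k r ω - D.level k t ω| ∂P := abs_integral_le_integral_abs
    _ ≤ ∫ ω in A, (((r : ℝ) - t) * |D.X ω| + ∑ i, D.vol i *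
        |D.β i (max t (min r (D.switchTime (k + 1) ω))) ω
          - D.β i (max t (min r (D.switchTime k ω))) ω|) ∂P :=
        setIntegral_mono_on hlev.abs.integrableOn hbound.integrableOn hA
          fun ω hω => D.abs_level_sub_le htr (hAE hω)
    _ ≤ ∫ ω, (((r : ℝ) - t) * |D.X ω| + ∑ i, D.vol i *
        |D.β i (max t (min r (D.switchTime (k + 1) ω))) ω
          - D.β i (max t (min r (D.switchTime k ω))) ω|) ∂P :=
        setIntegral_le_integral hbound (ae_of_all _ fun ω => add_nonneg
          (mul_nonneg (sub_nonneg.2 htr) (abs_nonneg _))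
          (Finset.sum_nonneg fun i _ => mul_nonneg (D.vol_pos i).le (abs_nonneg _)))
    _ ≤ _ := by
        rw [integral_add hX (integrable_finsetSum _ fun i _ => hs i), integral_const_mul,
          integral_finsetSum _ fun i _ => hs i]
        refine add_le_add_right (Finset.sum_le_sum fun i _ => ?_) _
        rw [integral_const_mul]
        exact mul_le_mul_of_nonneg_left (hβ i).2 (D.vol_pos i).le

variable [P.IsComplete] {D} {Y : I → Ω → ℝ}

lemma IsBestEstimate.tendsto_setIntegral_compensator (hY : D.IsBestEstimate Y) (k : ℕ) {t : I}
    {r : ℕ → I} (hr : Antitone r) (htr : ∀ j, t ≤ r j) (hlim : Tendsto r atTop (𝓝 t)) (A : Set Ω) :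
    Tendsto (fun j => ∫ ω in A, D.compensator Y k (r j) ω ∂P) atTop
      (𝓝 (∫ ω in A, D.compensator Y k t ω ∂P)) := by
  have hH : Integrable (fun ω => ∫ s, ‖D.activeDrift Y (s, ω)‖) P :=
    hY.integrable_activeDrift.norm.integral_prod_right
  refine tendsto_integral_of_dominated_convergence (fun ω => ∫ s, ‖D.activeDrift Y (s, ω)‖)
    (fun j => (hY.integrable_compensator k (r j)).aestronglyMeasurable.restrict)
    hH.integrableOn (fun j => ae_restrict_of_ae ?_) (ae_restrict_of_ae ?_)
  · filter_upwards [hY.ae_integrable_activeDrift] with ω hω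
    exact (norm_integral_le_integral_norm _).trans
      (setIntegral_le_integral hω.norm (ae_of_all _ fun _ => norm_nonneg _))
  · filter_upwards [hY.ae_integrable_activeDrift] with ω hω
    have h := tendsto_setIntegral_of_antitone (μ := (volume : Measure I))
      (f := fun s => D.activeDrift Y (s, ω))
      (s := fun j => {s : I | s ≤ r j ∧ D.changes s ω = k})
      (fun j => D.measurableSet_segmentTimes k (r j) ω)
      (fun i j hij s hs => ⟨hs.1.trans (hr hij), hs.2⟩) ⟨0, hω.integrableOn⟩
    have h2 : (⋂ j, {s : I | s ≤ r j ∧ D.changes s ω = k}) = {s : I | s ≤ t ∧ D.changes s ω = k} := by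
      ext s
      simp only [Set.mem_iInter]
      exact ⟨fun h => ⟨ge_of_tendsto' hlim fun j => (h j).1, (h 0).2⟩,
        fun h j => ⟨h.1.trans (htr j), h.2⟩⟩
    rw [h2] at h
    exact h

lemma IsBestEstimate.tendsto_setIntegral_segment (hY : D.IsBestEstimate Y) (k : ℕ) {t : I}
    {r : ℕ → I} (hr : Antitone r) (htr : ∀ j, t ≤ r j) (hlim : Tendsto r atTop (𝓝 t)) {A : Set Ω}
    (hA : MeasurableSet A) :
    Tendsto (fun j => ∫ ω in A, D.segment Y k (r j) ω ∂P) atTop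
      (𝓝 (∫ ω in A, D.segment Y k t ω ∂P)) := by
  have hE := D.measurableSet_activeFrom k
  have h0 : ∀ v, ∫ ω in A, D.segment Y k v ω ∂P = (∫ ω in A ∩ D.activeFrom k, D.level k v ω ∂P)
      - ∫ ω in A ∩ D.activeFrom k, D.compensator Y k v ω ∂P := fun v => by
    rw [segment, setIntegral_indicator hE]
    exact integral_sub (D.integrable_level k v).integrableOn
      (hY.integrable_compensator k v).integrableOn
  simp only [h0]
  refine Tendsto.sub ?_ (hY.tendsto_setIntegral_compensator k hr htr hlim _)
  have hlim' : Tendsto (fun j => (r j : ℝ) - t) atTop (𝓝 0) := by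
    have h := ((continuous_subtype_val.tendsto t).comp hlim).sub_const (t : ℝ)
    rwa [sub_self] at h
  refine tendsto_iff_norm_sub_tendsto_zero.2 (squeeze_zero (fun _ => norm_nonneg _)
    (fun j => D.abs_setIntegral_level_sub_le (htr j) (hA.inter hE) Set.inter_subset_right) ?_)
  have h1 := hlim'.mul_const (∫ ω, |D.X ω| ∂P)
  have h2 : Tendsto (fun j => ∑ i, D.vol i * √((r j : ℝ) - t)) atTop (𝓝 (∑ i, D.vol i * √0)) :=
    tendsto_finsetSum _ fun i _ =>
      ((Real.continuous_sqrt.tendsto 0).comp hlim').const_mul (D.vol i)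
  simpa using h1.add h2

lemma IsBestEstimate.measurable_segment_filtration (hY : D.IsBestEstimate Y) (k : ℕ) (t : I) :
    StronglyMeasurable[D.filtration t] (D.segment Y k t) :=
  ((hY.measurable_segment_obs k t).mono (D.obsSigma_le_filtration t) le_rfl).stronglyMeasurable

/-- An event of the filtration at `t` is observable at every `r > t`, so the integral over it is the
same at `r` and at `u`. Letting `r` decrease to `t` replaces `r` by `t`. -/
theorem IsBestEstimate.condExp_segment (hY : D.IsBestEstimate Y) (k : ℕ) {t u : I} (htu : t ≤ u) :
    P[D.segment Y k u | D.filtration t] =ᵐ[P] D.segment Y k t := by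
  refine (ae_eq_condExp_of_forall_setIntegral_eq (D.filtration.le t) (hY.integrable_segment k u)
    (fun _ _ _ => (hY.integrable_segment k t).integrableOn) (fun A hA _ => ?_)
    (hY.measurable_segment_filtration k t).aestronglyMeasurable).symm
  rcases htu.eq_or_lt with rfl | htu
  · rfl
  · obtain ⟨r, hr, hrtu, hlim⟩ := exists_seq_strictAnti_tendsto' htu
    have h1 := hY.tendsto_setIntegral_segment k hr.antitone (fun j => (hrtu j).1.le) hlim
      (D.filtration.le t A hA)
    have h2 : ∀ j, ∫ ω in A, D.segment Y k (r j) ω ∂P = ∫ ω in A, D.segment Y k u ω ∂P := fun j =>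
      (hY.setIntegral_segment_eq k (hrtu j).2.le (D.obsSigma_le_wholeSigma _ _
        (D.filtration_le_obsSigma (hrtu j).1 A hA))).symm
    simp only [h2] at h1
    exact tendsto_nhds_unique h1 tendsto_const_nhds

end ModulatedInformation

/-! ### Pathwise identification of `M` between two state changes. -/

namespace ModulatedInformation

variable {Ω : Type*} [m : MeasurableSpace Ω] {P : Measure Ω} {n : ℕ}

variable (D : ModulatedInformation P n) {Y : I → Ω → ℝ} {k : ℕ} {s t u v : I} {ω : Ω}

lemma switchTime_lt_succ (h : k + 1 ≤ D.changes t ω) :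
    D.switchTime k ω < D.switchTime (k + 1) ω := by
  refine lt_of_le_of_ne (D.switchTime_mono k ω) fun hne => ?_
  have h1 := D.changes_switchTime (show k ≤ D.changes t ω by omega)
  rw [hne, D.changes_switchTime h] at h1
  omega

lemma eventually_left_changes (h : k + 1 ≤ D.changes t ω) :
    ∀ᶠ s in 𝓝[<] D.switchTime (k + 1) ω, D.changes s ω = k := by
  filter_upwards [Ioo_mem_nhdsLT (D.switchTime_lt_succ h)] with s hs
  exact (D.changes_eq_iff (hs.2.trans_le unitInterval.le_one')).2 ⟨hs.1.le, hs.2⟩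

lemma nhdsLT_switchTime_neBot (h : k + 1 ≤ D.changes t ω) :
    (𝓝[<] D.switchTime (k + 1) ω).NeBot :=
  nhdsLT_neBot_of_exists_lt ⟨_, D.switchTime_lt_succ h⟩

lemma xiHat_eq_effective_pattern (h : D.changes s ω = k) :
    D.xiHat s ω = D.effective (D.pattern k ω) s ω := by
  rw [xiHat_eq_effective, D.J_eq_pattern h]

lemma leftLim_xiHat_switchTime (h : k + 1 ≤ D.changes t ω) :
    Function.leftLim (fun r => D.xiHat r ω) (D.switchTime (k + 1) ω)
      = D.effective (D.pattern k ω) (D.switchTime (k + 1) ω) ω := by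
  have hne := D.nhdsLT_switchTime_neBot h
  refine leftLim_eq_of_tendsto (Tendsto.congr' ?_
    ((D.continuous_effective (D.pattern k ω) ω).continuousWithinAt (s := Set.Iio _)))
  filter_upwards [D.eventually_left_changes h] with s hs
  exact (D.xiHat_eq_effective_pattern hs).symm

lemma leftLim_J_switchTime (h : k + 1 ≤ D.changes t ω) :
    Function.leftLim (fun r => D.J r ω) (D.switchTime (k + 1) ω) = D.pattern k ω := by
  have hne := D.nhdsLT_switchTime_neBot h
  refine leftLim_eq_of_tendsto (Tendsto.congr' ?_ tendsto_const_nhds)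
  filter_upwards [D.eventually_left_changes h] with s hs
  exact (D.J_eq_pattern hs).symm

lemma stoppedBefore_of_changes_eq (Z : I → ℝ) (h : D.changes u ω = k) :
    stoppedBefore Z (D.changeTime (k + 1) ω) u = Z u := by
  rw [stoppedBefore, if_pos (D.lt_changeTime_iff.2 (by omega))]

lemma stoppedBefore_of_lt_changes (Z : I → ℝ) (h : k ≤ D.changes u ω) :
    stoppedBefore Z (D.changeTime k ω) u = Function.leftLim Z (D.switchTime k ω) := by
  rw [stoppedBefore, if_neg (fun h' => absurd (D.lt_changeTime_iff.1 h') (by omega))]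
  rfl

lemma stoppedBefore_xiHat (h : k ≤ D.changes u ω) :
    stoppedBefore (fun r => D.xiHat r ω) (D.changeTime (k + 1) ω) u
      = D.effective (D.pattern k ω) (min u (D.switchTime (k + 1) ω)) ω := by
  rcases h.eq_or_lt with heq | hlt
  · rw [D.stoppedBefore_of_changes_eq _ heq.symm, min_eq_left (D.le_switchTime (by omega)),
      D.xiHat_eq_effective_pattern heq.symm]
  · rw [D.stoppedBefore_of_lt_changes _ hlt, min_eq_right (D.switchTime_le hlt),
      D.leftLim_xiHat_switchTime hlt]

lemma changeTime_untopD (h : k ≤ D.changes u ω) :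
    (D.changeTime k ω).untopD 0 = D.switchTime k ω := by
  rw [D.changeTime_eq_switchTime h, WithTop.untopD_coe]

lemma changes_eq_iff_changeTime :
    D.changes s ω = k ↔ D.changeTime k ω ≤ s ∧ (s : WithTop I) < D.changeTime (k + 1) ω := by
  rw [D.changeTime_le_iff, D.lt_changeTime_iff]
  omega

lemma drift_eq_activeDrift (hω : ω ∈ D.activeFrom k) (hs : D.changes s ω = k) :
    D.drift Y s ω = D.activeDrift Y (s, ω) := by
  rw [activeDrift, Set.indicator_of_mem]
  exact D.active_of_mem_activeFrom hω hs

/-- The index shifts by one: the piece with number `k + 1` starts at the `k`-th change. Some source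
is active throughout that interval, so `drift` and `activeDrift` agree on it. -/
lemma piece_eq_segment (hω : ω ∈ D.activeFrom k) (h : k ≤ D.changes u ω) :
    D.piece Y (k + 1) u ω = D.segment Y k u ω := by
  rw [piece, Nat.add_sub_cancel, if_neg (fun h' => absurd (D.lt_changeTime_iff.1 h') (by omega)),
    D.stoppedBefore_xiHat h, D.changeTime_untopD h,
    D.xiHat_eq_effective_pattern (D.changes_switchTime h), segment, Set.indicator_of_mem hω, level,
    min_eq_right (D.switchTime_le h), compensator]
  have hset : {s : I | D.changeTime k ω ≤ s ∧ s ≤ u ∧ (s : WithTop I) < D.changeTime (k + 1) ω}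
      = {s : I | s ≤ u ∧ D.changes s ω = k} := by
    ext s
    change (_ ∧ _ ∧ _) ↔ _ ∧ _
    rw [D.changes_eq_iff_changeTime]
    tauto
  rw [hset]
  congr 1
  exact setIntegral_congr_fun (D.measurableSet_segmentTimes k u ω)
    fun s hs => D.drift_eq_activeDrift hω hs.2

lemma piece_eq_piece (hu : k + 1 ≤ D.changes u ω) (hv : k + 1 ≤ D.changes v ω) :
    D.piece Y (k + 1) u ω = D.piece Y (k + 1) v ω := by
  have h : ∀ w, k + 1 ≤ D.changes w ω →
      {s : I | D.changeTime k ω ≤ s ∧ s ≤ w ∧ (s : WithTop I) < D.changeTime (k + 1) ω}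
        = {s : I | D.changes s ω = k} := fun w hw => by
    ext s
    change (_ ∧ _ ∧ _) ↔ D.changes s ω = k
    rw [D.changes_eq_iff_changeTime]
    refine ⟨fun h => ⟨h.1, h.2.2⟩, fun h => ⟨h.1, ?_, h.2⟩⟩
    by_contra hlt
    have h1 : D.changes w ω ≤ D.changes s ω := D.changes_mono ω (not_le.1 hlt).le
    have h2 := D.lt_changeTime_iff.1 h.2
    omega
  rw [piece, piece, Nat.add_sub_cancel,
    if_neg (fun h' => absurd (D.lt_changeTime_iff.1 h') (by omega)),
    if_neg (fun h' => absurd (D.lt_changeTime_iff.1 h') (by omega)),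
    D.stoppedBefore_of_lt_changes _ hu, D.stoppedBefore_of_lt_changes _ hv, h u hu, h v hv]

lemma segment_eq_segment (hu : k + 1 ≤ D.changes u ω) (hv : k + 1 ≤ D.changes v ω) :
    D.segment Y k u ω = D.segment Y k v ω := by
  by_cases hω : ω ∈ D.activeFrom k
  · rw [← D.piece_eq_segment hω (by omega), ← D.piece_eq_segment hω (by omega),
      D.piece_eq_piece hu hv]
  · rw [segment, segment, Set.indicator_of_notMem hω, Set.indicator_of_notMem hω]

lemma segment_switchTime : D.segment Y k (D.switchTime k ω) ω = 0 := by
  have h1 : D.level k (D.switchTime k ω) ω = 0 := by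
    rw [level, min_eq_left (D.switchTime_mono k ω), min_self, sub_self]
  have h2 : D.compensator Y k (D.switchTime k ω) ω = 0 := by
    rw [compensator]
    refine setIntegral_measure_zero _ (measure_mono_null (t := {D.switchTime k ω}) ?_ (by simp))
    rintro s ⟨hs, hk⟩
    exact le_antisymm hs (D.switchTime_le hk.ge)
  rw [segment]
  exact Set.indicator_apply_eq_zero.2 fun _ => by rw [h1, h2, sub_self]

lemma mem_activations_jump (h : s ∈ D.activations ω) :
    D.J s ω ≠ Function.leftLim (fun r => D.J r ω) s := by
  obtain ⟨i, h1, h2⟩ := h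
  intro h
  rw [h, h2] at h1
  exact absurd h1 (by decide)

lemma not_mem_activations (huv : u < s) (hsv : s ≤ v) (h : D.changes u ω = D.changes v ω) :
    s ∉ D.activations ω := fun hs =>
  D.mem_activations_jump hs
    ((D.cadlag ω).no_jump_of_pathChanges_eq (huv.le.trans hsv) h s huv hsv)

/-- After the `k`-th change and before the next one there is no activation and all earlier pieces
are complete, so only the current piece moves, and it starts from zero. -/
lemma M_eq (h : D.changes u ω = k) (hω : ω ∈ D.activeFrom k) :
    D.M Y u ω = D.M Y (D.switchTime k ω) ω + D.segment Y k u ω := by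
  have hρ := D.changes_switchTime h.ge
  have hle := D.switchTime_le h.ge
  have hact : {s : I | s ≤ u} ∩ D.activations ω
      = {s : I | s ≤ D.switchTime k ω} ∩ D.activations ω := by
    ext s
    refine and_congr_left fun hs => ⟨fun hsu => ?_, fun hsk => ?_⟩
    · exact not_lt.1 fun hlt => D.not_mem_activations hlt hsu (hρ.trans h.symm) hs
    · exact le_trans (show s ≤ D.switchTime k ω from hsk) hle
  rw [M, M, hact, hρ, h, Finset.sum_Icc_succ_top (by omega), Finset.sum_Icc_succ_top (by omega),
    D.piece_eq_segment hω h.ge, D.piece_eq_segment hω hρ.ge, D.segment_switchTime,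
    Finset.sum_congr rfl fun j hj => ?_]
  · ring
  · obtain ⟨i, rfl⟩ := Nat.exists_eq_add_of_le' (Finset.mem_Icc.1 hj).1
    have := (Finset.mem_Icc.1 hj).2
    exact D.piece_eq_piece (by omega) (by omega)

/-- The pattern is held fixed, so `level` is continuous in time, and the integral of an integrable
drift is continuous by dominated convergence. This identifies the left limit of `M` at the next
change. -/
lemma tendsto_segment (hω : Integrable fun s => D.activeDrift Y (s, ω)) (k : ℕ) (t : I) :
    Tendsto (fun u => D.segment Y k u ω) (𝓝 t) (𝓝 (D.segment Y k t ω)) := by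
  by_cases hE : ω ∈ D.activeFrom k
  swap
  · simp only [segment, Set.indicator_of_notMem hE, tendsto_const_nhds]
  simp only [segment, Set.indicator_of_mem hE]
  have hl : ∀ ρ : I, Tendsto (fun u => D.effective (D.pattern k ω) (min u ρ) ω) (𝓝 t)
      (𝓝 (D.effective (D.pattern k ω) (min t ρ) ω)) := fun ρ =>
    ((D.continuous_effective (D.pattern k ω) ω).comp
      (continuous_id.min continuous_const)).tendsto t
  refine ((hl _).sub (hl _)).sub ?_
  simp only [compensator, ← integral_indicator (D.measurableSet_segmentTimes k _ ω)]
  refine tendsto_integral_filter_of_dominated_convergence (fun s => ‖D.activeDrift Y (s, ω)‖)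
    (Eventually.of_forall fun u => (hω.indicator
      (D.measurableSet_segmentTimes k u ω)).aestronglyMeasurable)
    (Eventually.of_forall fun u => ae_of_all _ fun s => norm_indicator_le_norm_self _ _) hω.norm ?_
  have h0 : ({t} : Set I)ᶜ ∈ ae (volume : Measure I) := compl_mem_ae_iff.2 (by simp)
  filter_upwards [h0] with s hs
  refine tendsto_nhds_of_eventually_eq ?_
  rcases lt_or_gt_of_ne (show s ≠ t from hs) with h | h
  · filter_upwards [Ioi_mem_nhds h] with u hu
    have hu' : s ≤ u := (show s < u from hu).le
    simp only [Set.indicator_apply, Set.mem_ofPred_eq, hu', h.le]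
  · filter_upwards [Iio_mem_nhds h] with u hu
    have hu' : ¬ s ≤ u := not_le.2 hu
    simp only [Set.indicator_apply, Set.mem_ofPred_eq, hu', not_le.2 h]

lemma stoppedBefore_eq_add_segment (hi : Integrable fun s => D.activeDrift Y (s, ω)) {Z : I → ℝ}
    {c : ℝ} (hZ : ∀ s, D.changes s ω = k → Z s = c + D.segment Y k s ω)
    (h : k ≤ D.changes u ω) :
    stoppedBefore Z (D.changeTime (k + 1) ω) u = c + D.segment Y k u ω := by
  rcases h.eq_or_lt with heq | hlt
  · rw [D.stoppedBefore_of_changes_eq _ heq.symm, hZ u heq.symm]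
  · have hne := D.nhdsLT_switchTime_neBot hlt
    rw [D.stoppedBefore_of_lt_changes _ hlt,
      D.segment_eq_segment (u := u) hlt (D.changes_switchTime hlt).ge]
    refine leftLim_eq_of_tendsto (Tendsto.congr' ?_
      (((D.tendsto_segment hi k _).const_add c).mono_left nhdsWithin_le_nhds))
    filter_upwards [D.eventually_left_changes hlt] with s hs
    exact (hZ s hs).symm

lemma stoppedBefore_M (hi : Integrable fun s => D.activeDrift Y (s, ω)) (hω : ω ∈ D.activeFrom k)
    (h : k ≤ D.changes u ω) : stoppedBefore (fun r => D.M Y r ω) (D.changeTime (k + 1) ω) u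
      = D.M Y (D.switchTime k ω) ω + D.segment Y k u ω :=
  D.stoppedBefore_eq_add_segment hi (fun _ hs => D.M_eq hs hω) h

lemma stoppedBefore_increment (hi : Integrable fun s => D.activeDrift Y (s, ω))
    (hω : ω ∈ D.activeFrom k) (h : k ≤ D.changes u ω) :
    stoppedBefore (fun r => D.increment Y k r ω) (D.changeTime (k + 1) ω) u
      = 0 + D.segment Y k u ω := by
  refine D.stoppedBefore_eq_add_segment hi (fun s hs => ?_) h
  rw [increment, D.changeTime_untopD h, D.M_eq hs hω]
  ring

end ModulatedInformation

/-! ### Jumps at activations, and the martingale property in the given filtration. -/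

namespace ModulatedInformation

variable {Ω : Type*} [m : MeasurableSpace Ω] {P : Measure Ω} {n : ℕ}

/-- The event that some source becomes active at the `k + 1`-st state change. -/
def activated (D : ModulatedInformation P n) (k : ℕ) : Set Ω :=
  {ω | ∃ i, D.pattern (k + 1) ω i = true ∧ D.pattern k ω i = false}

/-- The jump of the effective information at the `k + 1`-st state change, if some source becomes
active then. -/
def activationJump (D : ModulatedInformation P n) (k : ℕ) : Ω → ℝ :=
  (D.activated k).indicator fun ω =>
    D.effective (D.pattern (k + 1) ω) (D.switchTime (k + 1) ω) ω
      - D.effective (D.pattern k ω) (D.switchTime (k + 1) ω) ω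

variable (D : ModulatedInformation P n) {Y : I → Ω → ℝ} {k : ℕ} {t : I} {ω : Ω}

lemma activations_finite (ω : Ω) : (D.activations ω).Finite :=
  (D.cadlag ω).finite_jumps.subset fun _ hs => D.mem_activations_jump hs

lemma switchTime_mem_activations_iff (h : k + 1 ≤ D.changes t ω) :
    D.switchTime (k + 1) ω ∈ D.activations ω ↔ ω ∈ D.activated k := by
  simp only [activations, Set.mem_ofPred_eq, D.leftLim_J_switchTime h]
  rfl

lemma activations_le_zero : {s : I | s ≤ D.switchTime 0 ω} ∩ D.activations ω = ∅ := by
  refine Set.eq_empty_of_forall_notMem fun s hs => ?_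
  have h0 : D.switchTime 0 ω = 0 := D.switchTime_eq (D.cadlag ω).pathChangeTime_zero
  obtain rfl : s = 0 := le_antisymm (h0 ▸ hs.1) unitInterval.nonneg'
  exact D.mem_activations_jump hs.2 (leftLim_zero_eq (f := fun r => D.J r ω))

lemma activations_le_succ (h : k + 1 ≤ D.changes t ω) {s : I}
    (hs : s ∈ {s : I | s ≤ D.switchTime (k + 1) ω} ∩ D.activations ω) :
    s ∈ {s : I | s ≤ D.switchTime k ω} ∩ D.activations ω ∨ s = D.switchTime (k + 1) ω := by
  by_contra hne
  obtain ⟨h1, h2⟩ := not_or.1 hne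
  have hlt : s < D.switchTime (k + 1) ω := lt_of_le_of_ne hs.1 h2
  have hgt : D.switchTime k ω < s := not_le.1 fun h => h1 ⟨h, hs.2⟩
  refine D.not_mem_activations hgt le_rfl ?_ hs.2
  rw [D.changes_switchTime (show k ≤ D.changes t ω by omega)]
  exact ((D.changes_eq_iff (hlt.trans_le unitInterval.le_one')).2 ⟨hgt.le, hlt⟩).symm

/-- Activations are among the state changes, so the sum can be built up change by change; the jump
counts only if some source is switched on at that change. -/
lemma sum_activations (h : k ≤ D.changes t ω) :
    ∑ᶠ s ∈ {s : I | s ≤ D.switchTime k ω} ∩ D.activations ω,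
      (D.xiHat s ω - Function.leftLim (fun r => D.xiHat r ω) s)
      = ∑ i ∈ Finset.range k, D.activationJump i ω := by
  induction k with
  | zero => rw [D.activations_le_zero, finsum_mem_empty, Finset.sum_range_zero]
  | succ k ih =>
    have hlt := D.switchTime_lt_succ h
    have hfin : ({s : I | s ≤ D.switchTime k ω} ∩ D.activations ω).Finite :=
      (D.activations_finite ω).subset Set.inter_subset_right
    have hnot : D.switchTime (k + 1) ω ∉ {s : I | s ≤ D.switchTime k ω} ∩ D.activations ω :=
      fun hm => absurd hlt (not_lt.2 hm.1)
    have hmono : {s : I | s ≤ D.switchTime k ω} ∩ D.activations ω ⊆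
        {s : I | s ≤ D.switchTime (k + 1) ω} ∩ D.activations ω :=
      fun s hs => ⟨le_trans hs.1 hlt.le, hs.2⟩
    rw [Finset.sum_range_succ, ← ih (by omega)]
    by_cases ha : ω ∈ D.activated k
    · have hset : {s : I | s ≤ D.switchTime (k + 1) ω} ∩ D.activations ω
          = insert (D.switchTime (k + 1) ω)
            ({s : I | s ≤ D.switchTime k ω} ∩ D.activations ω) := by
        ext s
        rw [Set.mem_insert_iff]
        refine ⟨fun hs => (D.activations_le_succ h hs).symm, ?_⟩
        rintro (rfl | hs)
        · exact ⟨show D.switchTime (k + 1) ω ≤ _ from le_rfl, (D.switchTime_mem_activations_iff h).2 ha⟩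
        · exact hmono hs
      rw [hset, finsum_mem_insert _ hnot hfin, D.leftLim_xiHat_switchTime h,
        D.xiHat_eq_effective_pattern (D.changes_switchTime h), activationJump,
        Set.indicator_of_mem ha, add_comm]
    · have hset : {s : I | s ≤ D.switchTime (k + 1) ω} ∩ D.activations ω
          = {s : I | s ≤ D.switchTime k ω} ∩ D.activations ω := by
        refine Set.Subset.antisymm (fun s hs => ?_) hmono
        refine (D.activations_le_succ h hs).resolve_right fun he => ha ?_
        rw [he] at hs
        exact (D.switchTime_mem_activations_iff h).1 hs.2
      rw [hset, activationJump, Set.indicator_of_notMem ha, add_zero]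

lemma mem_activeUpTo_iff (h : k ≤ D.changes t ω) :
    ω ∈ D.activeUpTo k ↔ ∀ i ≤ k, ω ∈ D.activeFrom i := by
  have hk := D.changes_switchTime h
  constructor
  · rintro ⟨s, hs, ha⟩ i hi
    have hi' : i ≤ D.changes t ω := hi.trans h
    refine ⟨D.switchTime i ω, D.changeTime_eq_switchTime hi', ha _ ?_⟩
    rw [← D.switchTime_eq hs]
    exact D.switchTime_le (hi.trans hk.ge)
  · intro ha
    refine ⟨D.switchTime k ω, D.changeTime_eq_switchTime h, fun r hr => ?_⟩
    have hle : D.changes r ω ≤ k := hk ▸ D.changes_mono ω hr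
    exact D.active_of_mem_activeFrom (ha _ hle) rfl

/-- If a source has been active all along, every piece is a segment. The completed ones may be
evaluated at `t` instead of the `k`-th change, which makes the expression visibly observable at `t`.
-/
lemma M_switchTime_eq (h : k ≤ D.changes t ω) (hω : ω ∈ D.activeUpTo k) :
    D.M Y (D.switchTime k ω) ω
      = ∑ i ∈ Finset.range k, (D.segment Y i t ω + D.activationJump i ω) := by
  have hk := D.changes_switchTime h
  have ha := (D.mem_activeUpTo_iff h).1 hω
  rw [M, D.sum_activations h, hk, Finset.sum_Icc_succ_top (by omega),
    D.piece_eq_segment (ha k le_rfl) hk.ge, D.segment_switchTime, add_zero, Finset.sum_add_distrib]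
  congr 1
  refine (Finset.sum_nbij' (fun i => i + 1) (fun j => j - 1) ?_ ?_ ?_ ?_ fun i hi => ?_).symm
  · intro i hi
    simp only [Finset.mem_range, Finset.mem_Icc] at hi ⊢
    omega
  · intro j hj
    simp only [Finset.mem_range, Finset.mem_Icc] at hj ⊢
    omega
  · intro i hi
    rfl
  · intro j hj
    simp only [Finset.mem_Icc] at hj
    omega
  · have hi' := Finset.mem_range.1 hi
    rw [D.piece_eq_segment (ha i hi'.le) (by omega)]
    exact D.segment_eq_segment (by omega) (by omega)

/-- Once `k + 1` changes have taken place by time `t`, both patterns that are compared have been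
seen. -/
lemma measurableSet_activated_obs {k l : ℕ} (hkl : k + 1 ≤ l) (t : I) :
    MeasurableSet[D.obsSigma t] ({ω | l ≤ D.changes t ω} ∩ D.activated k) := by
  have h : {ω | l ≤ D.changes t ω} ∩ D.activated k = {ω | l ≤ D.changes t ω} ∩ ⋃ i,
      ({ω | k + 1 ≤ D.changes t ω ∧ D.pattern (k + 1) ω ∈ {a : Fin n → Bool | a i = true}} ∩
        {ω | k ≤ D.changes t ω ∧ D.pattern k ω ∈ {a : Fin n → Bool | a i = false}}) := by
    ext ω
    refine and_congr_right fun hl => ?_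
    have hl' : l ≤ D.changes t ω := hl
    rw [Set.mem_iUnion]
    refine exists_congr fun i => ⟨fun hi => ⟨⟨by omega, hi.1⟩, ⟨by omega, hi.2⟩⟩,
      fun hi => ⟨hi.1.2, hi.2.2⟩⟩
  rw [h]
  refine @MeasurableSet.inter _ (D.obsSigma t) _ _ (D.measurableSet_le_changes_obs l t)
    (@MeasurableSet.iUnion _ _ (D.obsSigma t) _ _ fun i => ?_)
  exact @MeasurableSet.inter _ (D.obsSigma t) _ _ (D.measurableSet_pattern_obs (k + 1) t _)
    (D.measurableSet_pattern_obs k t _)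

lemma measurable_activationJump_obs {k l : ℕ} (hkl : k + 1 ≤ l) (t : I) :
    Measurable[D.obsSigma t] ({ω | l ≤ D.changes t ω}.indicator (D.activationJump k)) := by
  have h1 := D.measurable_effective_obs_of_approx (k := k + 1) (k' := k + 1) (t := t)
    fun ω hω ε hε => D.exists_dense_near_switchTime hω hε
  have h0 := D.measurable_effective_obs_of_approx (k := k) (k' := k + 1) (t := t)
    fun ω hω ε hε => D.exists_dense_near_switchTime_succ hω hε
  have h2 := (h1.sub h0).indicator (D.measurableSet_activated_obs hkl t)
  convert h2 using 1
  ext ω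
  by_cases hl : ω ∈ {ω | l ≤ D.changes t ω}
  · have hl' : l ≤ D.changes t ω := hl
    have hk : k + 1 ≤ D.changes t ω := by omega
    have hk1 : ω ∈ {ω | k + 1 ≤ D.changes t ω} := hk
    have hk0 : ω ∈ {ω | k ≤ D.changes t ω} := show k ≤ D.changes t ω by omega
    rw [Set.indicator_of_mem hl, activationJump]
    by_cases ha : ω ∈ D.activated k
    · rw [Set.indicator_of_mem ha, Set.indicator_of_mem (show ω ∈ {ω | l ≤ D.changes t ω} ∩
        D.activated k from ⟨hl, ha⟩)]
      simp only [Pi.sub_apply, Set.indicator_of_mem hk1, Set.indicator_of_mem hk0,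
        min_eq_right (D.switchTime_le hk)]
    · rw [Set.indicator_of_notMem ha, Set.indicator_of_notMem fun h => ha h.2]
  · rw [Set.indicator_of_notMem hl, Set.indicator_of_notMem fun h => hl h.1]

lemma measurableSet_activated (k : ℕ) : MeasurableSet (D.activated k) := by
  have h : ∀ k, Measurable (D.pattern k) := fun k =>
    (D.measurable_pattern_switch k).mono D.switchSigma_le le_rfl
  exact ((h (k + 1)).prodMk (h k)) (Set.toFinite {p : (Fin n → Bool) × (Fin n → Bool) |
    ∃ i, p.1 i = true ∧ p.2 i = false}).measurableSet

lemma measurableSet_activeUpTo_obs (k : ℕ) (t : I) :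
    MeasurableSet[D.obsSigma t] (D.activeUpTo k ∩ {ω | k ≤ D.changes t ω}) := by
  have h : D.activeUpTo k ∩ {ω | k ≤ D.changes t ω} = {ω | k ≤ D.changes t ω} ∩
      ⋂ i : Fin (k + 1), (D.activeFrom i ∩ {ω | (i : ℕ) ≤ D.changes t ω}) := by
    ext ω
    rw [Set.inter_comm]
    refine and_congr_right fun hk => ?_
    have hk' : k ≤ D.changes t ω := hk
    rw [D.mem_activeUpTo_iff hk', Set.mem_iInter]
    exact ⟨fun h i => ⟨h i (by omega), show (i : ℕ) ≤ D.changes t ω by omega⟩,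
      fun h i hi => (h ⟨i, by omega⟩).1⟩
  rw [h]
  exact @MeasurableSet.inter _ (D.obsSigma t) _ _ (D.measurableSet_le_changes_obs k t)
    (@MeasurableSet.iInter _ _ (D.obsSigma t) _ _ fun i => D.measurableSet_activeFrom_obs i t)

lemma setOf_changeTime_le (k : ℕ) (t : I) :
    {ω | D.changeTime k ω ≤ t} = {ω | k ≤ D.changes t ω} := by
  ext ω
  exact D.changeTime_le_iff

lemma isStoppingTime_changeTime (k : ℕ) : IsStoppingTime D.filtration (D.changeTime k) := fun t => by
  rw [D.setOf_changeTime_le]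
  exact D.obsSigma_le_filtration t _ (D.measurableSet_le_changes_obs k t)

variable [IsProbabilityMeasure P]

lemma integrable_activationJump (k : ℕ) : Integrable (D.activationJump k) P :=
  ((D.integrable_effective_random (k + 1) (D.measurable_switchTime_switch (k + 1))).sub
    (D.integrable_effective_random k (D.measurable_switchTime_switch (k + 1)))).indicator
    (D.measurableSet_activated k)

variable [P.IsComplete] {D}

/-- On an event known at time `t` the stopped process is a quantity `W t`, known at `t`, plus a
segment. As `W t` stays the same when `u` varies, the claim reduces to `condExp_segment`; equality
almost surely suffices because null events belong to the filtration. -/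
theorem IsBestEstimate.isMartingaleOn (hY : D.IsBestEstimate Y) (k : ℕ) {Z : I → Ω → ℝ}
    {A : Set Ω} {W : I → Ω → ℝ}
    (hA : ∀ t, MeasurableSet[D.obsSigma t] (A ∩ {ω | k ≤ D.changes t ω}))
    (hWm : ∀ t, Measurable[D.obsSigma t] (W t)) (hWi : ∀ t, Integrable (W t) P)
    (hZ : ∀ t u, t ≤ u → ∀ᵐ ω ∂P, ω ∈ A ∩ {ω | k ≤ D.changes t ω} →
      stoppedBefore (fun r => Z r ω) (D.changeTime (k + 1) ω) u = W t ω + D.segment Y k u ω) :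
    IsMartingaleOn Z (D.changeTime k) (D.changeTime (k + 1)) A D.filtration P := by
  have hle := D.obsSigma_le_filtration
  have hA' : ∀ t, MeasurableSet[D.filtration t] (A ∩ {ω | k ≤ D.changes t ω}) :=
    fun t => hle t _ (hA t)
  have hAm : ∀ t, MeasurableSet (A ∩ {ω | k ≤ D.changes t ω}) :=
    fun t => D.filtration.le t _ (hA' t)
  have heq : ∀ t u, t ≤ u → ((A ∩ {ω | k ≤ D.changes t ω}).indicator fun ω =>
      stoppedBefore (fun r => Z r ω) (D.changeTime (k + 1) ω) u)
      =ᵐ[P] (A ∩ {ω | k ≤ D.changes t ω}).indicator (W t + D.segment Y k u) := fun t u htu => by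
    filter_upwards [hZ t u htu] with ω hω
    by_cases h : ω ∈ A ∩ {ω | k ≤ D.changes t ω}
    · rw [Set.indicator_of_mem h, Set.indicator_of_mem h, hω h, Pi.add_apply]
    · rw [Set.indicator_of_notMem h, Set.indicator_of_notMem h]
  have hint : ∀ t u, Integrable (W t + D.segment Y k u) P := fun t u =>
    (hWi t).add (hY.integrable_segment k u)
  refine ⟨D.isStoppingTime_changeTime k, D.isStoppingTime_changeTime (k + 1), fun t => ?_,
    fun t => ?_, fun t => ?_, fun t u htu => ?_⟩
  all_goals rw [D.setOf_changeTime_le]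
  · exact hA' t
  · have h := ((hWm t).add (hY.measurable_segment_obs k t)).indicator (hA t)
    exact ((measurable_of_ae_eq_of_null_le le_sup_right h (heq t t le_rfl)).mono (hle t)
      le_rfl).stronglyMeasurable
  · exact ((hint t t).indicator (hAm t)).congr (heq t t le_rfl).symm
  · have h1 := condExp_congr_ae (m := D.filtration t) (heq t u htu)
    have h2 := condExp_indicator (hint t u) (hA' t)
    have h3 := condExp_add (hWi t) (hY.integrable_segment k u) (D.filtration t)
    have h4 := hY.condExp_segment k htu
    have h5 : P[W t | D.filtration t] = W t := condExp_of_stronglyMeasurable (D.filtration.le t)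
      ((hWm t).mono (hle t) le_rfl).stronglyMeasurable (hWi t)
    refine h1.trans (h2.trans (EventuallyEq.trans ?_ (heq t t le_rfl).symm))
    filter_upwards [h3, h4] with ω e3 e4
    by_cases h : ω ∈ A ∩ {ω | k ≤ D.changes t ω}
    · rw [Set.indicator_of_mem h, Set.indicator_of_mem h, e3, Pi.add_apply, Pi.add_apply, h5, e4]
    · rw [Set.indicator_of_notMem h, Set.indicator_of_notMem h]

theorem IsBestEstimate.ae_integrableOn_drift (hY : D.IsBestEstimate Y) (k : ℕ) :
    ∀ᵐ ω ∂P, ω ∈ D.activeFrom k → IntegrableOn (fun s : I => D.drift Y s ω)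
      {s : I | D.changeTime k ω ≤ s ∧ (s : WithTop I) < D.changeTime (k + 1) ω} := by
  filter_upwards [hY.ae_integrable_activeDrift] with ω hi hω
  have h : {s : I | D.changeTime k ω ≤ s ∧ (s : WithTop I) < D.changeTime (k + 1) ω}
      = {s : I | D.changes s ω = k} := by
    ext s
    exact D.changes_eq_iff_changeTime.symm
  rw [h]
  exact (hi.integrableOn (s := {s : I | D.changes s ω = k})).congr_fun
    (fun s hs => (D.drift_eq_activeDrift hω hs).symm)
    ((D.changes_mono ω).measurable (measurableSet_singleton k))

theorem IsBestEstimate.isMartingaleOn_increment (hY : D.IsBestEstimate Y) (k : ℕ) :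
    IsMartingaleOn (D.increment Y k) (D.changeTime k) (D.changeTime (k + 1)) (D.activeFrom k)
      D.filtration P := by
  refine hY.isMartingaleOn k (W := fun _ _ => 0) (D.measurableSet_activeFrom_obs k)
    (fun t => measurable_const) (fun t => integrable_zero _ _ _) fun t u htu => ?_
  filter_upwards [hY.ae_integrable_activeDrift] with ω hi hω
  exact D.stoppedBefore_increment hi hω.1 (le_trans hω.2 (D.changes_mono ω htu))

theorem IsBestEstimate.isMartingaleOn_M (hY : D.IsBestEstimate Y) (k : ℕ) :
    IsMartingaleOn (D.M Y) (D.changeTime k) (D.changeTime (k + 1)) (D.activeUpTo k)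
      D.filtration P := by
  -- The value of `M` at the `k`-th change is the sum of the earlier segments and activation jumps.
  -- The indicator confines the jumps to the event that this change has occurred by `t`, which makes
  -- them observable.
  refine hY.isMartingaleOn k (W := fun t ω => ∑ i ∈ Finset.range k, (D.segment Y i t ω +
    {ω | k ≤ D.changes t ω}.indicator (D.activationJump i) ω))
    (D.measurableSet_activeUpTo_obs k) (fun t => ?_) (fun t => ?_) fun t u htu => ?_
  · exact Finset.measurable_fun_sum _ fun i hi => (hY.measurable_segment_obs i t).add
      (D.measurable_activationJump_obs (Finset.mem_range.1 hi) t)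
  · exact integrable_finsetSum _ fun i _ => (hY.integrable_segment i t).add
      ((D.integrable_activationJump i).indicator
        (D.obsSigma_le t _ (D.measurableSet_le_changes_obs k t)))
  · filter_upwards [hY.ae_integrable_activeDrift] with ω hi hω
    have hk : k ≤ D.changes t ω := hω.2
    rw [D.stoppedBefore_M hi ((D.mem_activeUpTo_iff hk).1 hω.1 k le_rfl)
      (hk.trans (D.changes_mono ω htu)), D.M_switchTime_eq hk hω.1]
    simp only [Set.indicator_of_mem hω.2]

end ModulatedInformation

end

theorem mainTheorem7 {Ω : Type*} [MeasurableSpace Ω] (P : Measure Ω) [IsProbabilityMeasure P]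
    [P.IsComplete] (n : ℕ) (D : ModulatedInformation P n) :
    (∃ Y : I → Ω → ℝ, D.IsBestEstimate Y) ∧
    ∀ Y : I → Ω → ℝ, D.IsBestEstimate Y → ∀ j : ℕ, 1 ≤ j →
      (∀ᵐ ω ∂P, ω ∈ D.activeFrom (j - 1) →
        IntegrableOn (fun s : I => D.drift Y s ω)
          {s : I | D.changeTime (j - 1) ω ≤ s ∧ (s : WithTop I) < D.changeTime j ω}) ∧
      IsMartingaleOn (D.increment Y (j - 1)) (D.changeTime (j - 1)) (D.changeTime j)
        (D.activeFrom (j - 1)) D.filtration P ∧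
      IsMartingaleOn (D.M Y) (D.changeTime (j - 1)) (D.changeTime j)
        (D.activeUpTo (j - 1)) D.filtration P := by
  refine ⟨⟨D.estimate, D.isBestEstimate_estimate⟩, fun Y hY j hj => ?_⟩
  obtain ⟨k, rfl⟩ := Nat.exists_eq_add_of_le' hj
  rw [Nat.add_sub_cancel]
  exact ⟨hY.ae_integrableOn_drift k, hY.isMartingaleOn_increment k, hY.isMartingaleOn_M k⟩
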